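/- Let $\mathcal S=\{1,\dots,m\}$, let $\Theta\subseteq\mathbb R^p$ be open, and for each $\theta\in\Theta$ let ${\bf T}(\theta)=[T_{ij}(\theta)]$ be the generator of a continuous-time Markov chain $\varphi$ on $\mathcal S$ and let $c_i(\theta)\in\mathbb R$, $i\in\mathcal S$, be fluid rates, such that the sets $\mathcal S_+=\{i:c_i(\theta)>0\}$, $\mathcal S_-=\{i:c_i(\theta)<0\}$, $\mathcal S_0=\{i:c_i(\theta)=0\}$ do not depend on $\theta\in\Theta$. Consider the fluid model without boundary, $\frac{d}{dt}\widetilde X(t)=c_{\varphi(t)}(\theta)$, put $\widetilde\delta=\inf\{t>0:\widetilde X(t)=0\}$ and, for ${\rm Re}(s)>0$, let ${\bf\Xi}(s;\theta)=[\Xi_{ij}(s;\theta)]_{i\in\mathcal S_-,j\in\mathcal S_+}$ with $$\Xi_{ij}(s;\theta)=\mathbb E\big(e^{-s\widetilde\delta}\,I(\widetilde\delta<\infty,\ \varphi(\widetilde\delta)=j)\ \big|\ \widetilde X(0)=0,\ \varphi(0)=i\big).$$ With ${\bf T}_{ab}=[T_{ij}]_{i\in\mathcal S_a,j\in\mathcal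 S_b}$ for $a,b\in\{+,-,0\}$, ${\bf C}_\pm={\rm diag}(c_i)_{i\in\mathcal S_\pm}$, and $[a=b]$ equal to $1$ if $a=b$ and to $0$ otherwise, let, for $a,b\in\{+,-\}$, $${\bf Q}_{ab}(s;\theta)=|{\bf C}_a|^{-1}\big({\bf T}_{ab}-[a=b]\,s{\bf I}-{\bf T}_{a0}({\bf T}_{00}-s{\bf I})^{-1}{\bf T}_{0b}\big),$$ $${\bf J}(s;\theta)={\bf Q}_{--}+{\bf\Xi}\,{\bf Q}_{+-},\qquad {\bf U}(s;\theta)={\bf Q}_{++}+{\bf Q}_{+-}{\bf\Xi}.$$ For a matrix function ${\bf M}(\theta)$ write $\frac{\partial {\bf M}}{\partial\theta}=\big[\frac{\partial {\bf M}}{\partial\theta_1}\,\big|\,\cdots\,\big|\,\frac{\partial {\bf M}}{\partial\theta_p}\big]$, and let $\otimes$ be the Kronecker product. Theorem. Let ${\rm Re}(s)>0$ and let $\theta\in\Theta$ be a point at which all $T_{ij}$ and $c_i$ are differentiable. Then the entries of ${\bf\Xi}(s;\cdot)$ are differentiable at $\theta$, and $\frac{\partial}{\partial\theta}{\bf\Xi}(s;\theta)$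 is the unique solution ${\bf X}$ (among the complex $|\mathcal S_-|\times p|\mathcal S_+|$ matrices) of $${\bf A}{\bf X}+{\bf X}{\bf B}=-{\bf D},$$ where, with ${\bf I}={\bf I}_p$, $${\bf A}={\bf J}(s;\theta),\qquad {\bf B}={\bf I}\otimes{\bf U}(s;\theta),$$ $${\bf D}=\frac{\partial{\bf Q}_{-+}}{\partial\theta}+\frac{\partial{\bf Q}_{--}}{\partial\theta}({\bf I}\otimes{\bf\Xi})+{\bf\Xi}\,\frac{\partial{\bf Q}_{++}}{\partial\theta}+{\bf\Xi}\Big\{\frac{\partial{\bf Q}_{+-}}{\partial\theta}({\bf I}\otimes{\bf\Xi})\Big\},$$ all evaluated at $(s;\theta)$. -/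

import Mathlib

open MeasureTheory ProbabilityTheory
open scoped Kronecker

noncomputable section

namespace FluidModel

/-- `T` is the generator of a continuous-time Markov chain on the phases `Fin m`. -/
def IsGenerator {m : ℕ} (T : Matrix (Fin m) (Fin m) ℝ) : Prop :=
  (∀ i j, i ≠ j → 0 ≤ T i j) ∧ ∀ i, ∑ j, T i j = 0

/-! ### The phase process, through its jump chain and its holding times -/

/-- The weights of the jumps out of phase `i`: the rates `T i j`, `j ≠ i`. -/
def jumpWeight {m : ℕ} (T : Matrix (Fin m) (Fin m) ℝ) (i j : Fin m) : ENNReal :=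
  if j = i then 0 else ENNReal.ofReal (T i j)

theorem tsum_jumpWeight_ne_top {m : ℕ} (T : Matrix (Fin m) (Fin m) ℝ) (i : Fin m) :
    ∑' j, jumpWeight T i j ≠ ⊤ := by
  rw [tsum_fintype]
  refine ENNReal.sum_ne_top.2 fun j _ => ?_
  unfold jumpWeight
  split_ifs
  · exact ENNReal.zero_ne_top
  · exact ENNReal.ofReal_ne_top

open Classical in
/-- The law of the next phase visited after phase `i`. For a generator `T` this is
`T i j / (-T i i)` for `j ≠ i`, and the point mass at `i` if `i` is absorbing. -/
def jumpPMF {m : ℕ} (T : Matrix (Fin m) (Fin m) ℝ) (i : Fin m) : PMF (Fin m) :=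
  if h : ∑' j, jumpWeight T i j = 0 then PMF.pure i
  else PMF.normalize (jumpWeight T i) h (tsum_jumpWeight_ne_top T i)

/-- A trajectory: the `n`-th term consists of the `n`-th phase visited and of a unit-rate
exponential clock, which is turned into the time spent there by `sojourn`. -/
abbrev Path (m : ℕ) : Type := ℕ → Fin m × ℝ

/-- The law of a phase drawn from `ν` together with an independent unit-rate exponential clock. -/
def phaseClock {m : ℕ} (ν : PMF (Fin m)) : Measure (Fin m × ℝ) :=
  ν.toMeasure.prod (expMeasure 1)

instance {m : ℕ} (ν : PMF (Fin m)) : IsProbabilityMeasure (phaseClock ν) := by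
  have := isProbabilityMeasure_expMeasure one_pos
  unfold phaseClock
  infer_instance

/-- Given the past up to step `n`, the next phase is drawn by the jump chain from the `n`-th phase,
and the next clock is independent of everything else. -/
def stepKernel {m : ℕ} (T : Matrix (Fin m) (Fin m) ℝ) (n : ℕ) :
    Kernel (Π _ : Finset.Iic n, Fin m × ℝ) (Fin m × ℝ) :=
  (Kernel.ofFunOfCountable fun i : Fin m => phaseClock (jumpPMF T i)).comap
    (fun h => (h ⟨n, Finset.mem_Iic.2 le_rfl⟩).1)
    (measurable_fst.comp (measurable_pi_apply _))

instance {m : ℕ} (T : Matrix (Fin m) (Fin m) ℝ) (n : ℕ) : IsMarkovKernel (stepKernel T n) := by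
  refine ⟨fun h => ?_⟩
  rw [stepKernel, Kernel.comap_apply]
  change IsProbabilityMeasure (phaseClock _)
  infer_instance

/-- The law of the trajectory of the phase process with generator `T` started in phase `i`. -/
def pathLaw {m : ℕ} (T : Matrix (Fin m) (Fin m) ℝ) (i : Fin m) : Measure (Path m) :=
  Kernel.trajMeasure (X := fun _ => Fin m × ℝ) (phaseClock (PMF.pure i)) (stepKernel T)

/-- The time spent at the `n`-th visited phase `i`: exponential of rate `-T i i`, which means
`∞` if that rate is `0`. -/
def sojourn {m : ℕ} (T : Matrix (Fin m) (Fin m) ℝ) (ω : Path m) (n : ℕ) : ENNReal :=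
  ENNReal.ofReal (ω n).2 / ENNReal.ofReal (-T (ω n).1 (ω n).1)

/-- The time of the `n`-th jump (`jumpTime T ω 0 = 0`). -/
def jumpTime {m : ℕ} (T : Matrix (Fin m) (Fin m) ℝ) (ω : Path m) (n : ℕ) : ENNReal :=
  ∑ k ∈ Finset.range n, sojourn T ω k

/-- `φ(t)`: the `n`-th visited phase, where `n` is the number of jumps in `[0, t]`. -/
def phase {m : ℕ} (T : Matrix (Fin m) (Fin m) ℝ) (ω : Path m) (t : ℝ) : Fin m :=
  (ω (sInf {n : ℕ | ENNReal.ofReal t < jumpTime T ω (n + 1)})).1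

/-- The level of the fluid model without boundary: `dX/dt = c_{φ(t)}`, started at `X(0) = 0`. -/
def level {m : ℕ} (T : Matrix (Fin m) (Fin m) ℝ) (c : Fin m → ℝ) (ω : Path m) (t : ℝ) : ℝ :=
  ∫ u in (0 : ℝ)..t, c (phase T ω u)

/-- The times `t > 0` at which the level is `0`; the first return time is their infimum. -/
def returnTimes {m : ℕ} (T : Matrix (Fin m) (Fin m) ℝ) (c : Fin m → ℝ) (ω : Path m) : Set ℝ :=
  {t | 0 < t ∧ level T c ω t = 0}

open Classical in
/-- `exp (-s δ) · I(φ(δ) = j)`, where `δ` is the first return time to level `0`; it is `0` on the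
paths that never return (`δ = ∞`). -/
def returnFunctional {m : ℕ} (T : Matrix (Fin m) (Fin m) ℝ) (c : Fin m → ℝ) (s : ℂ) (j : Fin m)
    (ω : Path m) : ℂ :=
  if (returnTimes T c ω).Nonempty ∧ phase T ω (sInf (returnTimes T c ω)) = j
  then Complex.exp (-s * ((sInf (returnTimes T c ω) : ℝ) : ℂ))
  else 0

/-! ### The matrices of the model

The sign pattern `σ` of the rates partitions the phases into those of positive, negative and
zero rate. -/

/-- The phases of positive rate. -/
abbrev SPos {m : ℕ} (σ : Fin m → SignType) : Type := {i : Fin m // σ i = 1}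

/-- The phases of negative rate. -/
abbrev SNeg {m : ℕ} (σ : Fin m → SignType) : Type := {i : Fin m // σ i = -1}

/-- The phases of rate zero. -/
abbrev SZero {m : ℕ} (σ : Fin m → SignType) : Type := {i : Fin m // σ i = 0}

/-- The matrix `Ξ(s)` of the Laplace transforms of the first return time to level `0` from below,
`Ξ(s)_{ij} = E(exp(-s δ) I(φ(δ) = j) | X(0) = 0, φ(0) = i)`. -/
def Xi {m : ℕ} (σ : Fin m → SignType) (T : Matrix (Fin m) (Fin m) ℝ) (c : Fin m → ℝ) (s : ℂ) :
    Matrix (SNeg σ) (SPos σ) ℂ :=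
  Matrix.of fun i j => ∫ ω, returnFunctional T c s j.1 ω ∂(pathLaw T i.1)

/-- The block `[T i j]` with rows in `{i // P i}` and columns in `{j // R j}`. -/
def block {m : ℕ} (T : Matrix (Fin m) (Fin m) ℝ) (P R : Fin m → Prop) :
    Matrix {i // P i} {j // R j} ℂ :=
  Matrix.of fun i j => ((T i.1 j.1 : ℝ) : ℂ)

/-- The diagonal matrix `|C|⁻¹` on the phases in `{i // P i}`. -/
def absRateInv {m : ℕ} (c : Fin m → ℝ) (P : Fin m → Prop) : Matrix {i // P i} {i // P i} ℂ :=
  Matrix.diagonal fun i => ((|c i.1|⁻¹ : ℝ) : ℂ)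

/-- `(T₀₀ - s I)⁻¹`. -/
def zeroResolvent {m : ℕ} (σ : Fin m → SignType) (T : Matrix (Fin m) (Fin m) ℝ) (s : ℂ) :
    Matrix (SZero σ) (SZero σ) ℂ :=
  (block T (σ · = 0) (σ · = 0) - s • (1 : Matrix (SZero σ) (SZero σ) ℂ))⁻¹

/-- `Q₊₊(s) = C₊⁻¹ (T₊₊ - s I - T₊₀ (T₀₀ - s I)⁻¹ T₀₊)`. -/
def Qpp {m : ℕ} (σ : Fin m → SignType) (T : Matrix (Fin m) (Fin m) ℝ) (c : Fin m → ℝ) (s : ℂ) :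
    Matrix (SPos σ) (SPos σ) ℂ :=
  absRateInv c (σ · = 1) *
    (block T (σ · = 1) (σ · = 1) - s • (1 : Matrix (SPos σ) (SPos σ) ℂ)
      - block T (σ · = 1) (σ · = 0) * zeroResolvent σ T s * block T (σ · = 0) (σ · = 1))

/-- `Q₊₋(s) = C₊⁻¹ (T₊₋ - T₊₀ (T₀₀ - s I)⁻¹ T₀₋)`. -/
def Qpm {m : ℕ} (σ : Fin m → SignType) (T : Matrix (Fin m) (Fin m) ℝ) (c : Fin m → ℝ) (s : ℂ) :
    Matrix (SPos σ) (SNeg σ) ℂ :=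
  absRateInv c (σ · = 1) *
    (block T (σ · = 1) (σ · = -1)
      - block T (σ · = 1) (σ · = 0) * zeroResolvent σ T s * block T (σ · = 0) (σ · = -1))

/-- `Q₋₋(s) = |C₋|⁻¹ (T₋₋ - s I - T₋₀ (T₀₀ - s I)⁻¹ T₀₋)`. -/
def Qmm {m : ℕ} (σ : Fin m → SignType) (T : Matrix (Fin m) (Fin m) ℝ) (c : Fin m → ℝ) (s : ℂ) :
    Matrix (SNeg σ) (SNeg σ) ℂ :=
  absRateInv c (σ · = -1) *
    (block T (σ · = -1) (σ · = -1) - s • (1 : Matrix (SNeg σ) (SNeg σ) ℂ)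
      - block T (σ · = -1) (σ · = 0) * zeroResolvent σ T s * block T (σ · = 0) (σ · = -1))

/-- `Q₋₊(s) = |C₋|⁻¹ (T₋₊ - T₋₀ (T₀₀ - s I)⁻¹ T₀₊)`. -/
def Qmp {m : ℕ} (σ : Fin m → SignType) (T : Matrix (Fin m) (Fin m) ℝ) (c : Fin m → ℝ) (s : ℂ) :
    Matrix (SNeg σ) (SPos σ) ℂ :=
  absRateInv c (σ · = -1) *
    (block T (σ · = -1) (σ · = 1)
      - block T (σ · = -1) (σ · = 0) * zeroResolvent σ T s * block T (σ · = 0) (σ · = 1))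

/-- `J(s) = Q₋₋(s) + Ξ(s) Q₊₋(s)`. -/
def J {m : ℕ} (σ : Fin m → SignType) (T : Matrix (Fin m) (Fin m) ℝ) (c : Fin m → ℝ) (s : ℂ) :
    Matrix (SNeg σ) (SNeg σ) ℂ :=
  Qmm σ T c s + Xi σ T c s * Qpm σ T c s

/-- `U(s) = Q₊₊(s) + Q₊₋(s) Ξ(s)`. -/
def U {m : ℕ} (σ : Fin m → SignType) (T : Matrix (Fin m) (Fin m) ℝ) (c : Fin m → ℝ) (s : ℂ) :
    Matrix (SPos σ) (SPos σ) ℂ :=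
  Qpp σ T c s + Qpm σ T c s * Xi σ T c s

/-- The derivative `∂A/∂θ = [∂A/∂θ₁ | … | ∂A/∂θ_p]` of a matrix function with respect to the
parameter vector: the entry in row `i` and column `(k, j)` is `∂A_{ij}/∂θ_k`. -/
def matDeriv {p : ℕ} {α β : Type} (A : (Fin p → ℝ) → Matrix α β ℂ) (θ : Fin p → ℝ) :
    Matrix α (Fin p × β) ℂ :=
  Matrix.of fun i kj => fderiv ℝ (fun η => A η i kj.2) θ (Pi.single kj.1 1)

end FluidModel

end

noncomputable section

namespace FluidModel

/-! ### The Markov property of the path law -/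

section Markov

variable {m : ℕ}

/-! Differentiating the Riccati equation Q₋₊ + Q₋₋Ξ + ΞQ₊₊ + ΞQ₊₋Ξ = 0 by the product rule and
collecting the terms with ∂Ξ gives the Sylvester equation at once. What needs proof is that Ξ, an
expectation over trajectories, solves the Riccati equation (`riccati_Xi`), that X ↦ JX + XU is
injective (`sylvester_injective`), and that Ξ is differentiable (`differentiableAt_Xi`).

All three rest on one uniqueness principle, `IsFluidSolution.eq_zero`. A solution of cᵢyᵢ' = (Ty)ᵢ -
s yᵢ on [0, ∞) of slow exponential growth, whose components of positive rate start at 0, must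
vanish. Indeed, solving each equation for yᵢ in terms of the other components (forwards from 0 if cᵢ
> 0, backwards from ∞ if cᵢ < 0, algebraically if cᵢ = 0) shrinks every growth bound by a fixed
factor below 1, thanks to Re s > 0.

Probability enters through the discounted first passage transforms up to height x. Conditioning on
the first sojourn gives a Volterra equation, hence the system above (`isFluidSolution_passageVec`).
The transforms are bounded, and at x = 0 they equal the identity on the positive phases and Ξ on the
negative ones. Eliminating the phases of rate zero leaves a system with constant coefficients Q. The
derivative of a bounded solution is again a bounded solution, so uniqueness expresses it through its
initial value (`passage_deriv_eq`). At x = 0 this is the Riccati equation, and it also shows that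
the transforms between positive phases are exp(xU), so this semigroup is bounded. Conversely a
Riccati solution Y with exp(x(Q₊₊ + Q₊₋Y)) bounded yields bounded solutions of the system, hence Y =
Ξ.

If JX + XU = 0, varying Ξ in the direction X produces a solution of linear growth with zero positive
part at 0 and negative part X there; it vanishes, so X = 0. Continuity of Ξ follows from compactness
and the characterization of Ξ among Riccati solutions. Differentiability follows by subtracting the
Riccati equations at η and θ and inverting the Sylvester operator. This uses differentiability of T
and c at the single point θ only. -/

/-- The path with first term `a` followed by the path `ω`. -/
def consPath (a : Fin m × ℝ) (ω : Path m) : Path m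
  | 0 => a
  | n + 1 => ω n

/-- The path without its first term. -/
def tailPath (ω : Path m) : Path m := fun n => ω (n + 1)

@[simp] theorem consPath_zero (a : Fin m × ℝ) (ω : Path m) : consPath a ω 0 = a := rfl

@[simp] theorem consPath_succ (a : Fin m × ℝ) (ω : Path m) (n : ℕ) :
    consPath a ω (n + 1) = ω n := rfl

@[fun_prop]
theorem measurable_consPath :
    Measurable fun p : (Fin m × ℝ) × Path m => consPath p.1 p.2 := by
  refine measurable_pi_lambda _ fun n => ?_
  cases n with
  | zero => exact measurable_fst
  | succ n => exact (measurable_pi_apply n).comp measurable_snd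

@[fun_prop]
theorem measurable_tailPath : Measurable (tailPath (m := m)) :=
  measurable_pi_lambda _ fun n => measurable_pi_apply (n + 1)

/-- The law of the trajectory whose first phase is drawn from `ν`. -/
def pathLawFrom (T : Matrix (Fin m) (Fin m) ℝ) (ν : PMF (Fin m)) : Measure (Path m) :=
  Kernel.trajMeasure (X := fun _ => Fin m × ℝ) (phaseClock ν) (stepKernel T)

theorem pathLaw_eq (T : Matrix (Fin m) (Fin m) ℝ) (i : Fin m) :
    pathLaw T i = pathLawFrom T (PMF.pure i) := rfl

instance (T : Matrix (Fin m) (Fin m) ℝ) (ν : PMF (Fin m)) :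
    IsProbabilityMeasure (pathLawFrom T ν) := by
  unfold pathLawFrom; infer_instance

instance (T : Matrix (Fin m) (Fin m) ℝ) (i : Fin m) :
    IsProbabilityMeasure (pathLaw T i) := by
  rw [pathLaw_eq]; infer_instance

theorem stepKernel_apply (T : Matrix (Fin m) (Fin m) ℝ) (n : ℕ)
    (h : Π _ : Finset.Iic n, Fin m × ℝ) :
    stepKernel T n h = phaseClock (jumpPMF T (h ⟨n, Finset.mem_Iic.2 le_rfl⟩).1) := rfl

theorem pathLawFrom_map_zero (T : Matrix (Fin m) (Fin m) ℝ) (ν : PMF (Fin m)) :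
    (pathLawFrom T ν).map (fun ω => ω 0) = phaseClock ν := by
  have h : (fun ω : Path m => ω 0)
      = (MeasurableEquiv.piUnique (fun _ : Finset.Iic 0 => Fin m × ℝ)) ∘
        Preorder.frestrictLe (π := fun _ => Fin m × ℝ) 0 := by
    ext ω <;> rfl
  rw [h, ← Measure.map_map (by fun_prop) (by fun_prop), pathLawFrom, Kernel.trajMeasure,
    Measure.map_comp _ _ (by fun_prop), Kernel.traj_map_frestrictLe, Kernel.partialTraj_self,
    Measure.id_comp, Measure.map_map (by fun_prop) (by fun_prop)]
  exact Measure.map_id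

/-- The defining disintegration of the trajectory measure, written for integrals so that it can be
compared with the hypothesis of `eq_pathLawFrom`. -/
theorem lintegral_pathLawFrom_step (T : Matrix (Fin m) (Fin m) ℝ) (ν : PMF (Fin m)) (n : ℕ)
    {f : (Π _ : Finset.Iic n, Fin m × ℝ) × (Fin m × ℝ) → ENNReal} (hf : Measurable f) :
    ∫⁻ ω, f (Preorder.frestrictLe (π := fun _ => Fin m × ℝ) n ω, ω (n + 1)) ∂pathLawFrom T ν
      = ∫⁻ ω, ∫⁻ y, f (Preorder.frestrictLe (π := fun _ => Fin m × ℝ) n ω, y)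
          ∂phaseClock (jumpPMF T (ω n).1) ∂pathLawFrom T ν := by
  have h := Kernel.map_frestrictLe_trajMeasure_compProd_eq_map_trajMeasure
    (X := fun _ => Fin m × ℝ) (μ₀ := phaseClock ν) (κ := stepKernel T) (a := n)
  rw [← lintegral_map (f := f)
    (g := fun ω : Path m => (Preorder.frestrictLe (π := fun _ => Fin m × ℝ) n ω, ω (n + 1)))
    hf (by fun_prop)]
  change ∫⁻ a, f a ∂((Kernel.trajMeasure (X := fun _ => Fin m × ℝ) (phaseClock ν)
    (stepKernel T)).map _) = _
  rw [← h, Measure.lintegral_compProd hf, lintegral_map (by fun_prop) (by fun_prop)]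
  rfl

/-- The law of a trajectory is determined by its first term and its transition
probabilities. -/
theorem eq_pathLawFrom (T : Matrix (Fin m) (Fin m) ℝ) (ν : PMF (Fin m)) (ρ : Measure (Path m))
    [IsProbabilityMeasure ρ] (h0 : ρ.map (fun ω => ω 0) = phaseClock ν)
    (hs : ∀ n (f : (Π _ : Finset.Iic n, Fin m × ℝ) × (Fin m × ℝ) → ENNReal), Measurable f →
      ∫⁻ ω, f (Preorder.frestrictLe (π := fun _ => Fin m × ℝ) n ω, ω (n + 1)) ∂ρ
        = ∫⁻ ω, ∫⁻ y, f (Preorder.frestrictLe (π := fun _ => Fin m × ℝ) n ω, y)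
          ∂phaseClock (jumpPMF T (ω n).1) ∂ρ) :
    ρ = pathLawFrom T ν := by
  have key : ∀ n, ρ.map (Preorder.frestrictLe (π := fun _ => Fin m × ℝ) n)
      = (pathLawFrom T ν).map (Preorder.frestrictLe (π := fun _ => Fin m × ℝ) n) := by
    intro n
    induction n with
    | zero =>
      have h : Preorder.frestrictLe (π := fun _ => Fin m × ℝ) 0
          = (MeasurableEquiv.piUnique (fun _ : Finset.Iic 0 => Fin m × ℝ)).symm ∘
            (fun ω : Path m => ω 0) := by
        funext ω
        refine (MeasurableEquiv.piUnique (fun _ : Finset.Iic 0 => Fin m × ℝ)).injective ?_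
        rw [Function.comp_apply, MeasurableEquiv.apply_symm_apply]
        rfl
      rw [h, ← Measure.map_map (by fun_prop) (by fun_prop),
        ← Measure.map_map (by fun_prop) (by fun_prop), h0, pathLawFrom_map_zero]
    | succ n ih =>
      -- `G` appends the next term to an initial segment, so the law of the longer segment is an
      -- integral of the law of the shorter one against the step kernel.
      let G : (Π _ : Finset.Iic n, Fin m × ℝ) × (Fin m × ℝ) →
          (Π _ : Finset.Iic (n + 1), Fin m × ℝ) :=
        fun p k => if hk : k.1 ≤ n then p.1 ⟨k.1, Finset.mem_Iic.2 hk⟩ else p.2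
      have hG : Measurable G := by
        refine measurable_pi_lambda _ fun k => ?_
        by_cases hk : k.1 ≤ n
        · simp only [G, hk, dite_true]; fun_prop
        · simp only [G, hk, dite_false]; fun_prop
      have hGe : ∀ ω : Path m, Preorder.frestrictLe (π := fun _ => Fin m × ℝ) (n + 1) ω
          = G (Preorder.frestrictLe (π := fun _ => Fin m × ℝ) n ω, ω (n + 1)) := by
        intro ω
        funext k
        by_cases hk : k.1 ≤ n
        · simp [G, hk]
        · have : k.1 = n + 1 := by have := Finset.mem_Iic.1 k.2; lia
          simp [G, this]
      refine Measure.ext_of_lintegral _ fun f hf => ?_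
      rw [lintegral_map hf (by fun_prop), lintegral_map hf (by fun_prop)]
      simp only [hGe]
      rw [hs n (fun p => f (G p)) (hf.comp hG),
        lintegral_pathLawFrom_step T ν n (f := fun p => f (G p)) (hf.comp hG)]
      have hm : Measurable fun h : (Π _ : Finset.Iic n, Fin m × ℝ) =>
          ∫⁻ y, f (G (h, y)) ∂stepKernel T n h :=
        Measurable.lintegral_kernel_prod_right' (f := fun p => f (G p)) (hf.comp hG)
      have h1 := lintegral_map (μ := ρ) hm
        (Preorder.measurable_frestrictLe (X := fun _ => Fin m × ℝ) n)
      have h2 := lintegral_map (μ := pathLawFrom T ν) hm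
        (Preorder.measurable_frestrictLe (X := fun _ => Fin m × ℝ) n)
      rw [ih] at h1
      exact h1.symm.trans h2
  -- Every finite index set lies in an initial segment, so equality there gives equality of all
  -- finite-dimensional marginals.
  refine IsProjectiveLimit.unique (ι := ℕ) (α := fun _ => Fin m × ℝ)
    (P := fun I => (pathLawFrom T ν).map I.restrict) (fun I => ?_) (fun I => rfl)
  have hI := I.subset_Iic_sup_id
  have hc : I.restrict (π := fun _ : ℕ => Fin m × ℝ) = (Finset.restrict₂ (π := fun _ : ℕ => Fin m × ℝ) hI) ∘
      Preorder.frestrictLe (π := fun _ => Fin m × ℝ) (I.sup id) := rfl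
  have hm : Measurable (Finset.restrict₂ (π := fun _ : ℕ => Fin m × ℝ) hI) :=
    Finset.measurable_restrict₂ hI
  change _ = (pathLawFrom T ν).map (I.restrict (π := fun _ : ℕ => Fin m × ℝ))
  rw [hc, ← Measure.map_map hm (by fun_prop), key, Measure.map_map hm (by fun_prop)]

/-- The law of the remaining trajectory given its first term. -/
def tailKernel (T : Matrix (Fin m) (Fin m) ℝ) : Kernel (Fin m × ℝ) (Path m) :=
  (Kernel.ofFunOfCountable fun i : Fin m => pathLawFrom T (jumpPMF T i)).comap
    Prod.fst measurable_fst

theorem tailKernel_apply (T : Matrix (Fin m) (Fin m) ℝ) (a : Fin m × ℝ) :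
    tailKernel T a = pathLawFrom T (jumpPMF T a.1) := rfl

instance (T : Matrix (Fin m) (Fin m) ℝ) : IsMarkovKernel (tailKernel T) := by
  refine ⟨fun a => ?_⟩
  rw [tailKernel_apply]
  infer_instance

/-- The Markov property at the first jump. The glued law has the right first term and the right
transition probabilities, and `eq_pathLawFrom` says that these determine it. -/
theorem pathLawFrom_eq_map_compProd (T : Matrix (Fin m) (Fin m) ℝ) (ν : PMF (Fin m)) :
    pathLawFrom T ν
      = (phaseClock ν ⊗ₘ tailKernel T).map (fun p => consPath p.1 p.2) := by
  have hI : IsProbabilityMeasure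
      ((phaseClock ν ⊗ₘ tailKernel T).map (fun p => consPath p.1 p.2)) :=
    Measure.isProbabilityMeasure_map (by fun_prop)
  have hl : ∀ f : Path m → ENNReal, Measurable f →
      ∫⁻ ω, f ω ∂((phaseClock ν ⊗ₘ tailKernel T).map (fun p => consPath p.1 p.2))
        = ∫⁻ a, ∫⁻ ω, f (consPath a ω) ∂pathLawFrom T (jumpPMF T a.1) ∂phaseClock ν := by
    intro f hf
    rw [lintegral_map hf (by fun_prop), Measure.lintegral_compProd (by fun_prop)]
    rfl
  refine (eq_pathLawFrom T ν _ ?_ ?_).symm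
  · rw [Measure.map_map (by fun_prop) (by fun_prop)]
    exact Measure.fst_compProd (phaseClock ν) (tailKernel T)
  · intro n f hf
    have hm : Measurable fun ω : Path m =>
        ∫⁻ y, f (Preorder.frestrictLe (π := fun _ => Fin m × ℝ) n ω, y)
          ∂stepKernel T n (Preorder.frestrictLe (π := fun _ => Fin m × ℝ) n ω) :=
      (Measurable.lintegral_kernel_prod_right' (κ := stepKernel T n) hf).comp
        (Preorder.measurable_frestrictLe (X := fun _ => Fin m × ℝ) n)
    rw [hl (fun ω => f (Preorder.frestrictLe (π := fun _ => Fin m × ℝ) n ω, ω (n + 1)))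
      (by fun_prop)]
    refine Eq.trans ?_ (hl _ hm).symm
    refine lintegral_congr fun a => ?_
    cases n with
    | zero =>
      have hr : ∀ ω : Path m, Preorder.frestrictLe (π := fun _ => Fin m × ℝ) 0 (consPath a ω)
          = fun _ => a := by
        intro ω
        funext k
        have : k.1 = 0 := by have := Finset.mem_Iic.1 k.2; lia
        simp [this]
      simp only [hr, stepKernel_apply, consPath_succ]
      rw [lintegral_const, measure_univ, mul_one, ← pathLawFrom_map_zero T (jumpPMF T a.1),
        lintegral_map (by fun_prop) (by fun_prop)]
    | succ n =>
      let C : (Π _ : Finset.Iic n, Fin m × ℝ) → (Π _ : Finset.Iic (n + 1), Fin m × ℝ) :=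
        fun h k => if hk : k.1 = 0 then a else
          h ⟨k.1 - 1, Finset.mem_Iic.2 (by have := Finset.mem_Iic.1 k.2; lia)⟩
      have hC : Measurable C := by
        refine measurable_pi_lambda _ fun k => ?_
        by_cases hk : k.1 = 0
        · simp only [C, hk, dite_true]; fun_prop
        · simp only [C, hk, dite_false]; fun_prop
      have hCe : ∀ ω : Path m,
          Preorder.frestrictLe (π := fun _ => Fin m × ℝ) (n + 1) (consPath a ω)
            = C (Preorder.frestrictLe (π := fun _ => Fin m × ℝ) n ω) := by
        intro ω
        funext k
        obtain ⟨k, hk⟩ := k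
        cases k with
        | zero => simp [C]
        | succ k => simp [C]
      simp only [hCe, consPath_succ]
      rw [lintegral_pathLawFrom_step T _ n
        (f := fun p => f (C p.1, p.2)) (hf.comp (by fun_prop))]
      refine lintegral_congr fun ω => ?_
      rw [stepKernel_apply]
      simp [C]

theorem lintegral_phaseClock (ν : PMF (Fin m)) {f : Fin m × ℝ → ENNReal} (hf : Measurable f) :
    ∫⁻ a, f a ∂phaseClock ν = ∑ k, ν k * ∫⁻ e, f (k, e) ∂expMeasure 1 := by
  have := isProbabilityMeasure_expMeasure one_pos
  rw [phaseClock, lintegral_prod _ hf.aemeasurable, lintegral_fintype]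
  refine Finset.sum_congr rfl fun k _ => ?_
  rw [PMF.toMeasure_apply_singleton _ _ (measurableSet_singleton k), mul_comm]

theorem lintegral_pathLawFrom (T : Matrix (Fin m) (Fin m) ℝ) (ν : PMF (Fin m))
    {f : Path m → ENNReal} (hf : Measurable f) :
    ∫⁻ ω, f ω ∂pathLawFrom T ν
      = ∑ k, ν k * ∫⁻ e, ∫⁻ ω, f (consPath (k, e) ω) ∂pathLawFrom T (jumpPMF T k)
        ∂expMeasure 1 := by
  rw [pathLawFrom_eq_map_compProd, lintegral_map hf (by fun_prop),
    Measure.lintegral_compProd (by fun_prop), lintegral_phaseClock]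
  · rfl
  · exact Measurable.lintegral_kernel_prod_right' (κ := tailKernel T)
      (f := fun p => f (consPath p.1 p.2)) (by fun_prop)

/-- The law with a random first phase is the mixture of the laws with a fixed first phase. -/
theorem pathLawFrom_eq_sum (T : Matrix (Fin m) (Fin m) ℝ) (ν : PMF (Fin m)) :
    pathLawFrom T ν = ∑ k, ν k • pathLaw T k := by
  refine Measure.ext_of_lintegral _ fun f hf => ?_
  rw [lintegral_finsetSum_measure, lintegral_pathLawFrom T ν hf]
  refine Finset.sum_congr rfl fun k _ => ?_
  rw [lintegral_smul_measure, smul_eq_mul, pathLaw_eq, lintegral_pathLawFrom T _ hf,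
    Finset.sum_eq_single k]
  · simp
  · intro b _ hb; simp [hb]
  · simp

theorem lintegral_pathLaw (T : Matrix (Fin m) (Fin m) ℝ) (i : Fin m)
    {f : Path m → ENNReal} (hf : Measurable f) :
    ∫⁻ ω, f ω ∂pathLaw T i
      = ∫⁻ e, ∑ k, jumpPMF T i k * ∫⁻ ω, f (consPath (i, e) ω) ∂pathLaw T k ∂expMeasure 1 := by
  rw [pathLaw_eq, lintegral_pathLawFrom T _ hf, Finset.sum_eq_single i]
  · simp [pathLawFrom_eq_sum, lintegral_finsetSum_measure]
  · intro b _ hb; simp [hb]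
  · simp

/-- First-step decomposition of the law of the trajectory. -/
theorem integral_pathLaw (T : Matrix (Fin m) (Fin m) ℝ) (i : Fin m)
    {f : Path m → ℂ} (hf : Measurable f) {C : ℝ} (hC : ∀ ω, ‖f ω‖ ≤ C) :
    ∫ ω, f ω ∂pathLaw T i
      = ∫ e, ∑ k, ((jumpPMF T i k).toReal : ℂ) * ∫ ω, f (consPath (i, e) ω) ∂pathLaw T k
        ∂expMeasure 1 := by
  have := isProbabilityMeasure_expMeasure one_pos
  have hfi : Integrable (fun p : (Fin m × ℝ) × Path m => f (consPath p.1 p.2))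
      (phaseClock (PMF.pure i) ⊗ₘ tailKernel T) :=
    Integrable.of_bound (hf.comp (by fun_prop)).aestronglyMeasurable C (Filter.Eventually.of_forall fun _ => hC _)
  rw [pathLaw_eq, pathLawFrom_eq_map_compProd, integral_map (by fun_prop)
    hf.aestronglyMeasurable, Measure.integral_compProd hfi]
  rw [phaseClock, PMF.toMeasure_pure, Measure.dirac_prod, integral_map (by fun_prop)]
  · refine integral_congr_ae (Filter.Eventually.of_forall fun e => ?_)
    simp only [tailKernel_apply, pathLawFrom_eq_sum]
    rw [integral_finsetSum_measure]
    · refine Finset.sum_congr rfl fun k _ => ?_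
      rw [integral_smul_measure, Complex.real_smul]
    · intro k _
      refine Integrable.smul_measure ?_ (PMF.apply_ne_top _ _)
      exact Integrable.of_bound (hf.comp (by fun_prop)).aestronglyMeasurable C (Filter.Eventually.of_forall fun _ => hC _)
  · refine StronglyMeasurable.aestronglyMeasurable ?_
    exact StronglyMeasurable.integral_kernel_prod_right' (κ := tailKernel T)
      (f := fun p => f (consPath p.1 p.2)) (Measurable.stronglyMeasurable (by fun_prop))

end Markov

/-! ### The first passage functional, jump by jump -/

section Passage

variable {m : ℕ}

/-- The contribution of the first sojourn `a = (i, e)` to the first passage up to height `x`,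
where `v` is the contribution of the rest of the path if the height is not reached at once. -/
def passageStep (T : Matrix (Fin m) (Fin m) ℝ) (c : Fin m → ℝ) (s : ℂ) (j : Fin m) (x : ℝ)
    (a : Fin m × ℝ) (v : ℂ) : ℂ :=
  -- These cases do not arise from x ≥ 0 along positive clocks; the value 0 keeps the functional
  -- bounded by 1 for every argument.
  if x < 0 ∨ a.2 ≤ 0 then 0
  -- Multiplying out the rate lets the same test cover absorbing phases, whose sojourn is infinite.
  -- The inequality is strict: a height reached exactly at a jump is passed on as height 0, which is
  -- a null event in the cases used. At x = 0 a positive rate crosses immediately, with value 1 or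
  -- 0.
  else if 0 < c a.1 ∧ x * -T a.1 a.1 < c a.1 * a.2 then
    if a.1 = j then Complex.exp (-s * ((x / c a.1 : ℝ) : ℂ)) else 0
  else if T a.1 a.1 = 0 then 0
  else Complex.exp (-s * ((a.2 / -T a.1 a.1 : ℝ) : ℂ)) * v

/-- The height left to climb after the first sojourn `a`. -/
def heightAfter (T : Matrix (Fin m) (Fin m) ℝ) (c : Fin m → ℝ) (x : ℝ) (a : Fin m × ℝ) : ℝ :=
  x - c a.1 * (a.2 / -T a.1 a.1)

/-- The discounted indicator of a first passage up to height `x` in phase `j` during the first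
`N` sojourns. -/
def passage (T : Matrix (Fin m) (Fin m) ℝ) (c : Fin m → ℝ) (s : ℂ) (j : Fin m) :
    ℕ → ℝ → Path m → ℂ
  | 0, _, _ => 0
  | N + 1, x, ω => passageStep T c s j x (ω 0)
      (passage T c s j N (heightAfter T c x (ω 0)) (tailPath ω))

variable (T : Matrix (Fin m) (Fin m) ℝ) (c : Fin m → ℝ) (s : ℂ) (j : Fin m)

theorem passage_succ (N : ℕ) (x : ℝ) (ω : Path m) :
    passage T c s j (N + 1) x ω = passageStep T c s j x (ω 0)
      (passage T c s j N (heightAfter T c x (ω 0)) (tailPath ω)) := rfl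

/-- A nonzero value means that the passage has occurred, and later sojourns do not matter. Hence
each path gives a sequence that is 0 and then constant, and the limit exists without exceptional
sets. -/
theorem passage_succ_eq {N : ℕ} {x : ℝ} {ω : Path m} (h : passage T c s j N x ω ≠ 0) :
    passage T c s j (N + 1) x ω = passage T c s j N x ω := by
  induction N generalizing x ω with
  | zero => exact absurd rfl h
  | succ N ih =>
    rw [passage_succ T c s j (N + 1) x ω, passage_succ T c s j N x ω]
    by_cases hv : passage T c s j N (heightAfter T c x (ω 0)) (tailPath ω) = 0
    · rw [passage_succ, hv] at h
      rw [hv]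
      unfold passageStep at h ⊢
      split_ifs at h ⊢ <;> simp_all
    · rw [ih hv]

theorem passage_eq_of_le {N M : ℕ} (hNM : N ≤ M) {x : ℝ} {ω : Path m}
    (h : passage T c s j N x ω ≠ 0) : passage T c s j M x ω = passage T c s j N x ω := by
  induction M, hNM using Nat.le_induction with
  | base => rfl
  | succ M _ ih => rw [passage_succ_eq T c s j (by rwa [ih]), ih]

theorem exists_tendsto_passage (x : ℝ) (ω : Path m) :
    ∃ L, Filter.Tendsto (fun N => passage T c s j N x ω) Filter.atTop (nhds L) := by
  by_cases h : ∃ N, passage T c s j N x ω ≠ 0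
  · obtain ⟨N, hN⟩ := h
    refine ⟨passage T c s j N x ω, tendsto_const_nhds.congr' ?_⟩
    filter_upwards [Filter.eventually_ge_atTop N] with M hM
    exact (passage_eq_of_le T c s j hM hN).symm
  · push Not at h
    exact ⟨0, by simp [h]⟩

/-- The discounted indicator of a first passage up to height `x` in phase `j`. -/
def passageLim (x : ℝ) (ω : Path m) : ℂ := (exists_tendsto_passage T c s j x ω).choose

theorem tendsto_passage (x : ℝ) (ω : Path m) :
    Filter.Tendsto (fun N => passage T c s j N x ω) Filter.atTop
      (nhds (passageLim T c s j x ω)) :=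
  (exists_tendsto_passage T c s j x ω).choose_spec

/-- Limit of the recursion in N, since `passageStep` is continuous in its last argument. -/
theorem passageLim_eq (x : ℝ) (ω : Path m) :
    passageLim T c s j x ω = passageStep T c s j x (ω 0)
      (passageLim T c s j (heightAfter T c x (ω 0)) (tailPath ω)) := by
  have h1 := (Filter.tendsto_add_atTop_iff_nat 1).2 (tendsto_passage T c s j x ω)
  have hc : Continuous fun v => passageStep T c s j x (ω 0) v := by
    unfold passageStep
    split_ifs <;> fun_prop
  exact tendsto_nhds_unique h1 ((hc.tendsto _).comp (tendsto_passage T c s j _ _))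

variable {T c s j}

theorem norm_exp_neg_mul_le (hs : 0 < s.re) {y : ℝ} (hy : 0 ≤ y) :
    ‖Complex.exp (-s * (y : ℂ))‖ ≤ 1 := by
  rw [Complex.norm_exp]
  simp only [Complex.mul_re, Complex.neg_re, Complex.ofReal_re, Complex.ofReal_im, mul_zero,
    sub_zero]
  exact Real.exp_le_one_iff.2 (by nlinarith)

theorem norm_passageStep_le (hs : 0 < s.re) (hT : ∀ i, T i i ≤ 0) (x : ℝ) (a : Fin m × ℝ)
    {v : ℂ} (hv : ‖v‖ ≤ 1) : ‖passageStep T c s j x a v‖ ≤ 1 := by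
  unfold passageStep
  split_ifs with h1 h2 h3 h4
  · simp
  · push Not at h1
    exact norm_exp_neg_mul_le hs (div_nonneg h1.1 h2.1.le)
  · simp
  · simp
  · push Not at h1
    rw [norm_mul]
    exact mul_le_one₀ (norm_exp_neg_mul_le hs
      (div_nonneg h1.2.le (neg_nonneg.2 (hT _)))) (norm_nonneg _) hv

theorem norm_passage_le (hs : 0 < s.re) (hT : ∀ i, T i i ≤ 0) (N : ℕ) (x : ℝ) (ω : Path m) :
    ‖passage T c s j N x ω‖ ≤ 1 := by
  induction N generalizing x ω with
  | zero => simp [passage]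
  | succ N ih => exact norm_passageStep_le hs hT x _ (ih _ _)

theorem norm_passageLim_le (hs : 0 < s.re) (hT : ∀ i, T i i ≤ 0) (x : ℝ) (ω : Path m) :
    ‖passageLim T c s j x ω‖ ≤ 1 :=
  le_of_tendsto (tendsto_passage T c s j x ω).norm
    (Filter.Eventually.of_forall fun N => norm_passage_le hs hT N x ω)

variable (T c s j)

@[fun_prop]
theorem measurable_heightAfter :
    Measurable fun p : ℝ × (Fin m × ℝ) => heightAfter T c p.1 p.2 := by
  have h1 : Measurable fun p : ℝ × (Fin m × ℝ) => c p.2.1 :=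
    (measurable_of_finite c).comp (by fun_prop)
  have h2 : Measurable fun p : ℝ × (Fin m × ℝ) => T p.2.1 p.2.1 :=
    (measurable_of_finite fun i => T i i).comp (f := fun p : ℝ × (Fin m × ℝ) => p.2.1)
      (by fun_prop)
  unfold heightAfter
  fun_prop

@[fun_prop]
theorem measurable_passageStep :
    Measurable fun p : ℝ × (Fin m × ℝ) × ℂ => passageStep T c s j p.1 p.2.1 p.2.2 := by
  have h1 : Measurable fun p : ℝ × (Fin m × ℝ) × ℂ => c p.2.1.1 :=
    (measurable_of_finite c).comp (by fun_prop)
  have h2 : Measurable fun p : ℝ × (Fin m × ℝ) × ℂ => T p.2.1.1 p.2.1.1 :=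
    (measurable_of_finite fun i => T i i).comp (f := fun p : ℝ × (Fin m × ℝ) × ℂ => p.2.1.1)
      (by fun_prop)
  have h3 : Measurable fun p : ℝ × (Fin m × ℝ) × ℂ => p.2.1.1 := by fun_prop
  have h4 : Measurable fun p : ℝ × (Fin m × ℝ) × ℂ => p.2.1.2 := by fun_prop
  unfold passageStep
  refine Measurable.ite ?_ measurable_const (Measurable.ite ?_ (Measurable.ite ?_ ?_
    measurable_const) (Measurable.ite ?_ measurable_const ?_))
  · exact (measurableSet_lt measurable_fst measurable_const).union
      (measurableSet_le h4 measurable_const)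
  · exact (measurableSet_lt measurable_const h1).inter
      (measurableSet_lt (measurable_fst.mul h2.neg) (h1.mul h4))
  · exact h3 (measurableSet_singleton j)
  · fun_prop
  · exact h2 (measurableSet_singleton 0)
  · fun_prop

theorem measurable_passage (N : ℕ) :
    Measurable fun p : ℝ × Path m => passage T c s j N p.1 p.2 := by
  induction N with
  | zero => exact measurable_const
  | succ N ih =>
    have h0 : Measurable fun p : ℝ × Path m => p.2 0 := by fun_prop
    have h1 : Measurable fun p : ℝ × Path m =>
        passage T c s j N (heightAfter T c p.1 (p.2 0)) (tailPath p.2) :=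
      ih.comp (((measurable_heightAfter T c).comp (measurable_fst.prodMk h0)).prodMk
        (measurable_tailPath.comp measurable_snd))
    exact (measurable_passageStep T c s j).comp (measurable_fst.prodMk (h0.prodMk h1))

theorem measurable_passageLim :
    Measurable fun p : ℝ × Path m => passageLim T c s j p.1 p.2 :=
  measurable_of_tendsto_metrizable (measurable_passage T c s j)
    (tendsto_pi_nhds.2 fun p => tendsto_passage T c s j p.1 p.2)

/-- The Laplace transform of the first passage time up to height `x`, started in phase `i`,
on the event that the passage occurs in phase `j`. -/
def passageTransform (i : Fin m) (x : ℝ) : ℂ :=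
  ∫ ω, passageLim T c s j x ω ∂pathLaw T i

theorem measurable_passageTransform (i : Fin m) : Measurable (passageTransform T c s j i) :=
  (StronglyMeasurable.integral_prod_right'
    (measurable_passageLim T c s j).stronglyMeasurable).measurable

variable {T c s j}

theorem norm_passageTransform_le (hs : 0 < s.re) (hT : ∀ i, T i i ≤ 0) (i : Fin m) (x : ℝ) :
    ‖passageTransform T c s j i x‖ ≤ 1 := by
  refine (norm_integral_le_of_norm_le_const (C := 1)
    (Filter.Eventually.of_forall fun ω => norm_passageLim_le hs hT x ω)).trans ?_
  simp

theorem sum_jumpPMF (i : Fin m) : ∑ k, (jumpPMF T i k).toReal = 1 := by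
  have h := (jumpPMF T i).tsum_coe
  rw [tsum_fintype] at h
  rw [← ENNReal.toReal_sum fun k _ => PMF.apply_ne_top _ _, h, ENNReal.toReal_one]

/-- The first-step equation. -/
theorem passageTransform_eq (hs : 0 < s.re) (hT : ∀ i, T i i ≤ 0) (i : Fin m) (x : ℝ) :
    passageTransform T c s j i x = ∫ e, passageStep T c s j x (i, e)
      (∑ k, ((jumpPMF T i k).toReal : ℂ) *
        passageTransform T c s j k (heightAfter T c x (i, e))) ∂expMeasure 1 := by
  rw [passageTransform, integral_pathLaw T i (f := passageLim T c s j x)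
    ((measurable_passageLim T c s j).comp measurable_prodMk_left)
    (fun ω => norm_passageLim_le hs hT x ω)]
  refine integral_congr_ae (Filter.Eventually.of_forall fun e => ?_)
  have h1 : ∑ k, ((jumpPMF T i k).toReal : ℂ) = 1 := by
    exact_mod_cast congrArg (fun r : ℝ => (r : ℂ)) (sum_jumpPMF (T := T) i)
  have h2 : ∀ k, ∫ ω, passageLim T c s j x (consPath (i, e) ω) ∂pathLaw T k
      = passageStep T c s j x (i, e)
        (passageTransform T c s j k (heightAfter T c x (i, e))) := by
    intro k
    have : ∀ ω, passageLim T c s j x (consPath (i, e) ω) = passageStep T c s j x (i, e)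
        (passageLim T c s j (heightAfter T c x (i, e)) ω) := fun ω => passageLim_eq ..
    simp only [this]
    unfold passageStep passageTransform
    split_ifs <;> simp [integral_const_mul]
  simp only [h2]
  unfold passageStep
  split_ifs
  · simp
  -- On immediate passage the value does not depend on the next phase, and the jump probabilities
  -- sum to 1.
  · rw [← Finset.sum_mul, h1, one_mul]
  · simp
  · simp
  · rw [Finset.mul_sum]
    exact Finset.sum_congr rfl fun k _ => by ring

end Passage

/-! ### The unit-rate exponential law -/

theorem expMeasure_one_eq : expMeasure 1
    = (volume.restrict (Set.Ioi (0 : ℝ))).withDensity fun e => ENNReal.ofReal (Real.exp (-e)) := by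
  have h : expMeasure 1 = volume.withDensity (exponentialPDF 1) := rfl
  rw [h, ← withDensity_indicator measurableSet_Ioi]
  refine withDensity_congr_ae ?_
  filter_upwards [compl_mem_ae_iff.2 (measure_singleton (0 : ℝ))] with e he
  rw [exponentialPDF_eq]
  rcases lt_or_gt_of_ne (show e ≠ 0 from he) with h0 | h0
  · simp [h0.not_ge, h0.le]
  · simp [h0.le, h0]

theorem integral_expMeasure_one (f : ℝ → ℂ) :
    ∫ e, f e ∂expMeasure 1 = ∫ e in Set.Ioi (0 : ℝ), Complex.exp (-(e : ℂ)) * f e := by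
  rw [expMeasure_one_eq, integral_withDensity_eq_integral_toReal_smul (by fun_prop)
    (Filter.Eventually.of_forall fun _ => ENNReal.ofReal_lt_top)]
  refine integral_congr_ae (Filter.Eventually.of_forall fun e => ?_)
  simp only
  rw [ENNReal.toReal_ofReal (Real.exp_pos _).le, Complex.real_smul]
  push_cast
  rfl

theorem ae_expMeasure_one_pos : ∀ᵐ e ∂expMeasure 1, 0 < e := by
  rw [expMeasure_one_eq]
  exact (withDensity_absolutelyContinuous _ _).ae_le (ae_restrict_mem measurableSet_Ioi)

theorem ae_expMeasure_one_ne (a : ℝ) : ∀ᵐ e ∂expMeasure 1, e ≠ a := by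
  rw [expMeasure_one_eq]
  refine (withDensity_absolutelyContinuous _ _).ae_le (ae_restrict_of_ae ?_)
  exact compl_mem_ae_iff.2 (measure_singleton a)

theorem lintegral_exp_neg_expMeasure_one :
    ∫⁻ e, ENNReal.ofReal (Real.exp (-e)) ∂expMeasure 1 = ENNReal.ofReal (1 / 2) := by
  rw [expMeasure_one_eq, lintegral_withDensity_eq_lintegral_mul _ (by fun_prop) (by fun_prop)]
  have h1 : ∀ e : ℝ, ((fun e => ENNReal.ofReal (Real.exp (-e))) *
      fun e => ENNReal.ofReal (Real.exp (-e))) e = ENNReal.ofReal (Real.exp (-2 * e)) := by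
    intro e
    rw [Pi.mul_apply, ← ENNReal.ofReal_mul (Real.exp_pos _).le, ← Real.exp_add]
    congr 2; ring
  simp only [h1]
  rw [← ofReal_integral_eq_lintegral_ofReal (integrableOn_exp_mul_Ioi (by norm_num) 0)
    (Filter.Eventually.of_forall fun _ => (Real.exp_pos _).le),
    integral_exp_mul_Ioi (by norm_num)]
  norm_num

/-! ### Almost sure properties of the trajectories -/

section AlmostSure

variable {m : ℕ} (T : Matrix (Fin m) (Fin m) ℝ)

/-- First-step principle for almost sure events, which makes them accessible to induction over the
number of jumps. -/
theorem ae_pathLaw_of_forall (i : Fin m) {p : Path m → Prop} (hp : MeasurableSet {ω | p ω})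
    (h : ∀ᵐ e ∂expMeasure 1, ∀ k, ∀ᵐ ω ∂pathLaw T k, p (consPath (i, e) ω)) :
    ∀ᵐ ω ∂pathLaw T i, p ω := by
  have hm : Measurable ({ω : Path m | p ω}ᶜ.indicator (1 : Path m → ENNReal)) :=
    measurable_one.indicator hp.compl
  rw [ae_iff]
  change pathLaw T i {ω | p ω}ᶜ = 0
  rw [← lintegral_indicator_one hp.compl, lintegral_pathLaw T i hm]
  refine (lintegral_congr_ae (g := fun _ => 0) ?_).trans (by simp)
  filter_upwards [h] with e he
  refine Finset.sum_eq_zero fun k _ => ?_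
  rw [lintegral_congr_ae (g := fun _ => 0), lintegral_zero, mul_zero]
  filter_upwards [he k] with ω hω
  simp [hω]

theorem ae_clock_pos (i : Fin m) : ∀ᵐ ω ∂pathLaw T i, ∀ n, 0 < (ω n).2 := by
  rw [ae_all_iff]
  intro n
  induction n generalizing i with
  | zero =>
    refine ae_pathLaw_of_forall T i (measurableSet_lt measurable_const (by fun_prop)) ?_
    filter_upwards [ae_expMeasure_one_pos] with e he k
    exact Filter.Eventually.of_forall fun ω => he
  | succ n ih =>
    refine ae_pathLaw_of_forall T i (measurableSet_lt measurable_const (by fun_prop)) ?_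
    exact Filter.Eventually.of_forall fun e k => ih k

/-- Each clock contributes the factor E(exp(-e)) = 1/2, whatever the phase, so the product decays
geometrically. -/
theorem lintegral_prod_exp_neg_clock (i : Fin m) (n : ℕ) :
    ∫⁻ ω, ∏ k ∈ Finset.range n, ENNReal.ofReal (Real.exp (-(ω k).2)) ∂pathLaw T i
      = ENNReal.ofReal (1 / 2) ^ n := by
  induction n generalizing i with
  | zero => simp
  | succ n ih =>
    rw [lintegral_pathLaw T i (by fun_prop)]
    simp only [Finset.prod_range_succ', consPath_zero, consPath_succ]
    have h1 : ∀ (e : ℝ) k, ∫⁻ ω, (∏ k ∈ Finset.range n, ENNReal.ofReal (Real.exp (-(ω k).2))) *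
        ENNReal.ofReal (Real.exp (-e)) ∂pathLaw T k
        = ENNReal.ofReal (1 / 2) ^ n * ENNReal.ofReal (Real.exp (-e)) := by
      intro e k
      rw [lintegral_mul_const _ (by fun_prop), ih]
    have h2 : ∑ k, jumpPMF T i k = 1 := by
      have h := (jumpPMF T i).tsum_coe
      rwa [tsum_fintype] at h
    simp only [h1, ← Finset.sum_mul, h2, one_mul]
    rw [lintegral_const_mul _ (by fun_prop), lintegral_exp_neg_expMeasure_one, pow_succ]

/-- Markov's inequality applied to exp of minus the clock sum: the probability that the sum of n
clocks stays below C is at most exp(C)/2ⁿ. -/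
theorem ae_exists_lt_sum_clock (i : Fin m) :
    ∀ᵐ ω ∂pathLaw T i, ∀ C : ℕ, ∃ n, (C : ℝ) < ∑ k ∈ Finset.range n, (ω k).2 := by
  rw [ae_all_iff]
  intro C
  rw [ae_iff]
  push Not
  have h : ∀ n, ENNReal.ofReal (Real.exp (-C)) *
      pathLaw T i {ω | ∀ n, ∑ k ∈ Finset.range n, (ω k).2 ≤ C} ≤ ENNReal.ofReal (1 / 2) ^ n := by
    intro n
    rw [← lintegral_prod_exp_neg_clock T i n]
    refine le_trans ?_ (mul_meas_ge_le_lintegral (μ := pathLaw T i)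
      (f := fun ω : Path m => ∏ k ∈ Finset.range n, ENNReal.ofReal (Real.exp (-(ω k).2)))
      (by fun_prop) (ENNReal.ofReal (Real.exp (-C))))
    gcongr
    intro h
    rw [← ENNReal.ofReal_prod_of_nonneg fun _ _ => (Real.exp_pos _).le, ← Real.exp_sum]
    refine ENNReal.ofReal_le_ofReal (Real.exp_le_exp.2 ?_)
    rw [Finset.sum_neg_distrib]
    exact neg_le_neg (h n)
  have h0 : ENNReal.ofReal (Real.exp (-C)) *
      pathLaw T i {ω | ∀ n, ∑ k ∈ Finset.range n, (ω k).2 ≤ C} ≤ 0 :=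
    ge_of_tendsto' (ENNReal.tendsto_pow_atTop_nhds_zero_of_lt_one
      (by rw [ENNReal.ofReal_lt_one]; norm_num)) h
  rw [nonpos_iff_eq_zero, mul_eq_zero] at h0
  refine h0.resolve_left ?_
  simp [Real.exp_pos]

/-- The trajectories with positive clocks and finitely many jumps in bounded time. -/
def IsRegularPath (ω : Path m) : Prop :=
  (∀ n, 0 < (ω n).2) ∧ ∀ t : ℝ, ∃ n, ENNReal.ofReal t < jumpTime T ω n

/-- No explosion: the rates are bounded, so the jump times dominate a multiple of the clock sums,
which are unbounded. -/
theorem ae_isRegularPath (hT : ∀ i, T i i ≤ 0) (i : Fin m) :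
    ∀ᵐ ω ∂pathLaw T i, IsRegularPath T ω := by
  filter_upwards [ae_clock_pos T i, ae_exists_lt_sum_clock T i] with ω h1 h2
  refine ⟨h1, fun t => ?_⟩
  -- The summand 1 keeps `Λ` positive when all phases are absorbing.
  set Λ : ℝ := 1 + ∑ i, -T i i with hΛ
  have hs : ∀ i, -T i i ≤ Λ := fun i =>
    (Finset.single_le_sum (f := fun i => -T i i)
      (fun i _ => neg_nonneg.2 (hT i)) (Finset.mem_univ i)).trans (by linarith)
  have hΛ0 : 0 < Λ := by
    have := Finset.sum_nonneg (s := Finset.univ) (f := fun i => -T i i)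
      (fun i _ => neg_nonneg.2 (hT i))
    linarith
  obtain ⟨C, hC⟩ := exists_nat_gt (max t 0 * Λ)
  obtain ⟨n, hn⟩ := h2 C
  refine ⟨n, ?_⟩
  have h3 : ENNReal.ofReal ((∑ k ∈ Finset.range n, (ω k).2) / Λ) ≤ jumpTime T ω n := by
    rw [Finset.sum_div, ENNReal.ofReal_sum_of_nonneg fun k _ => div_nonneg (h1 k).le hΛ0.le]
    refine Finset.sum_le_sum fun k _ => ?_
    rw [ENNReal.ofReal_div_of_pos hΛ0, sojourn]
    gcongr
    exact hs _
  refine lt_of_lt_of_le ?_ h3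
  have h4 : max t 0 < (∑ k ∈ Finset.range n, (ω k).2) / Λ := by
    rw [lt_div_iff₀ hΛ0]; linarith
  exact (ENNReal.ofReal_lt_ofReal_iff_of_nonneg (le_max_right t 0)).2 h4 |>.trans_le'
    (ENNReal.ofReal_le_ofReal (le_max_left t 0))

/-- The height `x` is not hit exactly at one of the first `N` jumps. -/
def AvoidsJumps (c : Fin m → ℝ) : ℕ → ℝ → Path m → Prop
  | 0, _, _ => True
  | N + 1, x, ω => T (ω 0).1 (ω 0).1 = 0 ∨
      heightAfter T c x (ω 0) ≠ 0 ∧ AvoidsJumps c N (heightAfter T c x (ω 0)) (tailPath ω)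

theorem measurableSet_avoidsJumps (c : Fin m → ℝ) (N : ℕ) :
    MeasurableSet {p : ℝ × Path m | AvoidsJumps T c N p.1 p.2} := by
  induction N with
  | zero => simp [AvoidsJumps]
  | succ N ih =>
    have h0 : Measurable fun p : ℝ × Path m => p.2 0 := by fun_prop
    have h1 : Measurable fun p : ℝ × Path m => heightAfter T c p.1 (p.2 0) :=
      (measurable_heightAfter T c).comp (measurable_fst.prodMk h0)
    have h2 : Measurable fun p : ℝ × Path m => T (p.2 0).1 (p.2 0).1 :=
      (measurable_of_finite fun i => T i i).comp (f := fun p : ℝ × Path m => (p.2 0).1)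
        (by fun_prop)
    exact (h2 (measurableSet_singleton 0)).union
      ((h1 (measurableSet_singleton 0)).compl.inter
        ((h1.prodMk (measurable_tailPath.comp measurable_snd)) ih))

/-- If the rate is nonzero, at most one clock value leads to remaining height 0, and the exponential
law has no atoms. If the rate is zero the height does not move. After the first jump the height is
nonzero, so the first alternative of `hx` carries the induction. -/
theorem ae_avoidsJumps (c : Fin m → ℝ) (N : ℕ) (x : ℝ) (i : Fin m) (hx : x ≠ 0 ∨ c i ≠ 0) :
    ∀ᵐ ω ∂pathLaw T i, AvoidsJumps T c N x ω := by
  induction N generalizing x i with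
  | zero => exact Filter.Eventually.of_forall fun _ => trivial
  | succ N ih =>
    refine ae_pathLaw_of_forall T i
      (measurable_prodMk_left (measurableSet_avoidsJumps T c (N + 1))) ?_
    by_cases hq : T i i = 0
    · exact Filter.Eventually.of_forall fun e k => Filter.Eventually.of_forall fun ω => Or.inl hq
    filter_upwards [ae_expMeasure_one_ne (x * -T i i / c i)] with e he k
    have h : heightAfter T c x (i, e) ≠ 0 := by
      unfold heightAfter
      by_cases hc : c i = 0
      · simpa [hc] using hx
      · contrapose! he
        simp only at he
        field_simp at he ⊢
        linarith
    filter_upwards [ih (heightAfter T c x (i, e)) k (Or.inl h)] with ω hω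
    exact Or.inr ⟨h, hω⟩

end AlmostSure

/-! ### The level process along a regular path -/

section Pathwise

variable {m : ℕ} {T : Matrix (Fin m) (Fin m) ℝ} {c : Fin m → ℝ} {ω : Path m}

theorem jumpTime_succ (n : ℕ) :
    jumpTime T ω (n + 1) = sojourn T ω 0 + jumpTime T (tailPath ω) n := by
  rw [jumpTime, Finset.sum_range_succ', add_comm]
  rfl

theorem jumpTime_mono : Monotone (jumpTime T ω) := fun _ _ h =>
  Finset.sum_le_sum_of_subset (Finset.range_mono h)

/-- The duration of the first sojourn, as a real number. -/
def firstSojourn (T : Matrix (Fin m) (Fin m) ℝ) (ω : Path m) : ℝ :=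
  (ω 0).2 / -T (ω 0).1 (ω 0).1

theorem sojourn_zero_eq (h : T (ω 0).1 (ω 0).1 < 0) :
    sojourn T ω 0 = ENNReal.ofReal (firstSojourn T ω) := by
  rw [sojourn, firstSojourn, ENNReal.ofReal_div_of_pos (neg_pos.2 h)]

theorem sojourn_zero_eq_top (hω : 0 < (ω 0).2) (h : T (ω 0).1 (ω 0).1 = 0) :
    sojourn T ω 0 = ⊤ := by
  rw [sojourn, h, neg_zero, ENNReal.ofReal_zero, ENNReal.div_zero]
  simpa using hω

theorem firstSojourn_pos (hω : 0 < (ω 0).2) (h : T (ω 0).1 (ω 0).1 < 0) :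
    0 < firstSojourn T ω := div_pos hω (neg_pos.2 h)

theorem IsRegularPath.tail (hω : IsRegularPath T ω) (h : T (ω 0).1 (ω 0).1 < 0) :
    IsRegularPath T (tailPath ω) := by
  refine ⟨fun n => hω.1 (n + 1), fun t => ?_⟩
  have h0 := firstSojourn_pos (hω.1 0) h
  obtain ⟨n, hn⟩ := hω.2 (firstSojourn T ω + max t 0)
  have hn' := hn.trans_le (jumpTime_mono n.le_succ)
  rw [Nat.succ_eq_add_one, jumpTime_succ, sojourn_zero_eq h,
    ENNReal.ofReal_add h0.le (le_max_right t 0)] at hn'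
  refine ⟨n, lt_of_le_of_lt (ENNReal.ofReal_le_ofReal (le_max_left t 0)) ?_⟩
  exact (ENNReal.add_lt_add_iff_left ENNReal.ofReal_ne_top).1 hn'

theorem phase_of_lt {t : ℝ} (ht : ENNReal.ofReal t < sojourn T ω 0) :
    phase T ω t = (ω 0).1 := by
  have : sInf {n : ℕ | ENNReal.ofReal t < jumpTime T ω (n + 1)} = 0 :=
    Nat.sInf_eq_zero.2 (Or.inl (by simpa [jumpTime] using ht))
  rw [phase, this]

theorem phase_add (hω : IsRegularPath T ω) (h : T (ω 0).1 (ω 0).1 < 0) {t : ℝ} (ht : 0 ≤ t) :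
    phase T ω (firstSojourn T ω + t) = phase T (tailPath ω) t := by
  have h0 := firstSojourn_pos (hω.1 0) h
  have hs : ∀ n, ENNReal.ofReal (firstSojourn T ω + t) < jumpTime T ω (n + 1)
      ↔ ENNReal.ofReal t < jumpTime T (tailPath ω) n := by
    intro n
    rw [jumpTime_succ, sojourn_zero_eq h, ENNReal.ofReal_add h0.le ht,
      ENNReal.add_lt_add_iff_left ENNReal.ofReal_ne_top]
  obtain ⟨N, hN⟩ := (hω.tail h).2 t
  -- At least one jump precedes the time considered, so the infimum can be shifted by one index.
  have hle : 1 ≤ sInf {n : ℕ | ENNReal.ofReal (firstSojourn T ω + t) < jumpTime T ω (n + 1)} := by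
    rw [Nat.one_le_iff_ne_zero, Ne, Nat.sInf_eq_zero, not_or]
    refine ⟨?_, Set.Nonempty.ne_empty ⟨N, (hs N).2 hN⟩⟩
    rw [Set.mem_ofPred_eq, hs]
    simp [jumpTime]
  have hadd := Nat.sInf_add
    (p := fun n => ENNReal.ofReal (firstSojourn T ω + t) < jumpTime T ω (n + 1)) hle
  rw [phase, phase, ← hadd]
  simp only [hs]
  rfl

theorem measurable_phase (hω : IsRegularPath T ω) : Measurable (phase T ω) := by
  have hm : Monotone fun t : ℝ => sInf {n : ℕ | ENNReal.ofReal t < jumpTime T ω (n + 1)} := by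
    intro a b hab
    refine csInf_le_csInf (OrderBot.bddBelow _) ?_ ?_
    · obtain ⟨n, hn⟩ := hω.2 b
      exact ⟨n, hn.trans_le (jumpTime_mono n.le_succ)⟩
    · intro n hn
      exact lt_of_le_of_lt (ENNReal.ofReal_le_ofReal hab) hn
  exact (measurable_of_countable fun n => (ω n).1).comp hm.measurable

theorem intervalIntegrable_phase (hω : IsRegularPath T ω) (a b : ℝ) :
    IntervalIntegrable (fun u => c (phase T ω u)) volume a b := by
  have hc : Measurable fun u => c (phase T ω u) :=
    (measurable_of_finite c).comp (measurable_phase hω)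
  have hb : ∀ i, ‖c i‖ ≤ ∑ k, ‖c k‖ := fun i =>
    Finset.single_le_sum (f := fun k => ‖c k‖) (fun _ _ => norm_nonneg _) (Finset.mem_univ i)
  refine (intervalIntegrable_const (c := ∑ k, ‖c k‖)).mono_fun hc.aestronglyMeasurable
    (Filter.Eventually.of_forall fun u => ?_)
  exact (hb _).trans (le_abs_self _)

theorem level_of_le {t : ℝ} (ht0 : 0 ≤ t) (ht : ENNReal.ofReal t ≤ sojourn T ω 0) :
    level T c ω t = c (ω 0).1 * t := by
  -- At the right endpoint the phase may already have changed; one instant does not affect the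
  -- integral.
  have h : ∀ᵐ u, u ∈ Set.uIoc 0 t → c (phase T ω u) = c (ω 0).1 := by
    filter_upwards [compl_mem_ae_iff.2 (measure_singleton t)] with u hu hut
    rw [Set.uIoc_of_le ht0] at hut
    have hlt : u < t := lt_of_le_of_ne hut.2 hu
    rw [phase_of_lt (lt_of_lt_of_le
      ((ENNReal.ofReal_lt_ofReal_iff (ht0.lt_of_ne (by linarith [hut.1]))).2 hlt) ht)]
  rw [level, intervalIntegral.integral_congr_ae h, intervalIntegral.integral_const]
  simp [mul_comm]

theorem level_add (hω : IsRegularPath T ω) (h : T (ω 0).1 (ω 0).1 < 0) {t : ℝ} (ht : 0 ≤ t) :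
    level T c ω (firstSojourn T ω + t)
      = c (ω 0).1 * firstSojourn T ω + level T c (tailPath ω) t := by
  have h0 := firstSojourn_pos (hω.1 0) h
  rw [level, ← intervalIntegral.integral_add_adjacent_intervals
    (intervalIntegrable_phase hω 0 (firstSojourn T ω)) (intervalIntegrable_phase hω _ _)]
  congr 1
  · exact level_of_le h0.le (sojourn_zero_eq h).ge
  · rw [level]
    have := intervalIntegral.integral_comp_add_left (a := 0) (b := t)
      (fun u => c (phase T ω u)) (firstSojourn T ω)
    rw [add_zero] at this
    rw [← this]
    refine intervalIntegral.integral_congr fun u hu => ?_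
    rw [Set.uIcc_of_le ht] at hu
    exact congrArg c (phase_add hω h hu.1)

/-- The times `t > 0` at which the level is `x`. -/
def hitTimes (T : Matrix (Fin m) (Fin m) ℝ) (c : Fin m → ℝ) (ω : Path m) (x : ℝ) : Set ℝ :=
  {t | 0 < t ∧ level T c ω t = x}

theorem hitTimes_zero : hitTimes T c ω 0 = returnTimes T c ω := rfl

theorem bddBelow_hitTimes (x : ℝ) : BddBelow (hitTimes T c ω x) := ⟨0, fun _ ht => ht.1.le⟩

theorem sInf_hitTimes_nonneg (x : ℝ) : 0 ≤ sInf (hitTimes T c ω x) :=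
  Real.sInf_nonneg fun _ ht => ht.1.le

/-- If the height is not reached during the first sojourn, then the hitting times are those of the
remaining path, delayed. -/
theorem hitTimes_eq_image (hω : IsRegularPath T ω) (h : T (ω 0).1 (ω 0).1 < 0) {x : ℝ}
    (hx : ∀ t, 0 < t → t ≤ firstSojourn T ω → c (ω 0).1 * t ≠ x) :
    hitTimes T c ω x = (fun t => firstSojourn T ω + t) ''
      hitTimes T c (tailPath ω) (x - c (ω 0).1 * firstSojourn T ω) := by
  have h0 := firstSojourn_pos (hω.1 0) h
  ext t
  constructor
  · rintro ⟨ht, hl⟩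
    have hlt : firstSojourn T ω < t := by
      by_contra! hle
      refine hx t ht hle ?_
      rw [← hl, level_of_le ht.le]
      rw [sojourn_zero_eq h]
      exact ENNReal.ofReal_le_ofReal hle
    refine ⟨t - firstSojourn T ω, ⟨sub_pos.2 hlt, ?_⟩, by simp⟩
    rw [← hl, ← add_sub_cancel (firstSojourn T ω) t, level_add hω h (sub_pos.2 hlt).le]
    simp
  · rintro ⟨u, ⟨hu, hl⟩, rfl⟩
    refine ⟨add_pos h0 hu, ?_⟩
    rw [level_add hω h hu.le, hl]
    ring

open Classical in
/-- The passage functional, restricted to the first `N` sojourns, is the discounted indicator of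
the first hitting time. -/
theorem passage_eq_ite (hT : ∀ i, T i i ≤ 0) (s : ℂ) (j : Fin m) (N : ℕ) {x : ℝ}
    (hω : IsRegularPath T ω) (hav : AvoidsJumps T c N x ω)
    (hx : 0 < x ∨ x = 0 ∧ c (ω 0).1 < 0) :
    passage T c s j N x ω =
      if (hitTimes T c ω x).Nonempty ∧ phase T ω (sInf (hitTimes T c ω x)) = j ∧
        ENNReal.ofReal (sInf (hitTimes T c ω x)) < jumpTime T ω N
      then Complex.exp (-s * ((sInf (hitTimes T c ω x) : ℝ) : ℂ)) else 0 := by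
  induction N generalizing x ω with
  | zero => simp [passage, jumpTime]
  | succ N ih =>
    have hx0 : 0 ≤ x := by rcases hx with h | h <;> linarith [h]
    have he := hω.1 0
    rw [passage_succ, passageStep, if_neg (by push Not; exact ⟨hx0, he⟩)]
    by_cases hhit : 0 < c (ω 0).1 ∧ x * -T (ω 0).1 (ω 0).1 < c (ω 0).1 * (ω 0).2
    · rw [if_pos hhit]
      obtain ⟨hc, hlt⟩ := hhit
      have hxp : 0 < x := hx.resolve_right fun h => by linarith [h.2]
      have hlt' : ENNReal.ofReal (x / c (ω 0).1) < sojourn T ω 0 := by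
        rcases (hT (ω 0).1).lt_or_eq with hq | hq
        · rw [sojourn_zero_eq hq]
          refine (ENNReal.ofReal_lt_ofReal_iff (firstSojourn_pos he hq)).2 ?_
          rw [firstSojourn, div_lt_div_iff₀ hc (neg_pos.2 hq)]
          linarith
        · rw [sojourn_zero_eq_top he hq]
          exact ENNReal.ofReal_lt_top
      have hxc : 0 < x / c (ω 0).1 := div_pos hxp hc
      have hmem : x / c (ω 0).1 ∈ hitTimes T c ω x :=
        ⟨hxc, by rw [level_of_le hxc.le hlt'.le]; field_simp⟩
      have hinf : sInf (hitTimes T c ω x) = x / c (ω 0).1 := by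
        refine le_antisymm (csInf_le (bddBelow_hitTimes x) hmem)
          (le_csInf ⟨_, hmem⟩ fun t ht => ?_)
        by_contra! hlt2
        have h2 := ht.2
        rw [level_of_le ht.1.le ((ENNReal.ofReal_le_ofReal hlt2.le).trans hlt'.le)] at h2
        rw [lt_div_iff₀ hc] at hlt2
        linarith
      have hj : ENNReal.ofReal (x / c (ω 0).1) < jumpTime T ω (N + 1) := by
        rw [jumpTime_succ]
        exact hlt'.trans_le le_self_add
      have hne : (hitTimes T c ω x).Nonempty := ⟨_, hmem⟩
      simp [hinf, phase_of_lt hlt', hj, hne]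
    · rw [if_neg hhit]
      have hhit' : 0 < c (ω 0).1 → c (ω 0).1 * (ω 0).2 ≤ x * -T (ω 0).1 (ω 0).1 := by
        intro h; by_contra! h'; exact hhit ⟨h, h'⟩
      rcases (hT (ω 0).1).lt_or_eq with hq | hq
      · rw [if_neg hq.ne]
        obtain ⟨hne, hav'⟩ := hav.resolve_left hq.ne
        have hτ := firstSojourn_pos he hq
        have hτe : (ω 0).2 / -T (ω 0).1 (ω 0).1 = firstSojourn T ω := rfl
        have hha : heightAfter T c x (ω 0) = x - c (ω 0).1 * firstSojourn T ω := rfl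
        have hcτ : c (ω 0).1 * firstSojourn T ω ≤ x := by
          rcases le_or_gt (c (ω 0).1) 0 with hc | hc
          · nlinarith
          · rw [← hτe, ← mul_div_assoc, div_le_iff₀ (neg_pos.2 hq)]
            exact hhit' hc
        -- For x > 0 a hit up to and including the end of the sojourn forces a positive rate and, as
        -- the sojourn does not climb beyond x, a hit exactly at its end; `AvoidsJumps` excludes
        -- this. For x = 0 the level is negative throughout.
        have hnt : ∀ t, 0 < t → t ≤ firstSojourn T ω → c (ω 0).1 * t ≠ x := by
          intro t ht htle heq
          rw [hha] at hne
          rcases hx with hx | ⟨rfl, hc⟩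
          · have hc : 0 < c (ω 0).1 := by by_contra! hc; nlinarith
            apply hne
            nlinarith
          · nlinarith
        have hx' : 0 < heightAfter T c x (ω 0) :=
          lt_of_le_of_ne (by rw [hha]; linarith) (Ne.symm hne)
        rw [ih (hω.tail hq) hav' (Or.inl hx'), hitTimes_eq_image hω hq hnt, ← hha,
          Set.image_nonempty]
        by_cases hn : (hitTimes T c (tailPath ω) (heightAfter T c x (ω 0))).Nonempty
        · have hinf : sInf ((fun t => firstSojourn T ω + t) ''
              hitTimes T c (tailPath ω) (heightAfter T c x (ω 0)))
              = firstSojourn T ω +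
                sInf (hitTimes T c (tailPath ω) (heightAfter T c x (ω 0))) :=
            ((OrderIso.addLeft (firstSojourn T ω)).map_csInf' hn (bddBelow_hitTimes _)).symm
          have h0 := sInf_hitTimes_nonneg (T := T) (c := c) (ω := tailPath ω)
            (heightAfter T c x (ω 0))
          have hlt : ENNReal.ofReal (firstSojourn T ω +
              sInf (hitTimes T c (tailPath ω) (heightAfter T c x (ω 0)))) < jumpTime T ω (N + 1)
              ↔ ENNReal.ofReal (sInf (hitTimes T c (tailPath ω) (heightAfter T c x (ω 0))))
                < jumpTime T (tailPath ω) N := by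
            rw [jumpTime_succ, sojourn_zero_eq hq, ENNReal.ofReal_add hτ.le h0,
              ENNReal.add_lt_add_iff_left ENNReal.ofReal_ne_top]
          simp only [hinf, phase_add hω hq h0, hlt]
          rw [hτe, mul_ite, mul_zero, ← Complex.exp_add]
          congr 2
          push_cast
          ring
        · simp [hn]
      -- In an absorbing phase the level is linear for ever, and without immediate passage its rate
      -- is nonpositive, so the height is never hit.
      · rw [if_pos hq, if_neg]
        rintro ⟨⟨t, ht, hl⟩, -⟩
        rw [level_of_le ht.le (by rw [sojourn_zero_eq_top he hq]; exact le_top)] at hl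
        have hc : c (ω 0).1 ≤ 0 := by
          by_contra! hc
          have := hhit' hc
          rw [hq] at this
          nlinarith
        rcases hx with hx | ⟨rfl, hc⟩ <;> nlinarith

/-- On a regular path the infimum of the hitting times precedes the N-th jump for large N, so the
truncation in `passage_eq_ite` disappears. A negative initial rate excludes an immediate passage at
height 0. -/
theorem passageLim_zero_eq (hT : ∀ i, T i i ≤ 0) (s : ℂ) (j : Fin m)
    (hω : IsRegularPath T ω) (hav : ∀ N, AvoidsJumps T c N 0 ω) (hc : c (ω 0).1 < 0) :
    passageLim T c s j 0 ω = returnFunctional T c s j ω := by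
  refine tendsto_nhds_unique (tendsto_passage T c s j 0 ω) (tendsto_const_nhds.congr' ?_)
  obtain ⟨n, hn⟩ := hω.2 (sInf (hitTimes T c ω 0))
  filter_upwards [Filter.eventually_ge_atTop n] with N hN
  rw [passage_eq_ite hT s j N hω (hav N) (Or.inr ⟨rfl, hc⟩), returnFunctional, ← hitTimes_zero]
  have : ENNReal.ofReal (sInf (hitTimes T c ω 0)) < jumpTime T ω N :=
    hn.trans_le (jumpTime_mono hN)
  congr 1
  exact propext ⟨fun h => ⟨h.1, h.2, this⟩, fun h => ⟨h.1, h.2.1⟩⟩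

theorem ae_zero_eq (i : Fin m) : ∀ᵐ ω ∂pathLaw T i, (ω 0).1 = i := by
  have hm : Measurable fun ω : Path m => (ω 0).1 := by fun_prop
  exact ae_pathLaw_of_forall T i (hm (measurableSet_singleton i))
    (Filter.Eventually.of_forall fun e k => Filter.Eventually.of_forall fun ω => rfl)

theorem integral_returnFunctional (hT : ∀ i, T i i ≤ 0) (s : ℂ) (i j : Fin m) (hc : c i < 0) :
    ∫ ω, returnFunctional T c s j ω ∂pathLaw T i = passageTransform T c s j i 0 := by
  refine integral_congr_ae ?_
  filter_upwards [ae_zero_eq i, ae_isRegularPath T hT i,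
    ae_all_iff.2 fun N => ae_avoidsJumps T c N 0 i (Or.inr hc.ne)] with ω h1 h2 h3
  exact (passageLim_zero_eq hT s j h2 h3 (by rwa [h1])).symm

end Pathwise

/-! ### Uniqueness of the solutions of moderate growth -/

section Uniqueness

variable {m : ℕ} {T : Matrix (Fin m) (Fin m) ℝ} {c : Fin m → ℝ} {s : ℂ}

theorem IsGenerator.diag_nonpos (hT : IsGenerator T) (i : Fin m) : T i i ≤ 0 := by
  have h := hT.2 i
  rw [← Finset.add_sum_erase _ _ (Finset.mem_univ i)] at h
  have := Finset.sum_nonneg fun k (hk : k ∈ Finset.univ.erase i) =>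
    hT.1 i k (Finset.ne_of_mem_erase hk).symm
  linarith

/-- The rate of flow into the `i`-th equation from the other phases. -/
def inflow (T : Matrix (Fin m) (Fin m) ℝ) (i : Fin m) (y : Fin m → ℂ) : ℂ :=
  ∑ k ∈ Finset.univ.erase i, (T i k : ℂ) * y k

theorem sum_mul_eq_inflow (i : Fin m) (y : Fin m → ℂ) :
    ∑ k, (T i k : ℂ) * y k = (T i i : ℂ) * y i + inflow T i y :=
  (Finset.add_sum_erase _ _ (Finset.mem_univ i)).symm

/-- The off-diagonal rates are nonnegative and sum to the exit rate, because the row sums vanish. -/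
theorem norm_inflow_le (hT : IsGenerator T) (i : Fin m) {y : Fin m → ℂ} {M : ℝ}
    (hy : ∀ k, ‖y k‖ ≤ M) : ‖inflow T i y‖ ≤ -T i i * M := by
  have h := hT.2 i
  rw [← Finset.add_sum_erase _ _ (Finset.mem_univ i)] at h
  have h2 : -T i i = ∑ k ∈ Finset.univ.erase i, T i k := by linarith
  rw [h2, Finset.sum_mul]
  refine (norm_sum_le _ _).trans (Finset.sum_le_sum fun k hk => ?_)
  have h0 := hT.1 i k (Finset.ne_of_mem_erase hk).symm
  rw [norm_mul, Complex.norm_real, Real.norm_of_nonneg h0]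
  exact mul_le_mul_of_nonneg_left (hy k) h0

/-- The equations `cᵢ yᵢ' = (T y)ᵢ - s yᵢ` on the half-line `[0, ∞)`. -/
structure IsFluidSolution (T : Matrix (Fin m) (Fin m) ℝ) (c : Fin m → ℝ) (s : ℂ)
    (y : ℝ → Fin m → ℂ) : Prop where
  hasDeriv : ∀ i, c i ≠ 0 → ∀ x, 0 ≤ x → HasDerivWithinAt (fun u => y u i)
    ((∑ k, (T i k : ℂ) * y x k - s * y x i) / c i) (Set.Ici 0) x
  algebraic : ∀ i, c i = 0 → ∀ x, 0 ≤ x → ∑ k, (T i k : ℂ) * y x k = s * y x i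

theorem norm_exp_mul_ofReal (z : ℂ) (x : ℝ) : ‖Complex.exp (z * x)‖ = Real.exp (z.re * x) := by
  rw [Complex.norm_exp]
  simp

/-- The integrating factor removes the diagonal term and leaves only the inflow. -/
theorem IsFluidSolution.hasDeriv_exp_mul {y : ℝ → Fin m → ℂ} (hy : IsFluidSolution T c s y)
    {i : Fin m} (hc : c i ≠ 0) {x : ℝ} (hx : 0 ≤ x) :
    HasDerivWithinAt (fun u : ℝ => Complex.exp ((-T i i + s) / c i * u) * y u i)
      (Complex.exp ((-T i i + s) / c i * x) * (inflow T i (y x) / c i)) (Set.Ici 0) x := by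
  have hcc : (c i : ℂ) ≠ 0 := by exact_mod_cast hc
  have h1 : HasDerivAt (fun u : ℝ => Complex.exp ((-T i i + s) / c i * u))
      (Complex.exp ((-T i i + s) / c i * x) * ((-T i i + s) / c i * 1)) x :=
    (((hasDerivAt_id (x : ℂ)).const_mul ((-T i i + s) / c i : ℂ)).cexp).comp_ofReal
  convert! h1.hasDerivWithinAt.mul (hy.hasDeriv i hc x hx) using 1
  rw [sum_mul_eq_inflow]
  field_simp
  ring

/-- The inflow into component i is at most qM exp(εx), where q = -T i i. Solving for yᵢ divides this
by a number that is at least q + Re s/2: the term s contributes Re s, and the growth ε costs at most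
ε|cᵢ| ≤ Re s/2. The ratio q/(q + Re s/2) increases with q, so Λ gives a common factor below 1. -/
theorem IsFluidSolution.norm_le_contract (hT : IsGenerator T) (hs : 0 < s.re)
    {y : ℝ → Fin m → ℂ} (hy : IsFluidSolution T c s y) (h0 : ∀ i, 0 < c i → y 0 i = 0)
    {ε M Λ : ℝ} (hε0 : 0 ≤ ε) (hε : ∀ i, ε * |c i| ≤ s.re / 2) (hM : 0 ≤ M)
    (hΛ : ∀ i, -T i i ≤ Λ) (hb : ∀ x, 0 ≤ x → ∀ i, ‖y x i‖ ≤ M * Real.exp (ε * x))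
    {x : ℝ} (hx : 0 ≤ x) (i : Fin m) :
    ‖y x i‖ ≤ (Λ / (Λ + s.re / 2) * M) * Real.exp (ε * x) := by
  have hq : 0 ≤ -T i i := neg_nonneg.2 (hT.diag_nonpos i)
  have hΛ0 : 0 ≤ Λ := hq.trans (hΛ i)
  -- it suffices to have some denominator `d ≥ -T i i + s.re / 2`
  have key : ∀ d, -T i i + s.re / 2 ≤ d → -T i i * M / d ≤ Λ / (Λ + s.re / 2) * M := by
    intro d hd
    have h1 : -T i i / d ≤ Λ / (Λ + s.re / 2) := by
      refine (div_le_div_of_nonneg_left hq (by linarith) hd).trans ?_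
      rw [div_le_div_iff₀ (by linarith) (by linarith)]
      nlinarith [hΛ i]
    calc -T i i * M / d = -T i i / d * M := by ring
      _ ≤ _ := mul_le_mul_of_nonneg_right h1 hM
  have hin : ∀ u, 0 ≤ u → ‖inflow T i (y u)‖ ≤ -T i i * (M * Real.exp (ε * u)) :=
    fun u hu => norm_inflow_le hT i (hb u hu)
  rcases eq_or_ne (c i) 0 with hc | hc
  · have h1 := hy.algebraic i hc x hx
    rw [sum_mul_eq_inflow] at h1
    have h2 : (-T i i + s) * y x i = inflow T i (y x) := by linear_combination -h1
    have h3 : -T i i + s.re ≤ ‖(-T i i + s : ℂ)‖ := by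
      refine le_trans (le_of_eq ?_) (Complex.re_le_norm _)
      simp
    have h4 : ‖(-T i i + s : ℂ)‖ * ‖y x i‖ ≤ -T i i * M * Real.exp (ε * x) := by
      rw [← norm_mul, h2, mul_assoc]
      exact hin x hx
    have h5 : ‖y x i‖ ≤ -T i i * M / ‖(-T i i + s : ℂ)‖ * Real.exp (ε * x) := by
      rw [div_mul_eq_mul_div, le_div_iff₀ (by linarith)]
      linarith
    exact h5.trans (mul_le_mul_of_nonneg_right (key _ (by linarith)) (Real.exp_pos _).le)
  set κ : ℂ := (-T i i + s) / c i with hκ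
  have hκre : κ.re = (-T i i + s.re) / c i := by
    rw [hκ, Complex.div_ofReal_re]; simp
  set F : ℝ → ℂ := fun u => Complex.exp (κ * u) * y u i with hF
  set F' : ℝ → ℂ := fun u => Complex.exp (κ * u) * (inflow T i (y u) / c i) with hF'
  have hd : ∀ u, 0 ≤ u → HasDerivWithinAt F (F' u) (Set.Ici 0) u :=
    fun u hu => hy.hasDeriv_exp_mul hc hu
  have hcont : ContinuousOn F (Set.Ici 0) := fun u hu => (hd u hu).continuousWithinAt
  have hF'n : ∀ u, 0 ≤ u → ‖F' u‖ ≤ -T i i * M / |c i| * Real.exp ((κ.re + ε) * u) := by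
    intro u hu
    rw [hF', norm_mul, norm_exp_mul_ofReal, norm_div, Complex.norm_real, Real.norm_eq_abs,
      add_mul, Real.exp_add]
    calc Real.exp (κ.re * u) * (‖inflow T i (y u)‖ / |c i|)
        ≤ Real.exp (κ.re * u) * (-T i i * (M * Real.exp (ε * u)) / |c i|) := by
          gcongr; exact hin u hu
      _ = _ := by ring
  have hFn : ∀ u, ‖F u‖ = Real.exp (κ.re * u) * ‖y u i‖ := fun u => by
    rw [hF, norm_mul, norm_exp_mul_ofReal]
  -- it suffices to bound `F`
  have fin : ∀ d, -T i i + s.re / 2 ≤ d →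
      ‖F x‖ ≤ -T i i * M / d * Real.exp ((κ.re + ε) * x) →
      ‖y x i‖ ≤ (Λ / (Λ + s.re / 2) * M) * Real.exp (ε * x) := by
    intro d hd h
    rw [hFn, add_mul, Real.exp_add, mul_left_comm] at h
    exact (le_of_mul_le_mul_left h (Real.exp_pos _)).trans
      (mul_le_mul_of_nonneg_right (key _ hd) (Real.exp_pos _).le)
  have hB : ∀ β a : ℝ, ∀ u, β ≠ 0 → HasDerivAt (fun u => a / β * Real.exp (β * u))
      (a * Real.exp (β * u)) u := by
    intro β a u hβ
    convert! (((hasDerivAt_id u).const_mul β).exp).const_mul (a / β) using 1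
    simp only [id_eq]
    field_simp
  rcases lt_or_gt_of_ne hc with hc | hc
  · have habs : |c i| = -c i := abs_of_neg hc
    -- For a negative rate there is no initial condition. Instead γ < 0, so `F` decays at infinity
    -- by the growth bound, and `F x` is controlled by the integral of `F'` over (x, R) as R → ∞.
    set γ : ℝ := κ.re + ε with hγ
    have hγc : -c i * -γ = -T i i + s.re - ε * |c i| := by
      rw [hγ, hκre, habs]; field_simp; ring
    have hεi := hε i
    have hγ0 : γ < 0 := by
      by_contra! h
      nlinarith
    refine fin (-c i * -γ) (by rw [hγc]; linarith) ?_
    have hdiff : ∀ R, x ≤ R → ‖F R - F x‖ ≤ -T i i * M / |c i| / γ * Real.exp (γ * R)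
        - -T i i * M / |c i| / γ * Real.exp (γ * x) := by
      intro R hR
      refine image_norm_le_of_norm_deriv_right_le_deriv_boundary' (f := fun u => F u - F x)
        (f' := F') (a := x) (b := R)
        (B := fun u => -T i i * M / |c i| / γ * Real.exp (γ * u)
          - -T i i * M / |c i| / γ * Real.exp (γ * x))
        (B' := fun u => -T i i * M / |c i| * Real.exp (γ * u))
        ((hcont.mono fun u hu => hx.trans hu.1).sub continuousOn_const) ?_ (by simp) ?_ ?_ ?_
        ⟨hR, le_rfl⟩
      · intro u hu
        have hu0 : 0 ≤ u := hx.trans hu.1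
        exact ((hd u hu0).mono (Set.Ici_subset_Ici.2 hu0)).sub_const _
      · fun_prop
      · intro u hu
        exact ((hB γ _ u hγ0.ne).sub_const _).hasDerivWithinAt
      · intro u hu
        exact hF'n u (hx.trans hu.1)
    have hlim : Filter.Tendsto (fun R => M * Real.exp (γ * R) +
        (-T i i * M / |c i| / γ * Real.exp (γ * R)
        - -T i i * M / |c i| / γ * Real.exp (γ * x))) Filter.atTop
        (nhds (M * 0 + (-T i i * M / |c i| / γ * 0
          - -T i i * M / |c i| / γ * Real.exp (γ * x)))) := by
      have h1 : Filter.Tendsto (fun R => Real.exp (γ * R)) Filter.atTop (nhds 0) :=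
        Real.tendsto_exp_atBot.comp (Filter.tendsto_id.const_mul_atTop_of_neg hγ0)
      exact (h1.const_mul M).add ((h1.const_mul _).sub_const _)
    refine (ge_of_tendsto hlim ?_).trans (le_of_eq ?_)
    · filter_upwards [Filter.eventually_ge_atTop x] with R hR
      have hR0 := hx.trans hR
      have h1 : ‖F R‖ ≤ M * Real.exp (γ * R) := by
        rw [hFn, hγ, add_mul, Real.exp_add]
        have := hb R hR0 i
        have h2 := Real.exp_pos (κ.re * R)
        calc _ ≤ Real.exp (κ.re * R) * (M * Real.exp (ε * R)) := by gcongr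
          _ = _ := by ring
      have h2 := hdiff R hR
      have h3 : ‖F x‖ ≤ ‖F R‖ + ‖F R - F x‖ := by
        rw [norm_sub_rev]
        simpa using norm_add_le (F R) (F x - F R)
      linarith
    · rw [habs]
      have := hγ0.ne
      field_simp
      ring
  · have habs : |c i| = c i := abs_of_pos hc
    -- For a positive rate `F` starts at 0, and its derivative is integrated over (0, x).
    set β : ℝ := κ.re + ε with hβ
    have hκp : 0 < κ.re := by rw [hκre]; exact div_pos (by linarith) hc
    have hβ0 : 0 < β := by linarith
    have hβc : c i * β = -T i i + s.re + ε * c i := by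
      rw [hβ, hκre]; field_simp
    refine fin (c i * β) (by rw [hβc]; nlinarith) ?_
    have := image_norm_le_of_norm_deriv_right_le_deriv_boundary' (f := F)
        (f' := F') (a := 0) (b := x)
        (B := fun u => -T i i * M / |c i| / β * Real.exp (β * u))
        (B' := fun u => -T i i * M / |c i| * Real.exp (β * u))
        (hcont.mono fun u hu => hu.1)
        (fun u hu => (hd u hu.1).mono (Set.Ici_subset_Ici.2 hu.1))
        (by
          rw [hF]
          simp only [h0 i hc, mul_zero, norm_zero]
          positivity)
        (by fun_prop) (fun u hu => (hB β _ u hβ0.ne').hasDerivWithinAt)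
        (fun u hu => hF'n u hu.1) ⟨hx, le_rfl⟩
    refine this.trans (le_of_eq ?_)
    rw [habs, div_div]

/-- A solution of moderate growth whose components of positive rate start at `0` vanishes. -/
theorem IsFluidSolution.eq_zero (hT : IsGenerator T) (hs : 0 < s.re)
    {y : ℝ → Fin m → ℂ} (hy : IsFluidSolution T c s y) (h0 : ∀ i, 0 < c i → y 0 i = 0)
    {ε M : ℝ} (hε0 : 0 ≤ ε) (hε : ∀ i, ε * |c i| ≤ s.re / 2) (hM : 0 ≤ M)
    (hb : ∀ x, 0 ≤ x → ∀ i, ‖y x i‖ ≤ M * Real.exp (ε * x))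
    {x : ℝ} (hx : 0 ≤ x) (i : Fin m) : y x i = 0 := by
  set Λ : ℝ := ∑ i, -T i i with hΛ
  have hΛi : ∀ i, -T i i ≤ Λ := fun i => Finset.single_le_sum (f := fun i => -T i i)
      (fun i _ => neg_nonneg.2 (hT.diag_nonpos i)) (Finset.mem_univ i)
  have hΛ0 : 0 ≤ Λ := Finset.sum_nonneg fun i _ => neg_nonneg.2 (hT.diag_nonpos i)
  set ρ : ℝ := Λ / (Λ + s.re / 2) with hρ
  have hρ0 : 0 ≤ ρ := by positivity
  have hρ1 : ρ < 1 := by rw [hρ, div_lt_one (by positivity)]; linarith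
  -- Each application of the contraction gains a factor `ρ` < 1 in the same growth bound.
  have hn : ∀ n : ℕ, ∀ x, 0 ≤ x → ∀ i, ‖y x i‖ ≤ (ρ ^ n * M) * Real.exp (ε * x) := by
    intro n
    induction n with
    | zero => simpa using hb
    | succ n ih =>
      intro x hx i
      refine (hy.norm_le_contract hT hs h0 hε0 hε (by positivity) hΛi ih hx i).trans
        (le_of_eq ?_)
      ring
  have hlim : Filter.Tendsto (fun n : ℕ => (ρ ^ n * M) * Real.exp (ε * x)) Filter.atTop
      (nhds ((0 * M) * Real.exp (ε * x))) :=
    ((tendsto_pow_atTop_nhds_zero_of_lt_one hρ0 hρ1).mul_const M).mul_const _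
  have := ge_of_tendsto' hlim fun n => hn n x hx i
  simpa using this

end Uniqueness

/-! ### Elimination of the phases of rate zero -/

section Schur

open Matrix

variable {m : ℕ} {σ : Fin m → SignType} {T : Matrix (Fin m) (Fin m) ℝ} {c : Fin m → ℝ} {s : ℂ}

theorem sum_eq_sum_sign {M : Type*} [AddCommMonoid M] (σ : Fin m → SignType) (f : Fin m → M) :
    ∑ k, f k = ∑ k : SPos σ, f k + ∑ k : SNeg σ, f k + ∑ k : SZero σ, f k := by
  have h : ∀ a : SignType, ∑ k : {i // σ i = a}, f k = ∑ k with σ k = a, f k := fun a =>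
    (Finset.sum_subtype _ (by simp) f).symm
  rw [h, h, h, ← Finset.sum_fiberwise Finset.univ σ f]
  have hu : (Finset.univ : Finset SignType) = {1, -1, 0} := by decide
  rw [hu, Finset.sum_insert (by decide), Finset.sum_insert (by decide), Finset.sum_singleton,
    add_assoc]

/-- Strict diagonal dominance: the off-diagonal row sum is at most -T k k, while the diagonal entry
has modulus at least -T k k + Re s. -/
theorem det_block_zero_sub_ne_zero (hT : IsGenerator T) (hs : 0 < s.re) :
    (block T (σ · = 0) (σ · = 0) - s • (1 : Matrix (SZero σ) (SZero σ) ℂ)).det ≠ 0 := by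
  refine det_ne_zero_of_sum_row_lt_diag fun k => ?_
  have h1 : ∀ j ∈ Finset.univ.erase k,
      ‖(block T (σ · = 0) (σ · = 0) - s • (1 : Matrix (SZero σ) (SZero σ) ℂ)) k j‖
        = T k.1 j.1 := by
    intro j hj
    have hne := (Finset.ne_of_mem_erase hj).symm
    rw [Matrix.sub_apply, Matrix.smul_apply, Matrix.one_apply_ne hne, smul_zero, sub_zero, block,
      Matrix.of_apply, Complex.norm_real,
      Real.norm_of_nonneg (hT.1 _ _ fun h => hne (Subtype.ext h))]
  rw [Finset.sum_congr rfl h1]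
  have h2 : ∑ j ∈ Finset.univ.erase k, T k.1 j.1 ≤ -T k.1 k.1 := by
    have h3 : ∑ j ∈ Finset.univ.erase k, T k.1 j.1
        ≤ ∑ j ∈ Finset.univ.erase k.1, T k.1 j := by
      rw [← Finset.sum_image (s := Finset.univ.erase k) (g := fun j : SZero σ => j.1)
        (f := fun j => T k.1 j) (fun a _ b _ h => Subtype.ext h)]
      refine Finset.sum_le_sum_of_subset_of_nonneg ?_ fun j hj _ =>
        hT.1 _ _ (Finset.ne_of_mem_erase hj).symm
      intro j hj
      obtain ⟨a, ha, rfl⟩ := Finset.mem_image.1 hj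
      exact Finset.mem_erase.2 ⟨fun h => Finset.ne_of_mem_erase ha (Subtype.ext h),
        Finset.mem_univ _⟩
    have h4 := hT.2 k.1
    rw [← Finset.add_sum_erase _ _ (Finset.mem_univ k.1)] at h4
    linarith
  have h5 : -T k.1 k.1 + s.re
      ≤ ‖(block T (σ · = 0) (σ · = 0) - s • (1 : Matrix (SZero σ) (SZero σ) ℂ)) k k‖ := by
    rw [Matrix.sub_apply, Matrix.smul_apply, Matrix.one_apply_eq, block,
      Matrix.of_apply, smul_eq_mul, mul_one, ← norm_neg]
    refine le_trans (le_of_eq ?_) (Complex.re_le_norm _)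
    simp
    ring
  linarith

/-- The components of rate zero, expressed through the others. -/
def zeroPart (σ : Fin m → SignType) (T : Matrix (Fin m) (Fin m) ℝ) (s : ℂ)
    (yp : SPos σ → ℂ) (ym : SNeg σ → ℂ) : SZero σ → ℂ :=
  -(zeroResolvent σ T s *ᵥ
    (block T (σ · = 0) (σ · = 1) *ᵥ yp + block T (σ · = 0) (σ · = -1) *ᵥ ym))

theorem block_mulVec_add (P : Fin m → Prop) (i : {i // P i}) (y : Fin m → ℂ) :
    (block T P (σ · = 1) *ᵥ fun k => y k) i + (block T P (σ · = -1) *ᵥ fun k => y k) i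
      + (block T P (σ · = 0) *ᵥ fun k => y k) i = ∑ k, (T i k : ℂ) * y k := by
  rw [sum_eq_sum_sign σ]
  rfl

theorem algebraic_iff (hT : IsGenerator T) (hs : 0 < s.re) (y : Fin m → ℂ) :
    (∀ i, σ i = 0 → ∑ k, (T i k : ℂ) * y k = s * y i) ↔
      (fun k : SZero σ => y k) = zeroPart σ T s (fun k => y k) fun k => y k := by
  have hu : IsUnit (block T (σ · = 0) (σ · = 0) - s • (1 : Matrix (SZero σ) (SZero σ) ℂ)).det :=
    (det_block_zero_sub_ne_zero hT hs).isUnit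
  have h1 : (∀ i, σ i = 0 → ∑ k, (T i k : ℂ) * y k = s * y i) ↔
      (block T (σ · = 0) (σ · = 0) - s • (1 : Matrix (SZero σ) (SZero σ) ℂ)) *ᵥ
        (fun k : SZero σ => y k)
      = -(block T (σ · = 0) (σ · = 1) *ᵥ (fun k => y k)
        + block T (σ · = 0) (σ · = -1) *ᵥ fun k => y k) := by
    rw [funext_iff, Subtype.forall]
    refine forall_congr' fun i => forall_congr' fun hi => ?_
    rw [← block_mulVec_add (T := T) (σ := σ) (σ · = 0) ⟨i, hi⟩ y]
    simp only [Matrix.sub_mulVec, Matrix.smul_mulVec, Matrix.one_mulVec, Pi.sub_apply,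
      Pi.smul_apply, Pi.neg_apply, Pi.add_apply, smul_eq_mul]
    constructor <;> intro h <;> linear_combination h
  rw [h1, zeroPart, ← Matrix.mulVec_neg, zeroResolvent]
  constructor
  · intro h
    rw [← h, Matrix.mulVec_mulVec, Matrix.nonsing_inv_mul _ hu, Matrix.one_mulVec]
  · intro h
    rw [h, Matrix.mulVec_mulVec, Matrix.mul_nonsing_inv _ hu, Matrix.one_mulVec]

/-- Substituting the eliminated components turns the full row of T into its Schur complement; this
is why the matrices Q appear. -/
theorem schur_mulVec (P : Fin m → Prop) (i : {i // P i}) (y : Fin m → ℂ)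
    (hy : (fun k : SZero σ => y k) = zeroPart σ T s (fun k => y k) fun k => y k) :
    (block T P (σ · = 1) *ᵥ fun k => y k) i
      - (block T P (σ · = 0) *ᵥ (zeroResolvent σ T s *ᵥ
          (block T (σ · = 0) (σ · = 1) *ᵥ fun k => y k))) i
      + ((block T P (σ · = -1) *ᵥ fun k => y k) i
      - (block T P (σ · = 0) *ᵥ (zeroResolvent σ T s *ᵥ
          (block T (σ · = 0) (σ · = -1) *ᵥ fun k => y k))) i)
      = ∑ k, (T i k : ℂ) * y k := by
  rw [← block_mulVec_add (T := T) (σ := σ) P i y, hy, zeroPart, Matrix.mulVec_add,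
    Matrix.mulVec_neg, Matrix.mulVec_add]
  simp only [Pi.neg_apply, Pi.add_apply]
  ring

theorem absRateInv_mul_mulVec {P R : Fin m → Prop} [Fintype {i // P i}] [Fintype {i // R i}]
    [DecidableEq {i // P i}]
    (A : Matrix {i // P i} {i // R i} ℂ) (v : {i // R i} → ℂ) (i : {i // P i}) :
    (((Matrix.diagonal fun i : {i // P i} => ((|c i.1|⁻¹ : ℝ) : ℂ)) * A) *ᵥ v) i
      = (A *ᵥ v) i / (|c i.1| : ℝ) := by
  rw [← Matrix.mulVec_mulVec, Matrix.mulVec_diagonal]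
  push_cast
  rw [div_eq_inv_mul]

theorem Qpp_mulVec_add (y : Fin m → ℂ)
    (hy : (fun k : SZero σ => y k) = zeroPart σ T s (fun k => y k) fun k => y k) (i : SPos σ) :
    (Qpp σ T c s *ᵥ fun k => y k) i + (Qpm σ T c s *ᵥ fun k => y k) i
      = (∑ k, (T i k : ℂ) * y k - s * y i) / (|c i| : ℝ) := by
  rw [Qpp, Qpm, absRateInv, absRateInv_mul_mulVec, absRateInv_mul_mulVec,
    ← schur_mulVec (σ · = 1) i y hy]
  simp only [Matrix.sub_mulVec, Matrix.smul_mulVec, Matrix.one_mulVec, Pi.sub_apply,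
      Pi.smul_apply, smul_eq_mul, Matrix.mulVec_mulVec, Matrix.mul_assoc]
  ring

theorem Qmp_mulVec_add (y : Fin m → ℂ)
    (hy : (fun k : SZero σ => y k) = zeroPart σ T s (fun k => y k) fun k => y k) (i : SNeg σ) :
    (Qmp σ T c s *ᵥ fun k => y k) i + (Qmm σ T c s *ᵥ fun k => y k) i
      = (∑ k, (T i k : ℂ) * y k - s * y i) / (|c i| : ℝ) := by
  rw [Qmp, Qmm, absRateInv, absRateInv_mul_mulVec, absRateInv_mul_mulVec,
    ← schur_mulVec (σ · = -1) i y hy]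
  simp only [Matrix.sub_mulVec, Matrix.smul_mulVec, Matrix.one_mulVec, Pi.sub_apply,
      Pi.smul_apply, smul_eq_mul, Matrix.mulVec_mulVec, Matrix.mul_assoc]
  ring

/-- The vector with prescribed components. -/
def fill (σ : Fin m → SignType) (yp : SPos σ → ℂ) (ym : SNeg σ → ℂ) (y0 : SZero σ → ℂ)
    (k : Fin m) : ℂ :=
  if h : σ k = 1 then yp ⟨k, h⟩ else if h' : σ k = -1 then ym ⟨k, h'⟩
  else if h'' : σ k = 0 then y0 ⟨k, h''⟩ else 0

@[simp] theorem fill_pos (yp : SPos σ → ℂ) (ym : SNeg σ → ℂ) (y0 : SZero σ → ℂ) (k : SPos σ) :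
    fill σ yp ym y0 k = yp k := by simp [fill, k.2]

@[simp] theorem fill_neg (yp : SPos σ → ℂ) (ym : SNeg σ → ℂ) (y0 : SZero σ → ℂ) (k : SNeg σ) :
    fill σ yp ym y0 k = ym k := by simp [fill, k.2]

@[simp] theorem fill_zero (yp : SPos σ → ℂ) (ym : SNeg σ → ℂ) (y0 : SZero σ → ℂ) (k : SZero σ) :
    fill σ yp ym y0 k = y0 k := by simp [fill, k.2]

/-- The equations `z₊' = Q₊₊ z₊ + Q₊₋ z₋` and `z₋' = -(Q₋₊ z₊ + Q₋₋ z₋)` on `[0, ∞)`. -/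
structure IsReducedSolution (σ : Fin m → SignType) (T : Matrix (Fin m) (Fin m) ℝ)
    (c : Fin m → ℝ) (s : ℂ) (zp : ℝ → SPos σ → ℂ) (zm : ℝ → SNeg σ → ℂ) : Prop where
  pos : ∀ x, 0 ≤ x → HasDerivWithinAt zp
    (Qpp σ T c s *ᵥ zp x + Qpm σ T c s *ᵥ zm x) (Set.Ici 0) x
  neg : ∀ x, 0 ≤ x → HasDerivWithinAt zm
    (-(Qmp σ T c s *ᵥ zp x + Qmm σ T c s *ᵥ zm x)) (Set.Ici 0) x

theorem sign_eq_zero_iff' (hσ : ∀ i, SignType.sign (c i) = σ i) (i : Fin m) :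
    c i = 0 ↔ σ i = 0 := by rw [← hσ i, sign_eq_zero_iff]

/-- The minus sign in the second reduced equation comes from |cᵢ| = -cᵢ on the negative phases. -/
theorem IsFluidSolution.reduced (hT : IsGenerator T) (hs : 0 < s.re)
    (hσ : ∀ i, SignType.sign (c i) = σ i) {y : ℝ → Fin m → ℂ} (hy : IsFluidSolution T c s y) :
    IsReducedSolution σ T c s (fun x k => y x k) (fun x k => y x k) := by
  have h0 : ∀ x, 0 ≤ x → (fun k : SZero σ => y x k)
      = zeroPart σ T s (fun k => y x k) fun k => y x k := fun x hx =>
    (algebraic_iff hT hs (y x)).1 fun i hi =>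
      hy.algebraic i ((sign_eq_zero_iff' hσ i).2 hi) x hx
  constructor
  · intro x hx
    rw [hasDerivWithinAt_pi]
    intro i
    have hc : 0 < c i := by rw [← sign_eq_one_iff, hσ, i.2]
    rw [Pi.add_apply, Qpp_mulVec_add (y x) (h0 x hx) i, abs_of_pos hc]
    exact hy.hasDeriv i hc.ne' x hx
  · intro x hx
    rw [hasDerivWithinAt_pi]
    intro i
    have hc : c i < 0 := by rw [← sign_eq_neg_one_iff, hσ, i.2]
    rw [Pi.neg_apply, Pi.add_apply, Qmp_mulVec_add (y x) (h0 x hx) i, abs_of_neg hc,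
      Complex.ofReal_neg, div_neg, neg_neg]
    exact hy.hasDeriv i hc.ne x hx

theorem IsReducedSolution.fluid (hT : IsGenerator T) (hs : 0 < s.re)
    (hσ : ∀ i, SignType.sign (c i) = σ i) {zp : ℝ → SPos σ → ℂ} {zm : ℝ → SNeg σ → ℂ}
    (hz : IsReducedSolution σ T c s zp zm) :
    IsFluidSolution T c s fun x => fill σ (zp x) (zm x) (zeroPart σ T s (zp x) (zm x)) := by
  have h0 : ∀ x, (fun k : SZero σ => fill σ (zp x) (zm x) (zeroPart σ T s (zp x) (zm x)) k)
      = zeroPart σ T s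
        (fun k => fill σ (zp x) (zm x) (zeroPart σ T s (zp x) (zm x)) k)
        fun k => fill σ (zp x) (zm x) (zeroPart σ T s (zp x) (zm x)) k := fun x => by
    simp
  constructor
  · intro i hc x hx
    rcases lt_or_gt_of_ne hc with hc | hc
    · have hi : σ i = -1 := by rw [← hσ, sign_eq_neg_one_iff]; exact hc
      have h := hasDerivWithinAt_pi.1 (hz.neg x hx) ⟨i, hi⟩
      have h2 := Qmp_mulVec_add (c := c) _ (h0 x) ⟨i, hi⟩
      simp only [fill_pos, fill_neg] at h2
      rw [Pi.neg_apply, Pi.add_apply, h2, abs_of_neg hc, Complex.ofReal_neg, div_neg,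
        neg_neg] at h
      convert! h using 1
      ext u; simp [fill, hi]
    · have hi : σ i = 1 := by rw [← hσ, sign_eq_one_iff]; exact hc
      have h := hasDerivWithinAt_pi.1 (hz.pos x hx) ⟨i, hi⟩
      have h2 := Qpp_mulVec_add (c := c) _ (h0 x) ⟨i, hi⟩
      simp only [fill_pos, fill_neg] at h2
      rw [Pi.add_apply, h2, abs_of_pos hc] at h
      convert! h using 1
      ext u; simp [fill, hi]
  · intro i hc x _
    exact (algebraic_iff hT hs _).2 (h0 x) i ((sign_eq_zero_iff' hσ i).1 hc)

end Schur

/-! ### The differential equations of the passage transforms -/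

section PassageEquation

variable {m : ℕ} {T : Matrix (Fin m) (Fin m) ℝ} {c : Fin m → ℝ} {s : ℂ} {j : Fin m}

theorem tsum_jumpWeight (hT : IsGenerator T) (i : Fin m) :
    ∑' k, jumpWeight T i k = ENNReal.ofReal (-T i i) := by
  have h := hT.2 i
  rw [← Finset.add_sum_erase _ _ (Finset.mem_univ i)] at h
  have h2 : -T i i = ∑ k ∈ Finset.univ.erase i, T i k := by linarith
  rw [tsum_fintype, ← Finset.add_sum_erase _ _ (Finset.mem_univ i), h2,
    ENNReal.ofReal_sum_of_nonneg fun k hk => hT.1 i k (Finset.ne_of_mem_erase hk).symm]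
  have h3 : jumpWeight T i i = 0 := by simp [jumpWeight]
  rw [h3, zero_add]
  exact Finset.sum_congr rfl fun k hk => by simp [jumpWeight, Finset.ne_of_mem_erase hk]

theorem rate_mul_jumpPMF (hT : IsGenerator T) {i : Fin m} (hi : T i i ≠ 0) (k : Fin m) :
    -T i i * (jumpPMF T i k).toReal = if k = i then 0 else T i k := by
  have hq : 0 < -T i i := neg_pos.2 (lt_of_le_of_ne (hT.diag_nonpos i) hi)
  have h0 : ∑' k, jumpWeight T i k ≠ 0 := by
    rw [tsum_jumpWeight hT, Ne, ENNReal.ofReal_eq_zero]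
    linarith
  rw [jumpPMF, dif_neg h0, PMF.normalize_apply, tsum_jumpWeight hT, ENNReal.toReal_mul,
    ENNReal.toReal_inv, ENNReal.toReal_ofReal hq.le, jumpWeight]
  split_ifs with hk
  · simp
  · rw [ENNReal.toReal_ofReal (hT.1 i k fun h => hk h.symm)]
    field_simp

theorem rate_mul_sum_jumpPMF (hT : IsGenerator T) {i : Fin m} (hi : T i i ≠ 0) (y : Fin m → ℂ) :
    (-T i i : ℂ) * ∑ k, ((jumpPMF T i k).toReal : ℂ) * y k = inflow T i y := by
  have h : ∀ k, (-T i i : ℂ) * (((jumpPMF T i k).toReal : ℂ) * y k)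
      = if k = i then 0 else (T i k : ℂ) * y k := by
    intro k
    have := rate_mul_jumpPMF hT hi k
    rw [← mul_assoc, ← Complex.ofReal_neg, ← Complex.ofReal_mul, this]
    split_ifs <;> simp
  rw [Finset.mul_sum, Finset.sum_congr rfl fun k _ => h k, inflow,
    ← Finset.add_sum_erase _ _ (Finset.mem_univ i), if_pos rfl, zero_add]
  exact Finset.sum_congr rfl fun k hk => if_neg (Finset.ne_of_mem_erase hk)

theorem inflow_of_absorbing (hT : IsGenerator T) {i : Fin m} (hi : T i i = 0) (y : Fin m → ℂ) :
    inflow T i y = 0 := by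
  have h := norm_inflow_le hT i (y := y) (M := ∑ k, ‖y k‖) fun k =>
    Finset.single_le_sum (f := fun k => ‖y k‖) (fun _ _ => norm_nonneg _) (Finset.mem_univ k)
  rw [hi, neg_zero, zero_mul] at h
  exact norm_le_zero_iff.1 h

variable (T c s j)

/-- The vector of the passage transforms at height `x`. -/
def passageVec (x : ℝ) (i : Fin m) : ℂ := passageTransform T c s j i x

/-- The mean of the passage transforms after a jump out of phase `i`. -/
def jumpMean (i : Fin m) (x : ℝ) : ℂ :=
  ∑ k, ((jumpPMF T i k).toReal : ℂ) * passageVec T c s j x k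

@[fun_prop]
theorem measurable_jumpMean (i : Fin m) : Measurable (jumpMean T c s j i) :=
  Finset.measurable_fun_sum _ fun k _ => (measurable_passageTransform T c s j k).const_mul _

variable {T c s j}

theorem norm_jumpMean_le (hT : IsGenerator T) (hs : 0 < s.re) (i : Fin m) (x : ℝ) :
    ‖jumpMean T c s j i x‖ ≤ 1 := by
  refine (norm_sum_le _ _).trans ?_
  rw [← sum_jumpPMF (T := T) i]
  refine Finset.sum_le_sum fun k _ => ?_
  rw [norm_mul, Complex.norm_real, Real.norm_of_nonneg ENNReal.toReal_nonneg]
  exact mul_le_of_le_one_right ENNReal.toReal_nonneg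
    (norm_passageTransform_le hs hT.diag_nonpos k x)

theorem passageVec_eq (hT : IsGenerator T) (hs : 0 < s.re) (i : Fin m) (x : ℝ) :
    passageVec T c s j x i = ∫ e in Set.Ioi (0 : ℝ), Complex.exp (-(e : ℂ)) *
      passageStep T c s j x (i, e) (jumpMean T c s j i (heightAfter T c x (i, e))) := by
  rw [passageVec, passageTransform_eq hs hT.diag_nonpos, integral_expMeasure_one]
  rfl

theorem integrableOn_exp_mul_bounded {κ : ℂ} (hκ : κ.re < 0) {H : ℝ → ℂ} (hH : Measurable H)
    (hb : ∀ y, ‖H y‖ ≤ 1) (a : ℝ) :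
    IntegrableOn (fun y : ℝ => Complex.exp (κ * y) * H y) (Set.Ioi a) := by
  refine Integrable.mono (integrableOn_exp_mul_complex_Ioi hκ a)
    (Measurable.aestronglyMeasurable (by fun_prop)) (Filter.Eventually.of_forall fun y => ?_)
  rw [norm_mul]
  exact mul_le_of_le_one_right (norm_nonneg _) (hb y)

theorem intervalIntegrable_exp_mul_bounded (κ : ℂ) {H : ℝ → ℂ} (hH : Measurable H)
    (hb : ∀ y, ‖H y‖ ≤ 1) (a b : ℝ) :
    IntervalIntegrable (fun y : ℝ => Complex.exp (κ * y) * H y) volume a b := by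
  have h : Continuous fun y : ℝ => Complex.exp (κ * y) := by fun_prop
  refine (h.intervalIntegrable a b).mono_fun
    (Measurable.aestronglyMeasurable (by fun_prop)) (Filter.Eventually.of_forall fun y => ?_)
  simp only [norm_mul]
  exact mul_le_of_le_one_right (norm_nonneg _) (hb y)

/-- The Volterra equation with kernel `exp (κ u)` and the mean after a jump. -/
theorem passageVec_volterra (hT : IsGenerator T) (hs : 0 < s.re) {i : Fin m}
    (hc : c i ≠ 0) : ∃ A : ℂ, (0 < c i → A = if i = j then 1 else 0) ∧ ∀ x, 0 ≤ x →
      passageVec T c s j x i = Complex.exp (-((-T i i + s) / c i * x)) *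
        (A + (-T i i / c i) * ∫ u in (0 : ℝ)..x,
          Complex.exp ((-T i i + s) / c i * u) * jumpMean T c s j i u) := by
  set κ : ℂ := (-T i i + s) / c i with hκ
  have hκre : κ.re = (-T i i + s.re) / c i := by
    rw [hκ, Complex.div_ofReal_re]; simp
  have hcc : (c i : ℂ) ≠ 0 := by exact_mod_cast hc
  have hq0 : 0 ≤ -T i i := neg_nonneg.2 (hT.diag_nonpos i)
  set F : ℝ → ℂ := fun u => Complex.exp (κ * u) * jumpMean T c s j i u with hF
  have hHm := measurable_jumpMean T c s j i
  have hHb := norm_jumpMean_le (c := c) (j := j) hT hs i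
  -- the part of the integrand after a jump
  have hstep : ∀ x e : ℝ, T i i ≠ 0 → Complex.exp (-(e : ℂ)) *
      (Complex.exp (-s * ((e / -T i i : ℝ) : ℂ)) *
        jumpMean T c s j i (heightAfter T c x (i, e)))
      = Complex.exp (-(κ * x)) * F (x - c i / -T i i * e) := by
    intro x e hq
    have hqc : (T i i : ℂ) ≠ 0 := by exact_mod_cast hq
    have h1 : heightAfter T c x (i, e) = x - c i / -T i i * e := by
      unfold heightAfter; simp only; ring
    rw [h1, hF, ← mul_assoc, ← mul_assoc, ← Complex.exp_add, ← Complex.exp_add]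
    congr 2
    rw [hκ]
    push_cast
    field_simp
    ring
  rcases lt_or_gt_of_ne hc with hc | hc
  · have hκ0 : κ.re < 0 := by rw [hκre]; exact div_neg_of_pos_of_neg (by linarith) hc
    have hFi : ∀ a, IntegrableOn F (Set.Ioi a) := integrableOn_exp_mul_bounded hκ0 hHm hHb
    have hform : ∀ x, 0 ≤ x → passageVec T c s j x i
        = Complex.exp (-(κ * x)) * (-(-T i i / c i) * ∫ u in Set.Ioi x, F u) := by
      intro x hx
      rw [passageVec_eq hT hs]
      by_cases hq : T i i = 0
      · simp only [passageStep]
        rw [setIntegral_eq_zero_of_forall_eq_zero]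
        · simp [hq]
        · intro e he
          have he' : 0 < e := he
          rw [if_neg (by push Not; exact ⟨hx, he'⟩), if_neg (by simp [hc.not_gt]), if_pos hq,
            mul_zero]
      · have hqp : 0 < -T i i := lt_of_le_of_ne hq0 (Ne.symm (neg_ne_zero.2 hq))
        have ha : 0 < -c i / -T i i := div_pos (neg_pos.2 hc) hqp
        have h1 : ∀ e ∈ Set.Ioi (0 : ℝ), Complex.exp (-(e : ℂ)) * passageStep T c s j x (i, e)
            (jumpMean T c s j i (heightAfter T c x (i, e)))
            = Complex.exp (-(κ * x)) * F (x + -c i / -T i i * e) := by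
          intro e he
          have he' : 0 < e := he
          rw [passageStep, if_neg (by push Not; exact ⟨hx, he'⟩),
            if_neg (by simp [hc.not_gt]), if_neg hq, hstep x e hq]
          congr 2
          ring
        rw [setIntegral_congr_fun measurableSet_Ioi h1, integral_const_mul,
          integral_comp_mul_left_Ioi (fun u => F (x + u)) 0 ha, mul_zero]
        have h2 : ∫ u in Set.Ioi (0 : ℝ), F (x + u) = ∫ u in Set.Ioi x, F u := by
          have := (measurePreserving_add_left volume x).setIntegral_preimage_emb
            (measurableEmbedding_addLeft x) F (Set.Ioi x)
          simpa using this
        rw [h2, Complex.real_smul]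
        congr 2
        have hqc : (T i i : ℂ) ≠ 0 := by exact_mod_cast hq
        push_cast
        field_simp
    -- With a negative rate the height after the jump ranges over (x, ∞). Splitting the integral
    -- over (0, ∞) at x turns this backward formula into the forward one, and the full integral
    -- becomes the constant `A`.
    refine ⟨-(-T i i / c i) * ∫ u in Set.Ioi (0 : ℝ), F u, fun h => absurd h hc.not_gt,
      fun x hx => ?_⟩
    rw [hform x hx, ← intervalIntegral.integral_interval_add_Ioi (hFi 0) (hFi x)]
    ring
  · refine ⟨if i = j then 1 else 0, fun _ => rfl, fun x hx => ?_⟩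
    rw [passageVec_eq hT hs]
    by_cases hq : T i i = 0
    · have h1 : ∀ e ∈ Set.Ioi (0 : ℝ), Complex.exp (-(e : ℂ)) * passageStep T c s j x (i, e)
          (jumpMean T c s j i (heightAfter T c x (i, e)))
          = Complex.exp ((-1 : ℂ) * e) *
            (Complex.exp (-(κ * x)) * if i = j then 1 else 0) := by
        intro e he
        have he' : 0 < e := he
        rw [passageStep, if_neg (by push Not; exact ⟨hx, he'⟩),
          if_pos ⟨hc, by simp only [hq, neg_zero, mul_zero]; exact mul_pos hc he'⟩, hκ, hq]
        simp only [mul_ite, mul_one, mul_zero, neg_mul, one_mul]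
        split_ifs
        · congr 2
          push_cast
          field_simp
          simp [mul_comm]
        · rfl
      rw [setIntegral_congr_fun measurableSet_Ioi h1, integral_mul_const,
        integral_exp_mul_complex_Ioi (by simp)]
      simp [hq]
    · have hqp : 0 < -T i i := lt_of_le_of_ne hq0 (Ne.symm (neg_ne_zero.2 hq))
      have hqc : (T i i : ℂ) ≠ 0 := by exact_mod_cast hq
      -- Clock value at which the first sojourn just reaches height x: below it a jump comes first,
      -- above it the passage occurs.
      set b : ℝ := x * -T i i / c i with hb
      have hb0 : 0 ≤ b := by positivity
      have hI : IntegrableOn (fun e : ℝ => Complex.exp (-(e : ℂ)) * passageStep T c s j x (i, e)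
          (jumpMean T c s j i (heightAfter T c x (i, e)))) (Set.Ioi 0) := by
        have hm : Measurable fun e : ℝ => passageStep T c s j x (i, e)
            (jumpMean T c s j i (heightAfter T c x (i, e))) := by
          have h2 : Measurable fun e : ℝ => jumpMean T c s j i (heightAfter T c x (i, e)) :=
            hHm.comp ((measurable_heightAfter T c).comp
              (measurable_const.prodMk (measurable_const.prodMk measurable_id)))
          exact (measurable_passageStep T c s j).comp
            (measurable_const.prodMk ((measurable_const.prodMk measurable_id).prodMk h2))
        have := integrableOn_exp_mul_bounded (κ := -1) (by simp) hm
          (fun e => norm_passageStep_le hs hT.diag_nonpos x _ (hHb _)) 0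
        simpa using this
      rw [← intervalIntegral.integral_interval_add_Ioi (b := b) hI
        (hI.mono_set (Set.Ioi_subset_Ioi hb0))]
      have h1 : ∫ e in (0 : ℝ)..b, Complex.exp (-(e : ℂ)) * passageStep T c s j x (i, e)
          (jumpMean T c s j i (heightAfter T c x (i, e)))
          = ∫ e in (0 : ℝ)..b, Complex.exp (-(κ * x)) * F (x - c i / -T i i * e) := by
        rw [intervalIntegral.integral_of_le hb0, intervalIntegral.integral_of_le hb0]
        refine setIntegral_congr_fun measurableSet_Ioc fun e he => ?_
        have hle : ¬ (0 < c i ∧ x * -T i i < c i * e) := by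
          rintro ⟨-, h⟩
          have := he.2
          rw [hb, le_div_iff₀ hc] at this
          linarith
        rw [passageStep, if_neg (by push Not; exact ⟨hx, he.1⟩), if_neg hle, if_neg hq,
          hstep x e hq]
      have h2 : ∫ e in Set.Ioi b, Complex.exp (-(e : ℂ)) * passageStep T c s j x (i, e)
          (jumpMean T c s j i (heightAfter T c x (i, e)))
          = ∫ e in Set.Ioi b, Complex.exp ((-1 : ℂ) * e) *
            (if i = j then Complex.exp (-s * ((x / c i : ℝ) : ℂ)) else 0) := by
        refine setIntegral_congr_fun measurableSet_Ioi fun e he => ?_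
        have hlt : x * -T i i < c i * e := by
          have : b < e := he
          rw [hb, div_lt_iff₀ hc] at this
          linarith
        rw [passageStep, if_neg (by push Not; exact ⟨hx, hb0.trans_lt he⟩),
          if_pos ⟨hc, hlt⟩, neg_one_mul]
      rw [h1, h2, intervalIntegral.integral_const_mul, integral_mul_const,
        integral_exp_mul_complex_Ioi (by simp),
        intervalIntegral.integral_comp_sub_mul F (div_pos hc hqp).ne']
      have h3 : x - c i / -T i i * b = 0 := by rw [hb]; field_simp; ring
      rw [h3, mul_zero, sub_zero, Complex.real_smul, add_comm, mul_add]
      congr 1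
      · split_ifs
        · rw [mul_one, neg_div_neg_eq, div_one, ← Complex.exp_add]
          congr 1
          rw [hκ, hb]
          push_cast
          field_simp
          ring
        · simp
      · push_cast
        field_simp

theorem passageVec_zero_of_pos (hT : IsGenerator T) (hs : 0 < s.re) {i : Fin m} (hc : 0 < c i) :
    passageVec T c s j 0 i = if i = j then 1 else 0 := by
  obtain ⟨A, hA, h⟩ := passageVec_volterra (j := j) hT hs hc.ne'
  rw [h 0 le_rfl, ← hA hc]
  simp

/-- At rate zero the height is unchanged over the sojourn, so the first-step equation only
multiplies the mean after the jump by the transform of an exponential time. -/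
theorem passageVec_algebraic (hT : IsGenerator T) (hs : 0 < s.re) {i : Fin m} (hc : c i = 0)
    {x : ℝ} (hx : 0 ≤ x) :
    ∑ k, (T i k : ℂ) * passageVec T c s j x k = s * passageVec T c s j x i := by
  have hq0 := hT.diag_nonpos i
  have key : (-T i i + s) * passageVec T c s j x i = inflow T i (passageVec T c s j x) := by
    rw [passageVec_eq hT hs]
    by_cases hq : T i i = 0
    · rw [setIntegral_eq_zero_of_forall_eq_zero, inflow_of_absorbing hT hq, mul_zero]
      intro e he
      have he' : 0 < e := he
      rw [passageStep, if_neg (by push Not; exact ⟨hx, he'⟩), if_neg (by simp [hc]), if_pos hq,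
        mul_zero]
    · have hqp : 0 < -T i i := neg_pos.2 (lt_of_le_of_ne hq0 hq)
      have hqc : (T i i : ℂ) ≠ 0 := by exact_mod_cast hq
      have h1 : ∀ e ∈ Set.Ioi (0 : ℝ), Complex.exp (-(e : ℂ)) * passageStep T c s j x (i, e)
          (jumpMean T c s j i (heightAfter T c x (i, e)))
          = Complex.exp (-((-T i i + s) / -T i i) * e) * jumpMean T c s j i x := by
        intro e he
        have he' : 0 < e := he
        have h2 : heightAfter T c x (i, e) = x := by simp [heightAfter, hc]
        rw [passageStep, if_neg (by push Not; exact ⟨hx, he'⟩), if_neg (by simp [hc]),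
          if_neg hq, h2, ← mul_assoc, ← Complex.exp_add]
        congr 2
        push_cast
        field_simp
      have hre : (-((-T i i + s) / -T i i) : ℂ).re < 0 := by
        rw [← Complex.ofReal_neg, Complex.neg_re, Complex.div_ofReal_re, neg_lt_zero]
        refine div_pos ?_ hqp
        rw [Complex.add_re, Complex.ofReal_re]
        linarith
      have hne : (-T i i + s : ℂ) ≠ 0 := by
        intro h
        have := congrArg Complex.re h
        simp at this
        linarith
      rw [setIntegral_congr_fun measurableSet_Ioi h1, integral_mul_const,
        integral_exp_mul_complex_Ioi hre, jumpMean, ← rate_mul_sum_jumpPMF hT hq,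
        Complex.ofReal_zero, mul_zero, Complex.exp_zero]
      field_simp
  rw [sum_mul_eq_inflow]
  linear_combination -key

theorem continuousOn_passageVec_of_ne (hT : IsGenerator T) (hs : 0 < s.re) {i : Fin m}
    (hc : c i ≠ 0) : ContinuousOn (fun x => passageVec T c s j x i) (Set.Ici 0) := by
  obtain ⟨A, -, h⟩ := passageVec_volterra (j := j) hT hs hc
  have h1 : Continuous fun x => ∫ u in (0 : ℝ)..x,
      Complex.exp ((-T i i + s) / c i * u) * jumpMean T c s j i u :=
    intervalIntegral.continuous_primitive (intervalIntegrable_exp_mul_bounded _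
      (measurable_jumpMean T c s j i) (norm_jumpMean_le hT hs i)) 0
  refine ContinuousOn.congr (f := fun x : ℝ => Complex.exp (-((-T i i + s) / c i * x)) *
    (A + (-T i i / c i) * ∫ u in (0 : ℝ)..x,
      Complex.exp ((-T i i + s) / c i * u) * jumpMean T c s j i u)) ?_ fun x hx => h x hx
  exact Continuous.continuousOn (by fun_prop)

/-- For nonzero rate the Volterra formula contains a primitive of a locally integrable function and
is therefore continuous. The components of rate zero are linear in the others, hence continuous too.
-/
theorem continuousOn_passageVec (hT : IsGenerator T) (hs : 0 < s.re) (i : Fin m) :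
    ContinuousOn (fun x => passageVec T c s j x i) (Set.Ici 0) := by
  rcases eq_or_ne (c i) 0 with hc | hc
  swap
  · exact continuousOn_passageVec_of_ne hT hs hc
  set σ : Fin m → SignType := fun i => SignType.sign (c i) with hσ
  have hi : σ i = 0 := by simp [hσ, hc]
  have h0 : ∀ x, 0 ≤ x → (fun k : SZero σ => passageVec T c s j x k)
      = zeroPart σ T s (fun k => passageVec T c s j x k) fun k => passageVec T c s j x k :=
    fun x hx => (algebraic_iff hT hs _).1 fun i hi =>
      passageVec_algebraic hT hs (sign_eq_zero_iff.1 hi) hx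
  have hp : ContinuousOn (fun x => fun k : SPos σ => passageVec T c s j x k) (Set.Ici 0) :=
    continuousOn_pi.2 fun k => continuousOn_passageVec_of_ne hT hs
      (sign_eq_one_iff.1 k.2).ne'
  have hm : ContinuousOn (fun x => fun k : SNeg σ => passageVec T c s j x k) (Set.Ici 0) :=
    continuousOn_pi.2 fun k => continuousOn_passageVec_of_ne hT hs
      (sign_eq_neg_one_iff.1 k.2).ne
  have hz : Continuous fun p : (SPos σ → ℂ) × (SNeg σ → ℂ) => zeroPart σ T s p.1 p.2 := by
    unfold zeroPart
    fun_prop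
  exact (continuousOn_pi.1 (hz.comp_continuousOn (hp.prodMk hm)) ⟨i, hi⟩).congr
    fun x hx => congrFun (h0 x hx) ⟨i, hi⟩

theorem hasDerivWithinAt_primitive {F : ℝ → ℂ} (hF : ContinuousOn F (Set.Ici 0)) {x : ℝ}
    (hx : 0 ≤ x) :
    HasDerivWithinAt (fun x => ∫ u in (0 : ℝ)..x, F u) (F x) (Set.Ici 0) x := by
  -- Clamping at 0 extends `F` continuously to the line, which gives the fundamental theorem of
  -- calculus at the endpoint 0 as well.
  have hG : Continuous fun u => F (max u 0) :=
    hF.comp_continuous (by fun_prop) fun u => le_max_right u 0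
  have h1 := (intervalIntegral.integral_hasDerivAt_right (hG.intervalIntegrable 0 x)
    hG.stronglyMeasurable.stronglyMeasurableAtFilter hG.continuousAt).hasDerivWithinAt
    (s := Set.Ici 0)
  rw [max_eq_left hx] at h1
  have h2 : ∀ x : ℝ, 0 ≤ x → ∫ u in (0 : ℝ)..x, F u = ∫ u in (0 : ℝ)..x, F (max u 0) := by
    intro x hx
    refine intervalIntegral.integral_congr fun u hu => ?_
    rw [Set.uIcc_of_le hx] at hu
    simp only [max_eq_left hu.1]
  exact h1.congr (fun u hu => h2 u hu) (h2 x hx)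

/-- The passage transforms satisfy the fluid equations. -/
theorem isFluidSolution_passageVec (hT : IsGenerator T) (hs : 0 < s.re) :
    IsFluidSolution T c s (passageVec T c s j) := by
  refine ⟨fun i hc x hx => ?_, fun i hc x hx => passageVec_algebraic hT hs hc hx⟩
  obtain ⟨A, -, h⟩ := passageVec_volterra (j := j) hT hs hc
  have hcc : (c i : ℂ) ≠ 0 := by exact_mod_cast hc
  set κ : ℂ := (-T i i + s) / c i with hκ
  -- Continuity of the integrand is what upgrades the Volterra equation to a differential equation.
  have hH : ContinuousOn (jumpMean T c s j i) (Set.Ici 0) :=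
    continuousOn_finsetSum _ fun k _ => continuousOn_const.mul (continuousOn_passageVec hT hs k)
  have hF : ContinuousOn (fun u : ℝ => Complex.exp (κ * u) * jumpMean T c s j i u)
      (Set.Ici 0) := ContinuousOn.mul (Continuous.continuousOn (by fun_prop)) hH
  have h1 : HasDerivAt (fun u : ℝ => Complex.exp (-(κ * u)))
      (Complex.exp (-(κ * x)) * (-(κ * 1))) x :=
    (((hasDerivAt_id (x : ℂ)).const_mul κ).neg.cexp).comp_ofReal
  have h2 := h1.hasDerivWithinAt.mul
    (((hasDerivWithinAt_primitive hF hx).const_mul (-T i i / c i : ℂ)).const_add A)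
  refine (h2.congr (fun u hu => h u hu) (h x hx)).congr_deriv ?_
  have hin : (-T i i : ℂ) * jumpMean T c s j i x = inflow T i (passageVec T c s j x) := by
    by_cases hq : T i i = 0
    · rw [inflow_of_absorbing hT hq, hq]; simp
    · exact rate_mul_sum_jumpPMF hT hq _
  have hexp : Complex.exp (-(κ * x)) * Complex.exp (κ * x) = 1 := by
    rw [← Complex.exp_add]; simp
  have hx' := h x hx
  rw [sum_mul_eq_inflow, ← hin]
  have e1 : Complex.exp (-(κ * x)) * (-(κ * 1)) * (A + (-T i i / c i) * ∫ u in (0 : ℝ)..x,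
      Complex.exp (κ * u) * jumpMean T c s j i u) = -κ * passageVec T c s j x i := by
    rw [hx']; ring
  have e2 : Complex.exp (-(κ * x)) * ((-T i i / c i) * (Complex.exp (κ * x) *
      jumpMean T c s j i x)) = -T i i / c i * jumpMean T c s j i x := by
    linear_combination (-T i i / c i * jumpMean T c s j i x) * hexp
  rw [e1, e2, hκ]
  field_simp
  ring

end PassageEquation

/-! ### The matrix equations satisfied by `Ξ` -/

section Riccati

open Matrix
open scoped Matrix.Norms.Operator

/-! ### Matrix-valued functions and the matrix exponential -/

section Calculus

variable {α β : Type*} [Fintype α] [Fintype β]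

theorem hasDerivWithinAt_const_mulVec (Q : Matrix α β ℂ) {z : ℝ → β → ℂ} {z' : β → ℂ}
    {S : Set ℝ} {x : ℝ} (h : HasDerivWithinAt z z' S x) :
    HasDerivWithinAt (fun u => Q *ᵥ z u) (Q *ᵥ z') S x :=
  (Q.mulVecLin.restrictScalars ℝ).toContinuousLinearMap.hasFDerivAt.comp_hasDerivWithinAt x h

theorem hasDerivWithinAt_mulVec_const {M : ℝ → Matrix α β ℂ} {M' : Matrix α β ℂ}
    {S : Set ℝ} {x : ℝ} (h : HasDerivWithinAt M M' S x) (v : β → ℂ) :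
    HasDerivWithinAt (fun u => M u *ᵥ v) (M' *ᵥ v) S x := by
  let L : Matrix α β ℂ →ₗ[ℝ] (α → ℂ) :=
    { toFun := fun M => M *ᵥ v
      map_add' := fun A B => Matrix.add_mulVec A B v
      map_smul' := fun r A => Matrix.smul_mulVec r A v }
  exact L.toContinuousLinearMap.hasFDerivAt.comp_hasDerivWithinAt x h

theorem hasDerivWithinAt_matrix {M : ℝ → Matrix α β ℂ} {M' : Matrix α β ℂ} {S : Set ℝ} {x : ℝ}
    (h : ∀ i j, HasDerivWithinAt (fun u => M u i j) (M' i j) S x) :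
    HasDerivWithinAt M M' S x := by
  have h1 : HasDerivWithinAt (fun u => fun i j => M u i j) (fun i j => M' i j) S x :=
    hasDerivWithinAt_pi.2 fun i => hasDerivWithinAt_pi.2 fun j => h i j
  exact (Matrix.ofLinearEquiv ℝ : (α → β → ℂ) ≃ₗ[ℝ] Matrix α β ℂ).toLinearMap
    |>.toContinuousLinearMap.hasFDerivAt.comp_hasDerivWithinAt x h1

variable [DecidableEq α]

/-- The semigroup generated by a matrix. -/
def expFlow (A : Matrix α α ℂ) (x : ℝ) : Matrix α α ℂ := NormedSpace.exp (x • A)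

theorem hasDerivAt_expFlow (A : Matrix α α ℂ) (x : ℝ) :
    HasDerivAt (expFlow A) (A * expFlow A x) x := hasDerivAt_exp_smul_const' A x

theorem expFlow_zero (A : Matrix α α ℂ) : expFlow A 0 = 1 := by
  rw [expFlow, zero_smul, NormedSpace.exp_zero]

theorem expFlow_add (A : Matrix α α ℂ) (x y : ℝ) :
    expFlow A (x + y) = expFlow A x * expFlow A y := by
  rw [expFlow, add_smul]
  exact NormedSpace.exp_add_of_commute (((Commute.refl A).smul_right y).smul_left x)

theorem continuous_expFlow (A : Matrix α α ℂ) : Continuous (expFlow A) :=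
  continuous_iff_continuousAt.2 fun x => (hasDerivAt_expFlow A x).continuousAt

theorem continuous_expFlow_left (x : ℝ) : Continuous fun A : Matrix α α ℂ => expFlow A x :=
  NormedSpace.exp_continuous.comp (continuous_const_smul x)

theorem hasDerivWithinAt_expFlow_mulVec (A : Matrix α α ℂ) (v : α → ℂ) (S : Set ℝ) (x : ℝ) :
    HasDerivWithinAt (fun x => expFlow A x *ᵥ v) (A *ᵥ (expFlow A x *ᵥ v)) S x := by
  rw [Matrix.mulVec_mulVec]
  exact hasDerivWithinAt_mulVec_const (hasDerivAt_expFlow A x).hasDerivWithinAt v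

/-- A matrix solution of `M' = M A` on the half-line is determined by its initial value. -/
theorem eq_mul_expFlow {M : ℝ → Matrix α α ℂ} {A : Matrix α α ℂ}
    (hM : ∀ x, 0 ≤ x → HasDerivWithinAt M (M x * A) (Set.Ici 0) x) {x : ℝ} (hx : 0 ≤ x) :
    M x = M 0 * expFlow A x := by
  have hneg : ∀ x, HasDerivAt (fun x => expFlow A (-x)) (-(A * expFlow A (-x))) x := by
    intro x
    have := (hasDerivAt_expFlow A (-x)).scomp x (hasDerivAt_neg x)
    rw [neg_one_smul] at this
    exact this
  have hd : ∀ x, 0 ≤ x →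
      HasDerivWithinAt (fun x => M x * expFlow A (-x)) 0 (Set.Ici 0) x := by
    intro x hx
    refine ((hM x hx).mul (hneg x).hasDerivWithinAt).congr_deriv ?_
    rw [mul_neg, mul_assoc, add_neg_cancel]
  have hc : M x * expFlow A (-x) = M 0 * expFlow A (-0) := by
    refine constant_of_has_deriv_right_zero (a := 0) (b := x)
      (f := fun x => M x * expFlow A (-x)) (fun u hu => ?_) (fun u hu => ?_) x ⟨hx, le_rfl⟩
    · exact (hd u hu.1).continuousWithinAt.mono fun w hw => hw.1
    · exact (hd u hu.1).mono (Set.Ici_subset_Ici.2 hu.1)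
  rw [neg_zero, expFlow_zero, mul_one] at hc
  rw [← hc, mul_assoc, ← expFlow_add, neg_add_cancel, expFlow_zero, mul_one]

end Calculus

/-! ### Reduced solutions of linear growth and the Riccati equation -/

variable {m : ℕ} {σ : Fin m → SignType} {T : Matrix (Fin m) (Fin m) ℝ} {c : Fin m → ℝ} {s : ℂ}

theorem IsReducedSolution.sub {zp wp : ℝ → SPos σ → ℂ} {zm wm : ℝ → SNeg σ → ℂ}
    (hz : IsReducedSolution σ T c s zp zm) (hw : IsReducedSolution σ T c s wp wm) :
    IsReducedSolution σ T c s (fun x => zp x - wp x) (fun x => zm x - wm x) := by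
  constructor
  · intro x hx
    refine ((hz.pos x hx).sub (hw.pos x hx)).congr_deriv ?_
    rw [Matrix.mulVec_sub, Matrix.mulVec_sub]
    abel
  · intro x hx
    refine ((hz.neg x hx).sub (hw.neg x hx)).congr_deriv ?_
    rw [Matrix.mulVec_sub, Matrix.mulVec_sub]
    abel

/-- The derivative of a solution is a solution. -/
theorem IsReducedSolution.deriv {zp : ℝ → SPos σ → ℂ} {zm : ℝ → SNeg σ → ℂ}
    (hz : IsReducedSolution σ T c s zp zm) :
    IsReducedSolution σ T c s (fun x => Qpp σ T c s *ᵥ zp x + Qpm σ T c s *ᵥ zm x)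
      (fun x => -(Qmp σ T c s *ᵥ zp x + Qmm σ T c s *ᵥ zm x)) :=
  ⟨fun x hx => (hasDerivWithinAt_const_mulVec _ (hz.pos x hx)).add
      (hasDerivWithinAt_const_mulVec _ (hz.neg x hx)),
    fun x hx => ((hasDerivWithinAt_const_mulVec _ (hz.pos x hx)).add
      (hasDerivWithinAt_const_mulVec _ (hz.neg x hx))).neg⟩

theorem exists_norm_zeroPart_le (σ : Fin m → SignType) (T : Matrix (Fin m) (Fin m) ℝ) (s : ℂ) :
    ∃ K : ℝ, 0 ≤ K ∧ ∀ (yp : SPos σ → ℂ) (ym : SNeg σ → ℂ) (B : ℝ), ‖yp‖ ≤ B → ‖ym‖ ≤ B →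
      ‖zeroPart σ T s yp ym‖ ≤ K * B := by
  refine ⟨‖zeroResolvent σ T s‖ * (‖block T (σ · = 0) (σ · = 1)‖
    + ‖block T (σ · = 0) (σ · = -1)‖), by positivity, fun yp ym B hp hm => ?_⟩
  rw [zeroPart, norm_neg, mul_assoc, add_mul]
  refine (Matrix.linfty_opNorm_mulVec _ _).trans ?_
  gcongr
  refine (norm_add_le _ _).trans (add_le_add ?_ ?_)
  · exact (Matrix.linfty_opNorm_mulVec _ _).trans (by gcongr)
  · exact (Matrix.linfty_opNorm_mulVec _ _).trans (by gcongr)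

/-- A solution of at most linear growth whose positive part starts at `0` vanishes. -/
theorem IsReducedSolution.eq_zero (hT : IsGenerator T) (hs : 0 < s.re)
    (hσ : ∀ i, SignType.sign (c i) = σ i) {zp : ℝ → SPos σ → ℂ} {zm : ℝ → SNeg σ → ℂ}
    (hz : IsReducedSolution σ T c s zp zm) (h0 : zp 0 = 0) {M : ℝ} (hM : 0 ≤ M)
    (hp : ∀ x, 0 ≤ x → ‖zp x‖ ≤ M * (1 + x)) (hm : ∀ x, 0 ≤ x → ‖zm x‖ ≤ M * (1 + x))
    {x : ℝ} (hx : 0 ≤ x) : zp x = 0 ∧ zm x = 0 := by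
  obtain ⟨K, hK, hKb⟩ := exists_norm_zeroPart_le σ T s
  set C : ℝ := 1 + ∑ i, |c i| with hC
  have hCi : ∀ i, |c i| ≤ C := fun i =>
    (Finset.single_le_sum (f := fun i => |c i|) (fun i _ => abs_nonneg _)
      (Finset.mem_univ i)).trans (by linarith)
  have hC0 : 0 < C := by positivity
  -- The bound 1 gives M(1 + x) ≤ (M/ε) exp(εx); the other bound is the growth condition of the
  -- uniqueness theorem.
  set ε : ℝ := min 1 (s.re / 2 / C) with hε
  have hε0 : 0 < ε := lt_min one_pos (by positivity)
  have hεc : ∀ i, ε * |c i| ≤ s.re / 2 := by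
    intro i
    calc ε * |c i| ≤ (s.re / 2 / C) * C :=
          mul_le_mul (min_le_right _ _) (hCi i) (abs_nonneg _) (by positivity)
      _ = s.re / 2 := by field_simp
  have hgrow : ∀ x, 0 ≤ x → M * (1 + x) ≤ M / ε * Real.exp (ε * x) := by
    intro x hx
    have h1 : ε ≤ 1 := min_le_left _ _
    have h2 := Real.add_one_le_exp (ε * x)
    rw [div_mul_eq_mul_div, le_div_iff₀ hε0, mul_assoc]
    refine mul_le_mul_of_nonneg_left ?_ hM
    nlinarith
  have hfl := hz.fluid hT hs hσ
  have key : ∀ i, fill σ (zp x) (zm x) (zeroPart σ T s (zp x) (zm x)) i = 0 := by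
    intro i
    refine hfl.eq_zero hT hs (ε := ε) (M := (1 + K) * (M / ε)) (fun i hi => ?_) hε0.le hεc
      (by positivity) (fun x hx i => ?_) hx i
    · have hi' : σ i = 1 := by rw [← hσ, sign_eq_one_iff]; exact hi
      simp [fill, hi', h0]
    · have hp' := (hp x hx).trans (hgrow x hx)
      have hm' := (hm x hx).trans (hgrow x hx)
      have h0' := hKb _ _ _ hp' hm'
      have hB : 0 ≤ M / ε * Real.exp (ε * x) := by positivity
      have hKB := mul_nonneg hK hB
      unfold fill
      split_ifs with h1 h2 h3
      · refine ((norm_le_pi_norm (zp x) ⟨i, h1⟩).trans hp').trans ?_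
        linarith
      · refine ((norm_le_pi_norm (zm x) ⟨i, h2⟩).trans hm').trans ?_
        linarith
      · refine ((norm_le_pi_norm (zeroPart σ T s (zp x) (zm x)) ⟨i, h3⟩).trans h0').trans ?_
        linarith
      · rw [norm_zero]; positivity
  exact ⟨funext fun i => by simpa using key i, funext fun i => by simpa using key i⟩

/-- The passage transforms from and to the phases of positive rate. -/
def passagePos (σ : Fin m → SignType) (T : Matrix (Fin m) (Fin m) ℝ) (c : Fin m → ℝ) (s : ℂ)
    (x : ℝ) : Matrix (SPos σ) (SPos σ) ℂ :=
  Matrix.of fun i j => passageVec T c s j.1 x i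

/-- The passage transforms from the phases of negative rate to those of positive rate. -/
def passageNeg (σ : Fin m → SignType) (T : Matrix (Fin m) (Fin m) ℝ) (c : Fin m → ℝ) (s : ℂ)
    (x : ℝ) : Matrix (SNeg σ) (SPos σ) ℂ :=
  Matrix.of fun i j => passageVec T c s j.1 x i

theorem passageNeg_zero (hT : IsGenerator T) (hσ : ∀ i, SignType.sign (c i) = σ i) :
    passageNeg σ T c s 0 = Xi σ T c s := by
  ext i j
  have hc : c i < 0 := by rw [← sign_eq_neg_one_iff, hσ, i.2]
  exact (integral_returnFunctional hT.diag_nonpos s i.1 j.1 hc).symm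

theorem passagePos_zero (hT : IsGenerator T) (hs : 0 < s.re)
    (hσ : ∀ i, SignType.sign (c i) = σ i) : passagePos σ T c s 0 = 1 := by
  ext i j
  have hc : 0 < c i := by rw [← sign_eq_one_iff, hσ, i.2]
  rw [passagePos, Matrix.of_apply, passageVec_zero_of_pos hT hs hc, Matrix.one_apply]
  simp [Subtype.ext_iff]

theorem norm_matrix_le {α β : Type*} [Fintype α] [Fintype β] {A : Matrix α β ℂ}
    (h : ∀ i j, ‖A i j‖ ≤ 1) : ‖A‖ ≤ Fintype.card β := by
  rw [Matrix.linfty_opNorm_def]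
  have : (Finset.univ.sup fun i => ∑ j, ‖A i j‖₊) ≤ (Fintype.card β : NNReal) := by
    refine Finset.sup_le fun i _ => ?_
    refine (Finset.sum_le_card_nsmul _ _ 1 fun j _ => ?_).trans (by simp)
    exact_mod_cast h i j
  exact_mod_cast this

theorem norm_passagePos_le (hT : IsGenerator T) (hs : 0 < s.re) (x : ℝ) :
    ‖passagePos σ T c s x‖ ≤ Fintype.card (SPos σ) :=
  norm_matrix_le fun i _ => norm_passageTransform_le hs hT.diag_nonpos i.1 x

theorem norm_passageNeg_le (hT : IsGenerator T) (hs : 0 < s.re) (x : ℝ) :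
    ‖passageNeg σ T c s x‖ ≤ Fintype.card (SPos σ) :=
  norm_matrix_le fun i _ => norm_passageTransform_le hs hT.diag_nonpos i.1 x

/-- Superposition of the passage transforms over the target phase, with weights v. -/
theorem isReducedSolution_passage (hT : IsGenerator T) (hs : 0 < s.re)
    (hσ : ∀ i, SignType.sign (c i) = σ i) (v : SPos σ → ℂ) :
    IsReducedSolution σ T c s (fun x => passagePos σ T c s x *ᵥ v)
      (fun x => passageNeg σ T c s x *ᵥ v) := by
  have h : IsFluidSolution T c s
      fun x i => ∑ j : SPos σ, passageVec T c s j.1 x i * v j := by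
    constructor
    · intro i hc x hx
      refine (HasDerivWithinAt.fun_sum fun (j : SPos σ) (_ : j ∈ Finset.univ) =>
        ((isFluidSolution_passageVec (j := j.1) hT hs).hasDeriv i hc x hx).mul_const
          (v j)).congr_deriv ?_
      simp only [Finset.mul_sum]
      rw [Finset.sum_comm, ← Finset.sum_sub_distrib, Finset.sum_div]
      refine Finset.sum_congr rfl fun j _ => ?_
      simp only [← mul_assoc, ← Finset.sum_mul]
      ring
    · intro i hc x hx
      simp only [Finset.mul_sum]
      rw [Finset.sum_comm]
      refine Finset.sum_congr rfl fun j _ => ?_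
      simp only [← mul_assoc, ← Finset.sum_mul]
      rw [passageVec_algebraic hT hs hc hx]
  exact h.reduced hT hs hσ

/-- A reduced solution of at most linear growth is determined by the initial value of its positive
part. -/
theorem IsReducedSolution.eq_passage (hT : IsGenerator T) (hs : 0 < s.re)
    (hσ : ∀ i, SignType.sign (c i) = σ i) {zp : ℝ → SPos σ → ℂ} {zm : ℝ → SNeg σ → ℂ}
    (hz : IsReducedSolution σ T c s zp zm) {M : ℝ} (hM : 0 ≤ M)
    (hp : ∀ x, 0 ≤ x → ‖zp x‖ ≤ M * (1 + x)) (hm : ∀ x, 0 ≤ x → ‖zm x‖ ≤ M * (1 + x))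
    {x : ℝ} (hx : 0 ≤ x) : zp x = passagePos σ T c s x *ᵥ zp 0 ∧
      zm x = passageNeg σ T c s x *ᵥ zp 0 := by
  have hw := isReducedSolution_passage hT hs hσ (zp 0)
  set N : ℝ := Fintype.card (SPos σ) * ‖zp 0‖ with hN
  have hN0 : 0 ≤ N := by positivity
  have hwp : ∀ x, 0 ≤ x → ‖passagePos σ T c s x *ᵥ zp 0‖ ≤ N * (1 + x) := fun x hx =>
    ((Matrix.linfty_opNorm_mulVec _ _).trans
      (mul_le_mul_of_nonneg_right (norm_passagePos_le hT hs x) (norm_nonneg _))).trans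
      (le_mul_of_one_le_right hN0 (by linarith))
  have hwm : ∀ x, 0 ≤ x → ‖passageNeg σ T c s x *ᵥ zp 0‖ ≤ N * (1 + x) := fun x hx =>
    ((Matrix.linfty_opNorm_mulVec _ _).trans
      (mul_le_mul_of_nonneg_right (norm_passageNeg_le hT hs x) (norm_nonneg _))).trans
      (le_mul_of_one_le_right hN0 (by linarith))
  have key := (hz.sub hw).eq_zero hT hs hσ ?_ (add_nonneg hM hN0)
    (fun x hx => ?_) (fun x hx => ?_) hx
  · exact ⟨sub_eq_zero.1 key.1, sub_eq_zero.1 key.2⟩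
  · simp only [passagePos_zero hT hs hσ, Matrix.one_mulVec, sub_self]
  · rw [add_mul]
    exact (norm_sub_le _ _).trans (add_le_add (hp x hx) (hwp x hx))
  · rw [add_mul]
    exact (norm_sub_le _ _).trans (add_le_add (hm x hx) (hwm x hx))

/-- The derivative of the bounded solution generated by v is a bounded solution whose positive part
starts at Uv. By uniqueness it is the solution generated by Uv. -/
theorem passage_deriv_eq (hT : IsGenerator T) (hs : 0 < s.re)
    (hσ : ∀ i, SignType.sign (c i) = σ i) {x : ℝ} (hx : 0 ≤ x) :
    Qpp σ T c s * passagePos σ T c s x + Qpm σ T c s * passageNeg σ T c s x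
        = passagePos σ T c s x * U σ T c s ∧
      -(Qmp σ T c s * passagePos σ T c s x + Qmm σ T c s * passageNeg σ T c s x)
        = passageNeg σ T c s x * U σ T c s := by
  set n : ℝ := ((Fintype.card (SPos σ) : ℕ) : ℝ) with hn
  have hn0 : 0 ≤ n := by positivity
  have key : ∀ v : SPos σ → ℂ, _ := fun v =>
    (isReducedSolution_passage hT hs hσ v).deriv.eq_passage hT hs hσ
      (M := (‖Qpp σ T c s‖ + ‖Qpm σ T c s‖ + ‖Qmp σ T c s‖ + ‖Qmm σ T c s‖) * (n * ‖v‖))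
      (by positivity) (fun x hx => ?_) (fun x hx => ?_) hx
  · have hU : ∀ v, Qpp σ T c s *ᵥ (passagePos σ T c s 0 *ᵥ v)
        + Qpm σ T c s *ᵥ (passageNeg σ T c s 0 *ᵥ v) = U σ T c s *ᵥ v := by
      intro v
      rw [passagePos_zero hT hs hσ, passageNeg_zero hT hσ, U, Matrix.add_mulVec,
        Matrix.one_mulVec, Matrix.mulVec_mulVec]
    simp only [hU] at key
    constructor
    · refine Matrix.ext_of_mulVec_single fun i => ?_
      have := (key (Pi.single i 1)).1
      simpa only [Matrix.add_mulVec, Matrix.mulVec_mulVec] using this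
    · refine Matrix.ext_of_mulVec_single fun i => ?_
      have := (key (Pi.single i 1)).2
      simpa only [Matrix.add_mulVec, Matrix.neg_mulVec, Matrix.mulVec_mulVec] using this
  all_goals
    have hp : ‖passagePos σ T c s x *ᵥ v‖ ≤ n * ‖v‖ := (Matrix.linfty_opNorm_mulVec _ _).trans
      (mul_le_mul_of_nonneg_right (norm_passagePos_le hT hs x) (norm_nonneg _))
    have hm : ‖passageNeg σ T c s x *ᵥ v‖ ≤ n * ‖v‖ := (Matrix.linfty_opNorm_mulVec _ _).trans
      (mul_le_mul_of_nonneg_right (norm_passageNeg_le hT hs x) (norm_nonneg _))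
    refine le_trans ?_ (le_mul_of_one_le_right (by positivity) (by linarith))
  · calc _ ≤ ‖Qpp σ T c s‖ * (n * ‖v‖) + ‖Qpm σ T c s‖ * (n * ‖v‖) :=
        (norm_add_le _ _).trans (add_le_add
          ((Matrix.linfty_opNorm_mulVec _ _).trans (by gcongr))
          ((Matrix.linfty_opNorm_mulVec _ _).trans (by gcongr)))
      _ ≤ _ := by
        rw [← add_mul]
        refine mul_le_mul_of_nonneg_right ?_ (by positivity)
        linarith [norm_nonneg (Qmp σ T c s), norm_nonneg (Qmm σ T c s)]
  · rw [norm_neg]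
    calc _ ≤ ‖Qmp σ T c s‖ * (n * ‖v‖) + ‖Qmm σ T c s‖ * (n * ‖v‖) :=
        (norm_add_le _ _).trans (add_le_add
          ((Matrix.linfty_opNorm_mulVec _ _).trans (by gcongr))
          ((Matrix.linfty_opNorm_mulVec _ _).trans (by gcongr)))
      _ ≤ _ := by
        rw [← add_mul]
        refine mul_le_mul_of_nonneg_right ?_ (by positivity)
        linarith [norm_nonneg (Qpp σ T c s), norm_nonneg (Qpm σ T c s)]

/-- The Riccati equation of `Ξ`. -/
theorem riccati_Xi (hT : IsGenerator T) (hs : 0 < s.re)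
    (hσ : ∀ i, SignType.sign (c i) = σ i) :
    Qmp σ T c s + Qmm σ T c s * Xi σ T c s + Xi σ T c s * U σ T c s = 0 := by
  have h := (passage_deriv_eq hT hs hσ le_rfl).2
  rw [passagePos_zero hT hs hσ, passageNeg_zero hT hσ, Matrix.mul_one] at h
  rw [← h, add_neg_cancel]

/-- Probabilistic bounds on the transforms thereby become a bound on exp(xU) that is uniform in x
and in the parameters. -/
theorem passagePos_eq_expFlow (hT : IsGenerator T) (hs : 0 < s.re)
    (hσ : ∀ i, SignType.sign (c i) = σ i) {x : ℝ} (hx : 0 ≤ x) :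
    passagePos σ T c s x = expFlow (U σ T c s) x := by
  have h := eq_mul_expFlow (M := passagePos σ T c s) (A := U σ T c s) (fun x hx => ?_) hx
  · rwa [passagePos_zero hT hs hσ, one_mul] at h
  · refine hasDerivWithinAt_matrix fun i j => ?_
    rw [← (passage_deriv_eq hT hs hσ hx).1]
    have h1 := hasDerivWithinAt_pi.1
      ((isReducedSolution_passage hT hs hσ (Pi.single j 1)).pos x hx) i
    simp only [Matrix.mulVec_single_one, Pi.add_apply, Matrix.col_apply] at h1
    exact h1

theorem norm_expFlow_U_le (hT : IsGenerator T) (hs : 0 < s.re)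
    (hσ : ∀ i, SignType.sign (c i) = σ i) {x : ℝ} (hx : 0 ≤ x) :
    ‖expFlow (U σ T c s) x‖ ≤ Fintype.card (SPos σ) := by
  rw [← passagePos_eq_expFlow hT hs hσ hx]
  exact norm_passagePos_le hT hs x

theorem norm_Xi_le (hT : IsGenerator T) (hs : 0 < s.re) (hσ : ∀ i, SignType.sign (c i) = σ i) :
    ‖Xi σ T c s‖ ≤ Fintype.card (SPos σ) := by
  rw [← passageNeg_zero hT hσ]
  exact norm_passageNeg_le hT hs 0

/-- `Ξ` is the only solution of the Riccati equation that generates a bounded semigroup. -/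
theorem eq_Xi_of_riccati (hT : IsGenerator T) (hs : 0 < s.re)
    (hσ : ∀ i, SignType.sign (c i) = σ i) {Y : Matrix (SNeg σ) (SPos σ) ℂ}
    (hY : Qmp σ T c s + Qmm σ T c s * Y + Y * (Qpp σ T c s + Qpm σ T c s * Y) = 0)
    {K : ℝ} (hK : ∀ x, 0 ≤ x → ‖expFlow (Qpp σ T c s + Qpm σ T c s * Y) x‖ ≤ K) :
    Y = Xi σ T c s := by
  set V := Qpp σ T c s + Qpm σ T c s * Y with hV
  have hK0 : 0 ≤ K := (norm_nonneg _).trans (hK 0 le_rfl)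
  refine Matrix.ext_of_mulVec_single fun i => ?_
  set v : SPos σ → ℂ := Pi.single i 1
  -- The Riccati equation says exactly that the graph of Y is invariant under the reduced system, on
  -- which the flow is exp(xV).
  have hsol : IsReducedSolution σ T c s (fun x => expFlow V x *ᵥ v)
      (fun x => Y *ᵥ (expFlow V x *ᵥ v)) := by
    constructor
    · intro x _
      refine (hasDerivWithinAt_expFlow_mulVec V v _ x).congr_deriv ?_
      nth_rw 1 [hV]
      rw [Matrix.add_mulVec, ← Matrix.mulVec_mulVec]
    · intro x _
      refine (hasDerivWithinAt_const_mulVec Y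
        (hasDerivWithinAt_expFlow_mulVec V v _ x)).congr_deriv ?_
      have h : Y * V = -(Qmp σ T c s + Qmm σ T c s * Y) := by
        rw [eq_neg_iff_add_eq_zero, add_comm]; exact hY
      rw [Matrix.mulVec_mulVec _ Y, h, Matrix.neg_mulVec, Matrix.add_mulVec,
        ← Matrix.mulVec_mulVec _ (Qmm σ T c s)]
  have hp : ∀ x, 0 ≤ x → ‖expFlow V x *ᵥ v‖ ≤ K * ‖v‖ := fun x hx =>
    (Matrix.linfty_opNorm_mulVec _ _).trans
      (mul_le_mul_of_nonneg_right (hK x hx) (norm_nonneg _))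
  have h := (hsol.eq_passage hT hs hσ (M := (1 + ‖Y‖) * (K * ‖v‖)) (by positivity)
    (fun x hx => ?_) (fun x hx => ?_) le_rfl).2
  · simpa only [expFlow_zero, Matrix.one_mulVec, passageNeg_zero hT hσ] using h
  · refine le_trans ?_ (le_mul_of_one_le_right (by positivity) (by linarith))
    exact (hp x hx).trans (le_mul_of_one_le_left (by positivity) (by linarith [norm_nonneg Y]))
  · refine le_trans ?_ (le_mul_of_one_le_right (by positivity) (by linarith))
    refine (Matrix.linfty_opNorm_mulVec _ _).trans ?_
    exact mul_le_mul (by linarith [norm_nonneg Y]) (hp x hx) (norm_nonneg _)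
      (by linarith [norm_nonneg Y])

end Riccati

/-! ### The Sylvester operator -/

section Sylvester

open Matrix
open scoped Matrix.Norms.Operator

/-- Solution of `P' = A P + B exp (x A)`, `P 0 = 0`, with its linear bound if the semigroup of `A`
is bounded. -/
theorem exists_duhamel {α : Type*} [Fintype α] [DecidableEq α] (A B : Matrix α α ℂ) {K : ℝ}
    (hK : ∀ x, 0 ≤ x → ‖expFlow A x‖ ≤ K) :
    ∃ P : ℝ → Matrix α α ℂ, P 0 = 0 ∧
      (∀ x, HasDerivAt P (A * P x + B * expFlow A x) x) ∧
      ∀ x, 0 ≤ x → ‖P x‖ ≤ K * (‖B‖ * K) * x := by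
  set f : ℝ → Matrix α α ℂ := fun t => expFlow A (-t) * (B * expFlow A t) with hf
  have hc := continuous_expFlow A
  have hfc : Continuous f := by
    rw [hf]
    exact (hc.comp continuous_neg).mul (continuous_const.mul hc)
  have : TopologicalSpace.PseudoMetrizableSpace (Matrix α α ℂ) :=
    inferInstanceAs (TopologicalSpace.PseudoMetrizableSpace (α → α → ℂ))
  have hmeas : ∀ x, StronglyMeasurableAtFilter f (nhds x) volume := fun x =>
    hfc.stronglyMeasurableAtFilter _ _
  refine ⟨fun x => expFlow A x * ∫ t in (0 : ℝ)..x, f t, ?_, fun x => ?_, fun x hx => ?_⟩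
  · simp
  · refine ((hasDerivAt_expFlow A x).mul (intervalIntegral.integral_hasDerivAt_right
      (hfc.intervalIntegrable 0 x) (hmeas x)
      hfc.continuousAt)).congr_deriv ?_
    rw [hf, mul_assoc, ← mul_assoc (expFlow A x) (expFlow A (-x)), ← expFlow_add,
      add_neg_cancel, expFlow_zero, one_mul]
  · have h1 : expFlow A x * ∫ t in (0 : ℝ)..x, f t = ∫ t in (0 : ℝ)..x, expFlow A x * f t :=
      ((ContinuousLinearMap.mul ℝ (Matrix α α ℂ) (expFlow A x)).intervalIntegral_comp_comm
        (hfc.intervalIntegrable 0 x)).symm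
    have h2 : ∀ t ∈ Set.uIoc 0 x, ‖expFlow A x * f t‖ ≤ K * (‖B‖ * K) := by
      intro t ht
      rw [Set.uIoc_of_le hx] at ht
      rw [hf, ← mul_assoc, ← expFlow_add, ← sub_eq_add_neg]
      have h3 := hK (x - t) (sub_nonneg.2 ht.2)
      have h4 := hK t ht.1.le
      refine (norm_mul_le _ _).trans (mul_le_mul h3 ((norm_mul_le _ _).trans ?_)
        (norm_nonneg _) ((norm_nonneg _).trans h3))
      gcongr
    have h5 := intervalIntegral.norm_integral_le_of_norm_le_const h2
    rw [sub_zero, abs_of_nonneg hx] at h5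
    simp only [h1]
    exact h5

variable {m : ℕ} {σ : Fin m → SignType} {T : Matrix (Fin m) (Fin m) ℝ} {c : Fin m → ℝ} {s : ℂ}

/-- Formally, differentiate the solution (exp(xV)v, Y exp(xV)v) as Y = Ξ moves in the direction X,
where V = Q₊₊ + Q₊₋Y moves with it. The derivative `P` of the exponential is given by Duhamel's
formula and grows at most linearly. The relation JX + XU = 0 makes the variation (Pv, YPv + X
exp(xV)v) a reduced solution. Its positive part starts at 0, so it vanishes, and its negative part
at x = 0 is Xv. -/
theorem sylvester_injective (hT : IsGenerator T) (hs : 0 < s.re)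
    (hσ : ∀ i, SignType.sign (c i) = σ i) {X : Matrix (SNeg σ) (SPos σ) ℂ}
    (hX : J σ T c s * X + X * U σ T c s = 0) : X = 0 := by
  set V := U σ T c s with hV
  set n : ℝ := ((Fintype.card (SPos σ) : ℕ) : ℝ) with hn
  have hn0 : 0 ≤ n := by positivity
  have hK : ∀ x, 0 ≤ x → ‖expFlow V x‖ ≤ n := fun x hx => norm_expFlow_U_le hT hs hσ hx
  obtain ⟨P, hP0, hPd, hPb⟩ := exists_duhamel V (Qpm σ T c s * X) hK
  set L : ℝ := n * (‖Qpm σ T c s * X‖ * n) with hL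
  have hL0 : 0 ≤ L := by positivity
  set Y := Xi σ T c s with hY
  have hXV : X * V = -(J σ T c s * X) := eq_neg_of_add_eq_zero_right hX
  have hYV : Y * V = -(Qmp σ T c s + Qmm σ T c s * Y) :=
    eq_neg_of_add_eq_zero_right (riccati_Xi hT hs hσ)
  refine Matrix.ext_of_mulVec_single fun i => ?_
  set v : SPos σ → ℂ := Pi.single i 1
  have hpd : ∀ x, HasDerivWithinAt (fun x => P x *ᵥ v)
      (V *ᵥ (P x *ᵥ v) + Qpm σ T c s *ᵥ (X *ᵥ (expFlow V x *ᵥ v))) (Set.Ici 0) x := by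
    intro x
    refine (hasDerivWithinAt_mulVec_const (hPd x).hasDerivWithinAt v).congr_deriv ?_
    simp only [Matrix.add_mulVec, Matrix.mulVec_mulVec, Matrix.mul_assoc]
  have hsol : IsReducedSolution σ T c s (fun x => P x *ᵥ v)
      (fun x => Y *ᵥ (P x *ᵥ v) + X *ᵥ (expFlow V x *ᵥ v)) := by
    constructor
    · intro x _
      refine (hpd x).congr_deriv ?_
      nth_rw 1 [hV]
      rw [U, Matrix.add_mulVec, Matrix.mulVec_add, ← hY]
      simp only [Matrix.mulVec_mulVec, Matrix.mul_assoc]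
      abel
    · intro x _
      refine ((hasDerivWithinAt_const_mulVec Y (hpd x)).add (hasDerivWithinAt_const_mulVec X
        (hasDerivWithinAt_expFlow_mulVec V v _ x))).congr_deriv ?_
      rw [Matrix.mulVec_mulVec _ X V, hXV, Matrix.mulVec_add, Matrix.mulVec_mulVec _ Y V, hYV, J,
        ← hY]
      simp only [Matrix.add_mulVec, Matrix.neg_mulVec, Matrix.mulVec_add, Matrix.add_mul,
        ← Matrix.mulVec_mulVec]
      abel
  have hp : ∀ x, 0 ≤ x → ‖P x *ᵥ v‖ ≤ L * ‖v‖ * (1 + x) := by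
    intro x hx
    refine (Matrix.linfty_opNorm_mulVec _ _).trans ?_
    calc ‖P x‖ * ‖v‖ ≤ L * x * ‖v‖ := by gcongr; exact hPb x hx
      _ = L * ‖v‖ * x := by ring
      _ ≤ _ := by gcongr; linarith
  have hw : ∀ x, 0 ≤ x → ‖X *ᵥ (expFlow V x *ᵥ v)‖ ≤ ‖X‖ * (n * ‖v‖) * (1 + x) := by
    intro x hx
    refine le_trans ?_ (le_mul_of_one_le_right (by positivity) (by linarith))
    refine (Matrix.linfty_opNorm_mulVec _ _).trans ?_
    gcongr
    refine (Matrix.linfty_opNorm_mulVec _ _).trans ?_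
    gcongr
    exact hK x hx
  have h := (hsol.eq_zero hT hs hσ (M := L * ‖v‖ + ‖Y‖ * (L * ‖v‖) + ‖X‖ * (n * ‖v‖)) ?_
    (by positivity) (fun x hx => ?_) (fun x hx => ?_) le_rfl).2
  · simpa [hP0, expFlow_zero] using h
  · simp [hP0]
  · refine (hp x hx).trans ?_
    have : 0 ≤ ‖Y‖ * (L * ‖v‖) + ‖X‖ * (n * ‖v‖) := by positivity
    gcongr
    linarith
  · refine (norm_add_le _ _).trans ?_
    have h1 : ‖Y *ᵥ (P x *ᵥ v)‖ ≤ ‖Y‖ * (L * ‖v‖ * (1 + x)) :=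
      (Matrix.linfty_opNorm_mulVec _ _).trans (by gcongr; exact hp x hx)
    have h2 := hw x hx
    have h3 : 0 ≤ L * ‖v‖ * (1 + x) := by positivity
    linarith

/-- The Sylvester operator `X ↦ J X + X U`. -/
def sylvester (σ : Fin m → SignType) (T : Matrix (Fin m) (Fin m) ℝ) (c : Fin m → ℝ) (s : ℂ) :
    Matrix (SNeg σ) (SPos σ) ℂ →ₗ[ℝ] Matrix (SNeg σ) (SPos σ) ℂ where
  toFun X := J σ T c s * X + X * U σ T c s
  map_add' X Y := by rw [Matrix.mul_add, Matrix.add_mul]; abel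
  map_smul' r X := by simp

/-- The inverse of the Sylvester operator. -/
theorem exists_sylvester_inverse (hT : IsGenerator T) (hs : 0 < s.re)
    (hσ : ∀ i, SignType.sign (c i) = σ i) :
    ∃ S : Matrix (SNeg σ) (SPos σ) ℂ →L[ℝ] Matrix (SNeg σ) (SPos σ) ℂ,
      ∀ X, S (J σ T c s * X + X * U σ T c s) = X := by
  have hinj : Function.Injective (sylvester σ T c s) :=
    (injective_iff_map_eq_zero _).2 fun X hX => sylvester_injective hT hs hσ hX
  refine ⟨(LinearEquiv.ofInjectiveEndo _ hinj).symm.toLinearMap.toContinuousLinearMap,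
    fun X => ?_⟩
  exact (LinearEquiv.ofInjectiveEndo _ hinj).symm_apply_apply X

end Sylvester

/-! ### Matrix functions of the parameter -/

section Parameter

open Matrix

variable {E : Type*} [NormedAddCommGroup E] [NormedSpace ℝ E]

theorem differentiableAt_ofReal {f : E → ℝ} {θ : E} (hf : DifferentiableAt ℝ f θ) :
    DifferentiableAt ℝ (fun η => (f η : ℂ)) θ :=
  Complex.ofRealCLM.differentiableAt.comp θ hf

theorem differentiableAt_mul_apply {α β γ : Type*} [Fintype β] {A : E → Matrix α β ℂ}
    {B : E → Matrix β γ ℂ} {θ : E} (hA : ∀ i j, DifferentiableAt ℝ (fun η => A η i j) θ)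
    (hB : ∀ i j, DifferentiableAt ℝ (fun η => B η i j) θ) (i : α) (j : γ) :
    DifferentiableAt ℝ (fun η => (A η * B η) i j) θ := by
  simp only [Matrix.mul_apply]
  exact DifferentiableAt.fun_sum fun k _ => (hA i k).mul (hB k j)

theorem differentiableAt_det {α : Type*} [Fintype α] [DecidableEq α] {A : E → Matrix α α ℂ}
    {θ : E} (hA : ∀ i j, DifferentiableAt ℝ (fun η => A η i j) θ) :
    DifferentiableAt ℝ (fun η => (A η).det) θ := by
  simp only [Matrix.det_apply']
  exact DifferentiableAt.fun_sum fun π _ =>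
    (HasFDerivAt.finsetProd fun i _ => (hA (π i) i).hasFDerivAt).differentiableAt.const_mul _

theorem differentiableAt_inv_apply {α : Type*} [Fintype α] [DecidableEq α] {A : E → Matrix α α ℂ}
    {θ : E} (hA : ∀ i j, DifferentiableAt ℝ (fun η => A η i j) θ) (h : (A θ).det ≠ 0) (i j : α) :
    DifferentiableAt ℝ (fun η => (A η)⁻¹ i j) θ := by
  simp only [Matrix.inv_def, Ring.inverse_eq_inv', Matrix.smul_apply, smul_eq_mul,
    Matrix.adjugate_apply]
  refine ((differentiableAt_det hA).inv h).mul (differentiableAt_det fun k l => ?_)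
  simp only [Matrix.updateRow_apply]
  split_ifs
  · exact differentiableAt_const _
  · exact hA k l

/-! ### Differentiability of the matrices Q in the parameter -/

section Model

variable {m : ℕ} {σ : Fin m → SignType} {T : E → Matrix (Fin m) (Fin m) ℝ}
  {c : E → Fin m → ℝ} {s : ℂ} {θ : E}

theorem differentiableAt_block (hTd : ∀ i j, DifferentiableAt ℝ (fun η => T η i j) θ)
    (P R : Fin m → Prop) (i : {i // P i}) (j : {i // R i}) :
    DifferentiableAt ℝ (fun η => block (T η) P R i j) θ :=
  differentiableAt_ofReal (hTd i j)

theorem differentiableAt_absRateInv (hcd : ∀ i, DifferentiableAt ℝ (fun η => c η i) θ)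
    {P : Fin m → Prop} (hc : ∀ i, P i → c θ i ≠ 0) (i j : {i // P i}) :
    DifferentiableAt ℝ (fun η => absRateInv (c η) P i j) θ := by
  by_cases h : i = j
  · subst h
    simp only [absRateInv, Matrix.diagonal_apply_eq]
    exact differentiableAt_ofReal (((hcd i).abs (hc i i.2)).inv (abs_ne_zero.2 (hc i i.2)))
  · simp only [absRateInv, Matrix.diagonal_apply_ne _ h]
    exact differentiableAt_const _

theorem differentiableAt_zeroResolvent
    (hTd : ∀ i j, DifferentiableAt ℝ (fun η => T η i j) θ) (hT : IsGenerator (T θ))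
    (hs : 0 < s.re) (i j : SZero σ) :
    DifferentiableAt ℝ (fun η => zeroResolvent σ (T η) s i j) θ :=
  differentiableAt_inv_apply
    (fun k l => (differentiableAt_block hTd _ _ k l).sub_const _)
    (det_block_zero_sub_ne_zero hT hs) i j

/-- The constant matrix `M` stands for sI in the diagonal blocks and for 0 in the others. -/
theorem differentiableAt_schur (hTd : ∀ i j, DifferentiableAt ℝ (fun η => T η i j) θ)
    (hcd : ∀ i, DifferentiableAt ℝ (fun η => c η i) θ) (hT : IsGenerator (T θ))
    (hs : 0 < s.re) {P R : Fin m → Prop} [Fintype {i // P i}] (hc : ∀ i, P i → c θ i ≠ 0)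
    (M : Matrix {i // P i} {i // R i} ℂ) (i : {i // P i}) (j : {i // R i}) :
    DifferentiableAt ℝ (fun η => (absRateInv (c η) P * (block (T η) P R - M
      - block (T η) P (σ · = 0) * zeroResolvent σ (T η) s * block (T η) (σ · = 0) R)) i j) θ :=
  differentiableAt_mul_apply (differentiableAt_absRateInv hcd hc)
    (fun k l => ((differentiableAt_block hTd _ _ k l).sub_const (M k l)).sub
      (differentiableAt_mul_apply (differentiableAt_mul_apply (differentiableAt_block hTd _ _)
        (differentiableAt_zeroResolvent hTd hT hs)) (differentiableAt_block hTd _ _) k l)) i j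

theorem differentiableAt_Qpp (hTd : ∀ i j, DifferentiableAt ℝ (fun η => T η i j) θ)
    (hcd : ∀ i, DifferentiableAt ℝ (fun η => c η i) θ) (hT : IsGenerator (T θ))
    (hs : 0 < s.re) (hσ : ∀ i, SignType.sign (c θ i) = σ i) (i j : SPos σ) :
    DifferentiableAt ℝ (fun η => Qpp σ (T η) (c η) s i j) θ :=
  differentiableAt_schur hTd hcd hT hs
    (fun i hi => (sign_eq_one_iff.1 ((hσ i).trans hi)).ne') _ i j

theorem differentiableAt_Qpm (hTd : ∀ i j, DifferentiableAt ℝ (fun η => T η i j) θ)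
    (hcd : ∀ i, DifferentiableAt ℝ (fun η => c η i) θ) (hT : IsGenerator (T θ))
    (hs : 0 < s.re) (hσ : ∀ i, SignType.sign (c θ i) = σ i) (i : SPos σ) (j : SNeg σ) :
    DifferentiableAt ℝ (fun η => Qpm σ (T η) (c η) s i j) θ := by
  have h := differentiableAt_schur (σ := σ) (R := (σ · = -1)) hTd hcd hT hs
    (fun i hi => (sign_eq_one_iff.1 ((hσ i).trans hi)).ne') 0 i j
  simp only [sub_zero] at h
  exact h

theorem differentiableAt_Qmm (hTd : ∀ i j, DifferentiableAt ℝ (fun η => T η i j) θ)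
    (hcd : ∀ i, DifferentiableAt ℝ (fun η => c η i) θ) (hT : IsGenerator (T θ))
    (hs : 0 < s.re) (hσ : ∀ i, SignType.sign (c θ i) = σ i) (i j : SNeg σ) :
    DifferentiableAt ℝ (fun η => Qmm σ (T η) (c η) s i j) θ :=
  differentiableAt_schur hTd hcd hT hs
    (fun i hi => (sign_eq_neg_one_iff.1 ((hσ i).trans hi)).ne) _ i j

theorem differentiableAt_Qmp (hTd : ∀ i j, DifferentiableAt ℝ (fun η => T η i j) θ)
    (hcd : ∀ i, DifferentiableAt ℝ (fun η => c η i) θ) (hT : IsGenerator (T θ))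
    (hs : 0 < s.re) (hσ : ∀ i, SignType.sign (c θ i) = σ i) (i : SNeg σ) (j : SPos σ) :
    DifferentiableAt ℝ (fun η => Qmp σ (T η) (c η) s i j) θ := by
  have h := differentiableAt_schur (σ := σ) (R := (σ · = 1)) hTd hcd hT hs
    (fun i hi => (sign_eq_neg_one_iff.1 ((hσ i).trans hi)).ne) 0 i j
  simp only [sub_zero] at h
  exact h

end Model

end Parameter

/-! ### Differentiability of `Ξ` -/

theorem tendsto_matrix_mul {ι α β γ : Type*} [Fintype β] {F : Filter ι} {A : ι → Matrix α β ℂ}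
    {B : ι → Matrix β γ ℂ} {a : Matrix α β ℂ} {b : Matrix β γ ℂ}
    (hA : Filter.Tendsto A F (nhds a)) (hB : Filter.Tendsto B F (nhds b)) :
    Filter.Tendsto (fun η => A η * B η) F (nhds (a * b)) := by
  refine tendsto_pi_nhds.2 fun i => tendsto_pi_nhds.2 fun j => ?_
  have hA' : ∀ k, Filter.Tendsto (fun η => A η i k) F (nhds (a i k)) := fun k =>
    ((continuous_id.matrix_elem i k).tendsto a).comp hA
  have hB' : ∀ k, Filter.Tendsto (fun η => B η k j) F (nhds (b k j)) := fun k =>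
    ((continuous_id.matrix_elem k j).tendsto b).comp hB
  simp only [Matrix.mul_apply]
  exact tendsto_finsetSum _ fun k _ => (hA' k).mul (hB' k)

section Smoothness

open Matrix Filter Topology Asymptotics
open scoped Matrix.Norms.Operator

theorem differentiableAt_matrix {E : Type*} [NormedAddCommGroup E] [NormedSpace ℝ E]
    {α β : Type*} [Fintype α] [Fintype β] {A : E → Matrix α β ℂ} {θ : E}
    (h : ∀ i j, DifferentiableAt ℝ (fun η => A η i j) θ) : DifferentiableAt ℝ A θ := by
  have h1 : DifferentiableAt ℝ (fun η => fun i j => A η i j) θ :=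
    differentiableAt_pi.2 fun i => differentiableAt_pi.2 fun j => h i j
  exact (Matrix.ofLinearEquiv ℝ : (α → β → ℂ) ≃ₗ[ℝ] Matrix α β ℂ).toLinearMap
    |>.toContinuousLinearMap.differentiableAt.comp θ h1

theorem differentiableAt_matrix_apply {E : Type*} [NormedAddCommGroup E] [NormedSpace ℝ E]
    {α β : Type*} [Fintype α] [Fintype β] {A : E → Matrix α β ℂ} {θ : E}
    (h : DifferentiableAt ℝ A θ) (i : α) (j : β) : DifferentiableAt ℝ (fun η => A η i j) θ := by
  let L : Matrix α β ℂ →ₗ[ℝ] ℂ :=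
    { toFun := fun M => M i j, map_add' := fun _ _ => rfl, map_smul' := fun _ _ => rfl }
  exact L.toContinuousLinearMap.differentiableAt.comp θ h

theorem norm_matrix_le_sum {α β : Type*} [Fintype α] [Fintype β] (A : Matrix α β ℂ) :
    ‖A‖ ≤ ∑ i, ∑ j, ‖A i j‖ := by
  rw [Matrix.linfty_opNorm_def]
  have : (Finset.univ.sup fun i => ∑ j, ‖A i j‖₊) ≤ ∑ i, ∑ j, ‖A i j‖₊ :=
    Finset.sup_le fun i hi =>
      Finset.single_le_sum (f := fun i => ∑ j, ‖A i j‖₊) (fun _ _ => zero_le) hi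
  refine (NNReal.coe_le_coe.2 this).trans (le_of_eq ?_)
  push_cast
  rfl

theorem norm_apply_le {α β : Type*} [Fintype α] [Fintype β] (A : Matrix α β ℂ) (i : α) (j : β) :
    ‖A i j‖ ≤ ‖A‖ := by
  rw [Matrix.linfty_opNorm_def]
  have : ‖A i j‖₊ ≤ Finset.univ.sup fun i => ∑ j, ‖A i j‖₊ :=
    (Finset.single_le_sum (f := fun j => ‖A i j‖₊) (fun _ _ => zero_le)
      (Finset.mem_univ j)).trans
      (Finset.le_sup (f := fun i => ∑ j, ‖A i j‖₊) (Finset.mem_univ i))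
  exact_mod_cast this

/-- A product is differentiable at a zero of a differentiable factor if the other one is
continuous. -/
theorem differentiableAt_mul_of_eq_zero {E : Type*} [NormedAddCommGroup E] [NormedSpace ℝ E]
    {f g : E → ℂ} {θ : E} (hf : DifferentiableAt ℝ f θ) (h0 : f θ = 0) (hg : ContinuousAt g θ) :
    DifferentiableAt ℝ (fun η => f η * g η) θ := by
  have h1 : DifferentiableAt ℝ (fun η => f η * g θ) θ := hf.mul_const _
  have hO : f =O[𝓝 θ] fun η => η - θ := by
    simpa [h0] using hf.isBigO_sub
  have ho : (fun η => g η - g θ) =o[𝓝 θ] fun _ => (1 : ℝ) :=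
    (isLittleO_one_iff ℝ).2 (tendsto_sub_nhds_zero_iff.2 hg)
  have h2 : HasFDerivAt (fun η => f η * (g η - g θ)) (0 : E →L[ℝ] ℂ) θ := by
    rw [hasFDerivAt_iff_isLittleO]
    have := hO.norm_right.mul_isLittleO ho
    simpa [h0, isLittleO_norm_right] using this
  refine (h1.add h2.differentiableAt).congr_of_eventuallyEq (Eventually.of_forall fun η => ?_)
  simp only [Pi.add_apply]
  ring

variable {E : Type*} [NormedAddCommGroup E] [NormedSpace ℝ E] {m : ℕ} {σ : Fin m → SignType}
  {T : E → Matrix (Fin m) (Fin m) ℝ} {c : E → Fin m → ℝ} {s : ℂ} {θ : E} {Θ : Set E}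

/-- Near θ the values of Ξ stay in a fixed ball, which is compact. A cluster point solves the
limiting Riccati equation, and the uniform bound on exp(xU) passes to the limit for each x. By
`eq_Xi_of_riccati` the only cluster point is Ξ at θ. -/
theorem continuousAt_Xi (hΘ : IsOpen Θ) (hT : ∀ θ ∈ Θ, IsGenerator (T θ))
    (hσ : ∀ θ ∈ Θ, ∀ i, SignType.sign (c θ i) = σ i) (hθ : θ ∈ Θ)
    (hTd : ∀ i j, DifferentiableAt ℝ (fun η => T η i j) θ)
    (hcd : ∀ i, DifferentiableAt ℝ (fun η => c η i) θ) (hs : 0 < s.re) :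
    ContinuousAt (fun η => Xi σ (T η) (c η) s) θ := by
  have hev : ∀ᶠ η in 𝓝 θ, η ∈ Θ := hΘ.mem_nhds hθ
  have : ProperSpace (Matrix (SNeg σ) (SPos σ) ℂ) := FiniteDimensional.proper ℂ _
  refine (isCompact_closedBall (0 : Matrix (SNeg σ) (SPos σ) ℂ)
    (Fintype.card (SPos σ))).tendsto_nhds_of_unique_mapClusterPt ?_ fun Y _ hY => ?_
  · filter_upwards [hev] with η hη
    rw [mem_closedBall_zero_iff]
    exact norm_Xi_le (hT η hη) hs (hσ η hη)
  · obtain ⟨F, hF, hlim⟩ := mapClusterPt_iff_ultrafilter.1 hY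
    have hpp : Tendsto (fun η => Qpp σ (T η) (c η) s) F (𝓝 (Qpp σ (T θ) (c θ) s)) :=
      (differentiableAt_matrix (differentiableAt_Qpp hTd hcd (hT θ hθ) hs
        (hσ θ hθ))).continuousAt.tendsto.mono_left hF
    have hpm : Tendsto (fun η => Qpm σ (T η) (c η) s) F (𝓝 (Qpm σ (T θ) (c θ) s)) :=
      (differentiableAt_matrix (differentiableAt_Qpm hTd hcd (hT θ hθ) hs
        (hσ θ hθ))).continuousAt.tendsto.mono_left hF
    have hmm : Tendsto (fun η => Qmm σ (T η) (c η) s) F (𝓝 (Qmm σ (T θ) (c θ) s)) :=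
      (differentiableAt_matrix (differentiableAt_Qmm hTd hcd (hT θ hθ) hs
        (hσ θ hθ))).continuousAt.tendsto.mono_left hF
    have hmp : Tendsto (fun η => Qmp σ (T η) (c η) s) F (𝓝 (Qmp σ (T θ) (c θ) s)) :=
      (differentiableAt_matrix (differentiableAt_Qmp hTd hcd (hT θ hθ) hs
        (hσ θ hθ))).continuousAt.tendsto.mono_left hF
    have hU := hpp.add (tendsto_matrix_mul hpm hlim)
    refine eq_Xi_of_riccati (hT θ hθ) hs (hσ θ hθ) ?_ (K := Fintype.card (SPos σ))
      fun x hx => ?_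
    · refine tendsto_nhds_unique ((hmp.add (tendsto_matrix_mul hmm hlim)).add
        (tendsto_matrix_mul hlim hU))
        (tendsto_const_nhds.congr' ?_)
      filter_upwards [hF hev] with η hη
      exact (riccati_Xi (hT η hη) hs (hσ η hη)).symm
    · refine le_of_tendsto (((continuous_expFlow_left x).tendsto _).comp hU).norm ?_
      filter_upwards [hF hev] with η hη
      exact norm_expFlow_U_le (hT η hη) hs (hσ η hη) hx

/-- With Δ = Ξ(η) - Ξ(θ), subtracting the Riccati equations gives JΔ + ΔU = -(err + ΔQ₊₋Δ), with J,
U, Q₊₋ taken at θ. Inverting the left side, it suffices that `err` is differentiable at θ and that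
the quadratic term is o(η - θ). -/
theorem differentiableAt_Xi (hΘ : IsOpen Θ) (hT : ∀ θ ∈ Θ, IsGenerator (T θ))
    (hσ : ∀ θ ∈ Θ, ∀ i, SignType.sign (c θ i) = σ i) (hθ : θ ∈ Θ)
    (hTd : ∀ i j, DifferentiableAt ℝ (fun η => T η i j) θ)
    (hcd : ∀ i, DifferentiableAt ℝ (fun η => c η i) θ) (hs : 0 < s.re)
    (i : SNeg σ) (j : SPos σ) :
    DifferentiableAt ℝ (fun η => Xi σ (T η) (c η) s i j) θ := by
  have hev : ∀ᶠ η in 𝓝 θ, η ∈ Θ := hΘ.mem_nhds hθ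
  have hcont := continuousAt_Xi hΘ hT hσ hθ hTd hcd hs
  obtain ⟨S, hS⟩ := exists_sylvester_inverse (hT θ hθ) hs (hσ θ hθ)
  obtain ⟨K, hK, hSK⟩ := SemilinearMapClass.bound_of_continuous S S.continuous
  set X : E → Matrix (SNeg σ) (SPos σ) ℂ := fun η => Xi σ (T η) (c η) s with hX
  set pp : E → Matrix (SPos σ) (SPos σ) ℂ := fun η => Qpp σ (T η) (c η) s with hpp
  set pm : E → Matrix (SPos σ) (SNeg σ) ℂ := fun η => Qpm σ (T η) (c η) s with hpm
  set mm : E → Matrix (SNeg σ) (SNeg σ) ℂ := fun η => Qmm σ (T η) (c η) s with hmm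
  set mp : E → Matrix (SNeg σ) (SPos σ) ℂ := fun η => Qmp σ (T η) (c η) s with hmp
  have hXc : ∀ i j, ContinuousAt (fun η => X η i j) θ := fun i j =>
    ((continuous_id.matrix_elem i j).tendsto _).comp hcont
  -- The change of the Riccati coefficients from θ to η, evaluated at Ξ(η).
  set err : E → Matrix (SNeg σ) (SPos σ) ℂ := fun η =>
    (mp η - mp θ) + (mm η - mm θ) * X η + X η * ((pp η - pp θ) + (pm η - pm θ) * X η) with herr
  set Δ : E → Matrix (SNeg σ) (SPos σ) ℂ := fun η => X η - X θ with hΔ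
  have hid : ∀ᶠ η in 𝓝 θ, Δ η = S (-(err η + Δ η * (pm θ * Δ η))) := by
    filter_upwards [hev] with η hη
    have h1 := riccati_Xi (hT η hη) hs (hσ η hη)
    have h0 := riccati_Xi (hT θ hθ) hs (hσ θ hθ)
    refine (hS (Δ η)).symm.trans (congrArg S ?_)
    have : J σ (T θ) (c θ) s * Δ η + Δ η * U σ (T θ) (c θ) s + (err η + Δ η * (pm θ * Δ η)) =
        (mp η + mm η * X η + X η * (pp η + pm η * X η))
        - (mp θ + mm θ * X θ + X θ * (pp θ + pm θ * X θ)) := by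
      simp only [J, U, hΔ, herr, hX, hpp, hpm, hmm, hmp, Matrix.mul_add, Matrix.add_mul,
        Matrix.mul_sub, Matrix.sub_mul, Matrix.mul_assoc]
      abel
    rw [eq_neg_iff_add_eq_zero, this]
    exact sub_eq_zero.2 (h1.trans h0.symm)
  have herr_diff : ∀ i j, DifferentiableAt ℝ (fun η => err η i j) θ := by
    intro i j
    -- Only continuity of Ξ is available at this stage. It suffices because each product in `err`
    -- has a differentiable factor that vanishes at θ.
    have hmul : ∀ {α β γ : Type} [Fintype β] {A : E → Matrix α β ℂ} {B : E → Matrix β γ ℂ},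
        (∀ i j, DifferentiableAt ℝ (fun η => A η i j) θ) → A θ = 0 →
        (∀ i j, ContinuousAt (fun η => B η i j) θ) →
        ∀ i j, DifferentiableAt ℝ (fun η => (A η * B η) i j) θ := by
      intro α β γ _ A B hA h0 hB i j
      simp only [Matrix.mul_apply]
      exact DifferentiableAt.fun_sum fun k _ =>
        differentiableAt_mul_of_eq_zero (hA i k) (by rw [h0]; rfl) (hB k j)
    have dmp := fun i j => (differentiableAt_Qmp hTd hcd (hT θ hθ) hs (hσ θ hθ) i j).sub_const
      (mp θ i j)
    have dmm := fun i j => (differentiableAt_Qmm hTd hcd (hT θ hθ) hs (hσ θ hθ) i j).sub_const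
      (mm θ i j)
    have dpp := fun i j => (differentiableAt_Qpp hTd hcd (hT θ hθ) hs (hσ θ hθ) i j).sub_const
      (pp θ i j)
    have dpm := fun i j => (differentiableAt_Qpm hTd hcd (hT θ hθ) hs (hσ θ hθ) i j).sub_const
      (pm θ i j)
    have d1 := hmul (A := fun η => mm η - mm θ) dmm (sub_self _) hXc
    have d2 := hmul (A := fun η => pm η - pm θ) dpm (sub_self _) hXc
    have d3 : DifferentiableAt ℝ
        (fun η => (X η * ((pp η - pp θ) + (pm η - pm θ) * X η)) i j) θ := by
      simp only [Matrix.mul_apply (M := X _)]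
      refine DifferentiableAt.fun_sum fun k _ => ?_
      simp only [mul_comm (X _ _ _)]
      refine differentiableAt_mul_of_eq_zero ((dpp k j).add (d2 k j)) ?_ (hXc i k)
      simp
    exact ((dmp i j).add (d1 i j)).add d3
  have herr0 : err θ = 0 := by simp [herr]
  have herrO : err =O[𝓝 θ] fun η => η - θ := by
    have h1 : (fun η => ∑ i, ∑ j, ‖err η i j‖) =O[𝓝 θ] fun η => η - θ := by
      refine IsBigO.fun_sum fun i _ => IsBigO.fun_sum fun j _ => ?_
      have := (herr_diff i j).isBigO_sub
      simpa [herr0] using this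
    refine IsBigO.trans (IsBigO.of_norm_le fun η => ?_) h1
    exact norm_matrix_le_sum _
  have hΔ0 : Tendsto (fun η => ‖Δ η‖) (𝓝 θ) (𝓝 0) :=
    tendsto_iff_norm_sub_tendsto_zero.1 hcont
  have hΔO : Δ =O[𝓝 θ] fun η => η - θ := by
    refine IsBigO.trans (IsBigO.of_bound (2 * K) ?_) herrO
    -- By continuity of Ξ the quadratic term is at most half of ‖Δ‖ near θ and can be absorbed on
    -- the left, whence the constant 2K.
    have hsmall : ∀ᶠ η in 𝓝 θ, K * ‖pm θ‖ * ‖Δ η‖ < 1 / 2 := by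
      have := hΔ0.const_mul (K * ‖pm θ‖)
      rw [mul_zero] at this
      exact this.eventually_lt_const (by norm_num)
    filter_upwards [hid, hsmall] with η h1 h2
    have h3 : ‖Δ η‖ ≤ K * (‖err η‖ + ‖Δ η‖ * (‖pm θ‖ * ‖Δ η‖)) := by
      calc ‖Δ η‖ = ‖S (-(err η + Δ η * (pm θ * Δ η)))‖ := by rw [← h1]
        _ ≤ K * ‖-(err η + Δ η * (pm θ * Δ η))‖ := hSK _
        _ ≤ _ := by
          rw [norm_neg]
          gcongr
          refine (norm_add_le _ _).trans ?_
          gcongr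
          refine (Matrix.linfty_opNorm_mul _ _).trans ?_
          gcongr
          exact Matrix.linfty_opNorm_mul _ _
    nlinarith [mul_le_mul_of_nonneg_right h2.le (norm_nonneg (Δ η))]
  have hquad : ∀ i j, DifferentiableAt ℝ (fun η => (Δ η * (pm θ * Δ η)) i j) θ := by
    intro i j
    have hq : HasFDerivAt (fun η => (Δ η * (pm θ * Δ η)) i j) (0 : E →L[ℝ] ℂ) θ := by
      rw [hasFDerivAt_iff_isLittleO]
      have hΔθ : Δ θ = 0 := sub_self _
      have ho : (fun η => ‖Δ η‖) =o[𝓝 θ] fun _ => (1 : ℝ) := (isLittleO_one_iff ℝ).2 hΔ0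
      have h1 : (fun η => ‖Δ η‖ * ‖Δ η‖) =o[𝓝 θ] fun η => η - θ := by
        have := hΔO.norm_norm.mul_isLittleO ho
        simpa [isLittleO_norm_right] using this
      have h2 : (fun η => (Δ η * (pm θ * Δ η)) i j) =O[𝓝 θ] fun η => ‖Δ η‖ * ‖Δ η‖ := by
        refine IsBigO.of_bound ‖pm θ‖ (Eventually.of_forall fun η => ?_)
        refine (norm_apply_le _ i j).trans ((Matrix.linfty_opNorm_mul _ _).trans ?_)
        have := Matrix.linfty_opNorm_mul (pm θ) (Δ η)
        rw [Real.norm_of_nonneg (by positivity)]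
        calc ‖Δ η‖ * ‖pm θ * Δ η‖ ≤ ‖Δ η‖ * (‖pm θ‖ * ‖Δ η‖) := by gcongr
          _ = _ := by ring
      simpa [hΔθ] using h2.trans_isLittleO h1
    exact hq.differentiableAt
  have hd : DifferentiableAt ℝ (fun η => S (-(err η + Δ η * (pm θ * Δ η)))) θ :=
    S.differentiableAt.comp θ (differentiableAt_matrix fun i j =>
      ((herr_diff i j).add (hquad i j)).neg)
  have hd' := differentiableAt_matrix_apply (hd.congr_of_eventuallyEq hid) i j
  exact (hd'.add_const (X θ i j)).congr_of_eventuallyEq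
    (Eventually.of_forall fun η => (sub_add_cancel (X η i j) (X θ i j)).symm)

end Smoothness

/-! ### The derivative of `Ξ` -/

section Derivative

variable {p : ℕ} {α β γ : Type} {θ : Fin p → ℝ}

theorem matDeriv_add {A B : (Fin p → ℝ) → Matrix α β ℂ}
    (hA : ∀ i j, DifferentiableAt ℝ (fun η => A η i j) θ)
    (hB : ∀ i j, DifferentiableAt ℝ (fun η => B η i j) θ) :
    matDeriv (fun η => A η + B η) θ = matDeriv A θ + matDeriv B θ := by
  ext i kj
  simp only [matDeriv, Matrix.of_apply, Matrix.add_apply]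
  rw [fderiv_fun_add (hA i kj.2) (hB i kj.2)]
  rfl

theorem matDeriv_mul [Fintype β] {A : (Fin p → ℝ) → Matrix α β ℂ}
    {B : (Fin p → ℝ) → Matrix β γ ℂ} (hA : ∀ i j, DifferentiableAt ℝ (fun η => A η i j) θ)
    (hB : ∀ i j, DifferentiableAt ℝ (fun η => B η i j) θ) :
    matDeriv (fun η => A η * B η) θ =
      matDeriv A θ * ((1 : Matrix (Fin p) (Fin p) ℂ) ⊗ₖ B θ) + A θ * matDeriv B θ := by
  ext i ⟨k, j⟩
  simp only [matDeriv, Matrix.of_apply, Matrix.add_apply, Matrix.mul_apply,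
    Matrix.kroneckerMap_apply, Fintype.sum_prod_type]
  rw [fderiv_fun_sum fun l _ => (hA i l).fun_mul (hB l j)]
  simp only [fderiv_fun_mul (hA i _) (hB _ j), _root_.sum_apply,
    _root_.add_apply, _root_.smul_apply, smul_eq_mul,
    Finset.sum_add_distrib]
  rw [add_comm]
  congr 1
  rw [Finset.sum_eq_single k]
  · simp [mul_comm]
  · intro b _ hb
    simp [Matrix.one_apply_ne hb]
  · simp

/-- Multiplication by I ⊗ V acts separately on the p blocks of columns, so the Kronecker equation
splits into p copies of the equation JX + XU. -/
theorem mul_one_kronecker_apply [Fintype β] (X : Matrix α (Fin p × β) ℂ) (V : Matrix β γ ℂ)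
    (i : α) (k : Fin p) (j : γ) :
    (X * ((1 : Matrix (Fin p) (Fin p) ℂ) ⊗ₖ V)) i (k, j) =
      (X.submatrix id (fun l => (k, l)) * V) i j := by
  simp only [Matrix.mul_apply, Matrix.kroneckerMap_apply, Fintype.sum_prod_type]
  rw [Finset.sum_eq_single k]
  · simp
  · intro b _ hb
    simp [Matrix.one_apply_ne hb]
  · simp

theorem sylvester_kronecker_injective {m : ℕ} {σ : Fin m → SignType}
    {T : Matrix (Fin m) (Fin m) ℝ} {c : Fin m → ℝ} {s : ℂ} (hT : IsGenerator T) (hs : 0 < s.re)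
    (hσ : ∀ i, SignType.sign (c i) = σ i) {X : Matrix (SNeg σ) (Fin p × SPos σ) ℂ}
    (hX : J σ T c s * X + X * ((1 : Matrix (Fin p) (Fin p) ℂ) ⊗ₖ U σ T c s) = 0) : X = 0 := by
  ext i ⟨k, j⟩
  have h : X.submatrix id (fun l => (k, l)) = 0 := by
    refine sylvester_injective hT hs hσ ?_
    ext a b
    rw [Matrix.add_apply, ← mul_one_kronecker_apply]
    exact congrFun (congrFun hX a) (k, b)
  exact congrFun (congrFun h i) j

end Derivative

end FluidModel

/-! ### The Sylvester equation for the derivative -/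

theorem mainTheorem2 {m p : ℕ} (Θ : Set (Fin p → ℝ)) (hΘ : IsOpen Θ)
    (T : (Fin p → ℝ) → Matrix (Fin m) (Fin m) ℝ) (c : (Fin p → ℝ) → Fin m → ℝ)
    (σ : Fin m → SignType)
    (hT : ∀ θ ∈ Θ, FluidModel.IsGenerator (T θ))
    (hσ : ∀ θ ∈ Θ, ∀ i, SignType.sign (c θ i) = σ i)
    (θ : Fin p → ℝ) (hθ : θ ∈ Θ)
    (hTd : ∀ i j, DifferentiableAt ℝ (fun η => T η i j) θ)
    (hcd : ∀ i, DifferentiableAt ℝ (fun η => c η i) θ)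
    (s : ℂ) (hs : 0 < s.re) :
    let Ξ := fun η => FluidModel.Xi σ (T η) (c η) s
    let A := FluidModel.J σ (T θ) (c θ) s
    let B := (1 : Matrix (Fin p) (Fin p) ℂ) ⊗ₖ FluidModel.U σ (T θ) (c θ) s
    let IΞ := (1 : Matrix (Fin p) (Fin p) ℂ) ⊗ₖ Ξ θ
    let D := FluidModel.matDeriv (fun η => FluidModel.Qmp σ (T η) (c η) s) θ
      + FluidModel.matDeriv (fun η => FluidModel.Qmm σ (T η) (c η) s) θ * IΞ
      + Ξ θ * FluidModel.matDeriv (fun η => FluidModel.Qpp σ (T η) (c η) s) θ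
      + Ξ θ * (FluidModel.matDeriv (fun η => FluidModel.Qpm σ (T η) (c η) s) θ * IΞ)
    (∀ i j, DifferentiableAt ℝ (fun η => Ξ η i j) θ) ∧
      ∀ X : Matrix (FluidModel.SNeg σ) (Fin p × FluidModel.SPos σ) ℂ,
        A * X + X * B = -D ↔ X = FluidModel.matDeriv Ξ θ := by
  intro Ξ A B IΞ D
  have hΞ : ∀ i j, DifferentiableAt ℝ (fun η => Ξ η i j) θ :=
    FluidModel.differentiableAt_Xi hΘ hT hσ hθ hTd hcd hs
  have hmp := FluidModel.differentiableAt_Qmp hTd hcd (hT θ hθ) hs (hσ θ hθ)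
  have hmm := FluidModel.differentiableAt_Qmm hTd hcd (hT θ hθ) hs (hσ θ hθ)
  have hpp := FluidModel.differentiableAt_Qpp hTd hcd (hT θ hθ) hs (hσ θ hθ)
  have hpm := FluidModel.differentiableAt_Qpm hTd hcd (hT θ hθ) hs (hσ θ hθ)
  have hmmΞ := FluidModel.differentiableAt_mul_apply hmm hΞ
  have hpmΞ := FluidModel.differentiableAt_mul_apply hpm hΞ
  have hUd : ∀ i j, DifferentiableAt ℝ (fun η => FluidModel.U σ (T η) (c η) s i j) θ :=
    fun i j => (hpp i j).add (hpmΞ i j)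
  have hR : ∀ i j, DifferentiableAt ℝ (fun η => (FluidModel.Qmp σ (T η) (c η) s
      + FluidModel.Qmm σ (T η) (c η) s * Ξ η) i j) θ := fun i j => (hmp i j).add (hmmΞ i j)
  -- The Riccati equation holds on the open set Θ, hence near θ, and may be differentiated.
  have hzero : FluidModel.matDeriv (fun η => FluidModel.Qmp σ (T η) (c η) s
      + FluidModel.Qmm σ (T η) (c η) s * Ξ η + Ξ η * FluidModel.U σ (T η) (c η) s) θ = 0 := by
    ext i kj
    have h : (fun η => (FluidModel.Qmp σ (T η) (c η) s + FluidModel.Qmm σ (T η) (c η) s * Ξ η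
        + Ξ η * FluidModel.U σ (T η) (c η) s) i kj.2) =ᶠ[nhds θ] fun _ => 0 := by
      filter_upwards [hΘ.mem_nhds hθ] with η hη
      exact congrFun (congrFun (FluidModel.riccati_Xi (hT η hη) hs (hσ η hη)) i) kj.2
    rw [FluidModel.matDeriv, Matrix.of_apply, h.fderiv_eq, fderiv_fun_const]
    rfl
  have heq : A * FluidModel.matDeriv Ξ θ + FluidModel.matDeriv Ξ θ * B = -D := by
    rw [FluidModel.matDeriv_add hR
      (FluidModel.differentiableAt_mul_apply hΞ hUd), FluidModel.matDeriv_add hmp hmmΞ,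
      FluidModel.matDeriv_mul hmm hΞ, FluidModel.matDeriv_mul hΞ hUd] at hzero
    have hU : FluidModel.matDeriv (fun η => FluidModel.U σ (T η) (c η) s) θ =
        FluidModel.matDeriv (fun η => FluidModel.Qpp σ (T η) (c η) s) θ
        + (FluidModel.matDeriv (fun η => FluidModel.Qpm σ (T η) (c η) s) θ * IΞ
          + FluidModel.Qpm σ (T θ) (c θ) s * FluidModel.matDeriv Ξ θ) := by
      rw [← FluidModel.matDeriv_mul hpm hΞ, ← FluidModel.matDeriv_add hpp hpmΞ]
      rfl
    rw [hU] at hzero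
    -- The derivative of Ξ is multiplied on the left by Q₋₋ and, through ∂U, by ΞQ₊₋; these add up
    -- to J. On the right it is multiplied by I ⊗ U.
    rw [eq_neg_iff_add_eq_zero, ← hzero]
    simp only [A, B, D, IΞ, FluidModel.J, Matrix.mul_add, Matrix.add_mul, Matrix.mul_assoc, Ξ]
    abel
  refine ⟨hΞ, fun X => ⟨fun hX => ?_, fun hX => by rw [hX]; exact heq⟩⟩
  refine sub_eq_zero.1 (FluidModel.sylvester_kronecker_injective (hT θ hθ) hs (hσ θ hθ) ?_)
  rw [Matrix.mul_sub, Matrix.sub_mul, sub_add_sub_comm]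
  exact sub_eq_zero.2 (hX.trans heq.symm)

end
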